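/- All fields have characteristic $0$. A difference field $(F,\sigma)$ is a field $F$ with a field automorphism $\sigma$; $\mathrm{const}_\sigma F=\{c\in F:\sigma(c)=c\}$. A difference field extension $(F(t),\sigma)$ of $(F,\sigma)$ with $t$ transcendental over $F$ and $\mathrm{const}_\sigma F(t)=\mathrm{const}_\sigma F$ is a $\Sigma^*$-extension if $\sigma(t)=t+a$, and a $\Pi$-extension if $\sigma(t)=a\,t$, for some $a\in F\setminus\{0\}$; it is a $\Pi\Sigma^*$-extension if it is one of the two. A finite tower (possibly of length $0$) of $\Sigma^*$-extensions (resp. $\Pi\Sigma^*$-extensions) is again called a $\Sigma^*$-extension (resp. $\Pi\Sigma^*$-extension). Fix a ground difference field $(G,\sigma)$. For a $\Pi\Sigma^*$-extension $G(t_1)\dots(t_n)$ of $G$ with $\sigma(t_i)=t_i+a_i$ or $\sigma(t_i)=a_it_i$, the depth function $\delta$ is defined recursively by $\delta(t_i)=\delta(a_i)+1$ and $\delta(g)=\max(\{0\}\cup\{\delta(t_j): t_j \text{ occurs in } p \text{ or } q\})$, where $g=p/q$ with coprime $p,q\in G[t_1,\dots,t_n]$. If $F$ is a $\Pi\Sigma^*$-extension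 of $G$, the extension depth of a $\Pi\Sigma^*$-extension $F(x_1)\dots(x_r)$ of $F$ is $\max(0,\delta(x_1),\dots,\delta(x_r))$, the depth being taken over $G$. A $\Sigma^*$-extension $F(s)$ of $F$ with $\sigma(s)=s+f$ is depth-optimal if there is no $\Sigma^*$-extension of $F$ of extension depth $\le\delta(f)$ that contains a $g$ with $\sigma(g)-g=f$. A $\Pi\Sigma^*$-extension is a $\Pi\Sigma^\delta$-extension if all the $\Sigma^*$-extensions in its tower are depth-optimal; it is a $\Sigma^\delta$-extension if moreover all extensions in its tower are $\Sigma^*$-extensions. **Theorem.** Let $(F,\sigma)$ be a $\Pi\Sigma^\delta$-extension of $(G,\sigma)$, let $f\in F$, and let $E=F(s_1)\dots(s_e)$ be a $\Sigma^\delta$-extension of $F$ with extension depth $\mathfrak d$ that contains a $g$ with $$\sigma(g)-g=f.\qquad(*)$$ 1. For every $\Pi\Sigma^*$-extension $H$ of $F$ and every solution $g'\in H$ of $(*)$, $\delta(g)\le\delta(g')$. Hence $E$ and $g$ solve problem DOT if it is solvable: if some $\Sigma^*$-extension of $F$ contains a solution $g'$ of $(*)$ with $\delta(g')=\delta(f)$,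 then $E$ is a $\Sigma^*$-extension of $F$ and $\delta(g)=\delta(f)$. 2. Suppose that $\delta(s_e)=\mathfrak d$ and $g\notin F(s_1)\dots(s_{e-1})$ (no condition if $e=0$). Then every $\Pi\Sigma^*$-extension $H$ of $F$ that contains a solution of $(*)$ has extension depth $\ge\mathfrak d$. Hence $E$ and $g$ solve problem DOT$^*$: $E$ is a $\Sigma^*$-extension of $F$ containing a solution of $(*)$, with minimal extension depth among all such $\Sigma^*$-extensions of $F$. -/

import Mathlib

universe u

/-! ### Difference fields

A difference field is a field `F` with a field automorphism `σF : F ≃+* F`.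
An extension is given by an `F`-algebra `E`, which is a field, with an automorphism `σE`. -/

/-- `(E, σE)` is a difference field extension of `(F, σF)`. -/
def IsDiffExt {F E : Type u} [Field F] [Field E] [Algebra F E]
    (σF : F ≃+* F) (σE : E ≃+* E) : Prop :=
  ∀ x : F, σE (algebraMap F E x) = algebraMap F E (σF x)

/-- The subfield `F(t₀)…(tᵢ₋₁)` of `E` generated over `F` by the first `i` entries of `t`. -/
def belowField (F : Type u) {E : Type u} [Field F] [Field E] [Algebra F E] {n : ℕ}
    (t : Fin n → E) (i : ℕ) : IntermediateField F E :=
  IntermediateField.adjoin F {x | ∃ j : Fin n, (j : ℕ) < i ∧ t j = x}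

/-- The constants of `σ` in the intermediate field `K`. -/
def constIn {F E : Type u} [Field F] [Field E] [Algebra F E] (σ : E ≃+* E)
    (K : IntermediateField F E) : Set E :=
  {x | x ∈ K ∧ σ x = x}

/-- The `i`-th generator is a `Σ*`-extension of the field `F(t₀)…(tᵢ₋₁)` below it:
it is transcendental, `σ(tᵢ) = tᵢ + a` with `0 ≠ a ∈ F(t₀)…(tᵢ₋₁)`, and no constants are added. -/
def IsSigmaStarGen (F : Type u) {E : Type u} [Field F] [Field E] [Algebra F E] (σ : E ≃+* E)
    {n : ℕ} (t : Fin n → E) (i : Fin n) : Prop :=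
  Transcendental (belowField F t i) (t i) ∧
  (∃ a ∈ belowField F t i, a ≠ 0 ∧ σ (t i) = t i + a) ∧
  constIn σ (belowField F t (i + 1)) = constIn σ (belowField F t i)

/-- The `i`-th generator is a `Π`-extension of the field `F(t₀)…(tᵢ₋₁)` below it. -/
def IsPiGen (F : Type u) {E : Type u} [Field F] [Field E] [Algebra F E] (σ : E ≃+* E)
    {n : ℕ} (t : Fin n → E) (i : Fin n) : Prop :=
  Transcendental (belowField F t i) (t i) ∧
  (∃ a ∈ belowField F t i, a ≠ 0 ∧ σ (t i) = a * t i) ∧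
  constIn σ (belowField F t (i + 1)) = constIn σ (belowField F t i)

/-- `(E, σE)` with `E = F(t₀)…(tₙ₋₁)` is a `ΠΣ*`-extension of `(F, σF)`. -/
def IsPiSigmaStarExt {F E : Type u} [Field F] [Field E] [Algebra F E]
    (σF : F ≃+* F) (σE : E ≃+* E) {n : ℕ} (t : Fin n → E) : Prop :=
  IsDiffExt σF σE ∧ IntermediateField.adjoin F (Set.range t) = ⊤ ∧
  ∀ i, IsSigmaStarGen F σE t i ∨ IsPiGen F σE t i

/-- `(E, σE)` with `E = F(t₀)…(tₙ₋₁)` is a `Σ*`-extension of `(F, σF)`. -/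
def IsSigmaStarExt {F E : Type u} [Field F] [Field E] [Algebra F E]
    (σF : F ≃+* F) (σE : E ≃+* E) {n : ℕ} (t : Fin n → E) : Prop :=
  IsDiffExt σF σE ∧ IntermediateField.adjoin F (Set.range t) = ⊤ ∧
  ∀ i, IsSigmaStarGen F σE t i

/-! ### Depth

Everything below refers to a fixed ground field `G` and to towers `E = G(t₀)…(tₙ₋₁)` over `G`. -/

/-- The generator `tᵢ` occurs in the reduced representation of `g ∈ G(t₀)…(tₙ₋₁)`: `g = p / q` with
coprime `p, q ∈ G[t₀,…,tₙ₋₁]`, and `tᵢ` occurs in `p` or in `q`. (For algebraically independent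
`t` the pair `p, q` is unique up to a common factor from `G`.) -/
def Occurs (G : Type u) {E : Type u} [Field G] [Field E] [Algebra G E] {n : ℕ}
    (t : Fin n → E) (g : E) (i : Fin n) : Prop :=
  ∃ p q : MvPolynomial (Fin n) G, IsRelPrime p q ∧ MvPolynomial.aeval t q ≠ 0 ∧
    g = MvPolynomial.aeval t p / MvPolynomial.aeval t q ∧ (i ∈ p.vars ∨ i ∈ q.vars)

open Classical in
/-- The `aᵢ` with `σ(tᵢ) = tᵢ + aᵢ` (for `Σ*`-extensions) or `σ(tᵢ) = aᵢ tᵢ` (for `Π`-extensions). -/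
noncomputable def genCoeff (G : Type u) {E : Type u} [Field G] [Field E] [Algebra G E]
    (σ : E ≃+* E) {n : ℕ} (t : Fin n → E) (i : Fin n) : E :=
  if σ (t i) - t i ∈ belowField G t i then σ (t i) - t i else σ (t i) / t i

open Classical in
/-- The depth `δ(tᵢ) = δ(aᵢ) + 1` of a generator, where `δ(aᵢ)` is the maximal depth of the
generators that occur in `aᵢ`, or `0` if there are none. (As `aᵢ ∈ G(t₀)…(tᵢ₋₁)`, only `tⱼ` with
`j < i` can occur in `aᵢ`.) -/
noncomputable def genDepth (G : Type u) {E : Type u} [Field G] [Field E] [Algebra G E]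
    (σ : E ≃+* E) {n : ℕ} (t : Fin n → E) (i : Fin n) : ℕ :=
  (Finset.univ.sup fun j : Fin n =>
    if _h : j < i ∧ Occurs G t (genCoeff G σ t i) j then genDepth G σ t j else 0) + 1
termination_by i.val
decreasing_by exact _h.1

open Classical in
/-- The depth `δ(g)` over `G` of an element `g ∈ G(t₀)…(tₙ₋₁)`. -/
noncomputable def elemDepth (G : Type u) {E : Type u} [Field G] [Field E] [Algebra G E]
    (σ : E ≃+* E) {n : ℕ} (t : Fin n → E) (g : E) : ℕ :=
  Finset.univ.sup fun j : Fin n => if Occurs G t g j then genDepth G σ t j else 0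

/-- If `F = G(t₀)…(tₙ₋₁)` and `E = F(s₀)…(sₘ₋₁)`, the generators
`t₀,…,tₙ₋₁,s₀,…,sₘ₋₁` of `E` over `G`. -/
def towerAppend {F E : Type u} [Field F] [Field E] [Algebra F E] {n m : ℕ}
    (t : Fin n → F) (s : Fin m → E) : Fin (n + m) → E :=
  Fin.append (fun j => algebraMap F E (t j)) s

/-- The extension depth of `E = F(s₀)…(sₘ₋₁)` over `F = G(t₀)…(tₙ₋₁)`: the maximum of `0` and
the depths over `G` of the `sᵢ`. -/
noncomputable def extDepth (G : Type u) {F E : Type u} [Field G] [Field F] [Field E] [Algebra G E]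
    [Algebra F E] (σE : E ≃+* E) {n m : ℕ} (t : Fin n → F) (s : Fin m → E) : ℕ :=
  Finset.univ.sup fun i : Fin m => genDepth G σE (towerAppend t s) (Fin.natAdd n i)

/-! ### Depth-optimal extensions -/

/-- For `K = G(t₀)…(tₙ₋₁)` and `f ∈ K`: there is a `Σ*`-extension `(L, τ)` of `(K, σ)` of
extension depth `≤ δ(f)` that contains a solution `g` of `τ(g) - g = f`. -/
def HasShallowSolution (G : Type u) {K : Type u} [Field G] [Field K] [Algebra G K]
    (σ : K ≃+* K) {n : ℕ} (t : Fin n → K) (f : K) : Prop :=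
  ∃ (L : Type u) (_ : Field L) (_ : Algebra G L) (_ : Algebra K L) (_ : IsScalarTower G K L)
    (τ : L ≃+* L) (r : ℕ) (x : Fin r → L),
    IsSigmaStarExt σ τ x ∧ extDepth G τ t x ≤ elemDepth G σ t f ∧
    ∃ g : L, τ g - g = algebraMap K L f

/-- The first `i` generators of a tower over `G`, as elements of the field they generate. -/
def truncTower (G : Type u) {E : Type u} [Field G] [Field E] [Algebra G E] {n : ℕ}
    (t : Fin n → E) (i : Fin n) : Fin i → belowField G t i :=
  fun j => ⟨t ⟨j, j.isLt.trans i.isLt⟩,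
    IntermediateField.subset_adjoin G _ ⟨⟨j, j.isLt.trans i.isLt⟩, j.isLt, rfl⟩⟩

/-- In the tower `E = G(t₀)…(tₙ₋₁)`, the generator `tᵢ`, with `σ(tᵢ) = tᵢ + f`, is depth-optimal
over the difference field `K = G(t₀)…(tᵢ₋₁)` below it (`σK` is the restriction of `σ` to `K`). -/
def IsDepthOptimalGen (G : Type u) {E : Type u} [Field G] [Field E] [Algebra G E]
    (σ : E ≃+* E) {n : ℕ} (t : Fin n → E) (i : Fin n) : Prop :=
  ∃ σK : belowField G t i ≃+* belowField G t i,
    (∀ y : belowField G t i, ((σK y : belowField G t i) : E) = σ (y : E)) ∧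
    ∃ f : belowField G t i, σ (t i) = t i + (f : E) ∧
      ¬ HasShallowSolution G σK (truncTower G t i) f

/-- `F = G(t₀)…(tₙ₋₁)` is a depth-optimal `ΠΣ*`-extension (a `ΠΣ^δ`-extension) of `G`. -/
def IsPiSigmaDeltaExt {G F : Type u} [Field G] [Field F] [Algebra G F]
    (σG : G ≃+* G) (σF : F ≃+* F) {n : ℕ} (t : Fin n → F) : Prop :=
  IsPiSigmaStarExt σG σF t ∧ ∀ i, IsSigmaStarGen G σF t i → IsDepthOptimalGen G σF t i

/-- `E = F(s₀)…(sₘ₋₁)` is a depth-optimal `Σ*`-extension (a `Σ^δ`-extension) of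
`F = G(t₀)…(tₙ₋₁)`; the depth is taken over `G`. -/
def IsSigmaDeltaExt (G : Type u) {F E : Type u} [Field G] [Field F] [Field E] [Algebra G E]
    [Algebra F E] (σF : F ≃+* F) (σE : E ≃+* E) {n m : ℕ} (t : Fin n → F) (s : Fin m → E) : Prop :=
  IsSigmaStarExt σF σE s ∧ ∀ i : Fin m, IsDepthOptimalGen G σE (towerAppend t s) (Fin.natAdd n i)

/-! ### The two telescoping problems -/

/-- The `Σ*`-extension `E = F(s₀)…(sₘ₋₁)` of `F = G(t₀)…(tₙ₋₁)` with `g ∈ E` is a solution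
of the problem of depth optimal telescoping (DOT) for `f ∈ F`. -/
def SolvesDOT (G : Type u) {F E : Type u} [Field G] [Field F] [Field E] [Algebra G F] [Algebra G E]
    [Algebra F E] (σF : F ≃+* F) (σE : E ≃+* E) {n m : ℕ} (t : Fin n → F) (s : Fin m → E)
    (f : F) (g : E) : Prop :=
  IsSigmaStarExt σF σE s ∧ σE g - g = algebraMap F E f ∧
  elemDepth G σE (towerAppend t s) g = elemDepth G σF t f

/-- The `Σ*`-extension `E = F(s₀)…(sₘ₋₁)` of `F = G(t₀)…(tₙ₋₁)` with `g ∈ E` is a solution of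
the problem DOT* for `f ∈ F`: it contains the solution `g` of `σ(g) - g = f`, and its extension
depth is minimal among the `Σ*`-extensions of `F` that contain a solution. -/
def SolvesDOTStar (G : Type u) {F E : Type u} [Field G] [Field F] [Field E] [Algebra G F]
    [Algebra G E] [Algebra F E] (σF : F ≃+* F) (σE : E ≃+* E) {n m : ℕ} (t : Fin n → F)
    (s : Fin m → E) (f : F) (g : E) : Prop :=
  IsSigmaStarExt σF σE s ∧ σE g - g = algebraMap F E f ∧
  ∀ (H : Type u) [Field H] [Algebra G H] [Algebra F H] [IsScalarTower G F H] (σH : H ≃+* H)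
    (r : ℕ) (x : Fin r → H), IsSigmaStarExt σF σH x →
    (∃ g' : H, σH g' - g' = algebraMap F H f) → extDepth G σE t s ≤ extDepth G σH t x

/-! Embed `E` and a competing extension `H` into one difference field `U` over `F` without new
constants; this is possible because `E` is built from sums only
(`IsSigmaStarExt.exists_joint_extension`). In `U` the solutions `g` and `g'` differ by a constant,
and all constants lie in `G`. It remains to compare depths inside `U`.

For this, `U` carries a tower `A₀ = G ≤ A₁ ≤ …` (`sumTower`): `Aₖ₊₁` arises from `Aₖ` by adjoining
every element of `U` that is a sum over `Aₖ`, and those products over `Aₖ` that are generators of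
`H` of depth `≤ k + 1`. Elements of `H` of depth `≤ k` lie in `Aₖ`. The core claim is that the
generators of `E` of depth `> k` stay independent over `Aₖ` (`Filtr.Good`), so that elements of `E`
lying in `Aₖ` have depth `≤ k`. With `k = δ(g')` this is the first minimality statement. For the
second, let `B` be the field below the last generator `sₑ`, of depth `k + 1`. If `H` had extension
depth `≤ k`, then `g` would lie in `B·Aₖ` and in `B(sₑ)`, hence in `B`.

Independence is proved generator by generator. For products it holds because adjoining sums creates
no new solutions of `σ(u) = αu`. For a sum `t` over `K` with `σ(t) = t + f` and `δ(f) = k`, failure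
of independence means `t ∈ K·Aₖ`. Then `Filtr.exists_sumExt_mem` puts `t` into an extension of `K`
by sums of depth `≤ k`, which contradicts depth-optimality.

That reduction is an induction on the level. By Karr's structure theorem, an element of `K·Aₖ₊₁`
that telescopes into `K` is `x + w` with `x` a sum over `Aₖ` and `w ∈ K·Aₖ`. Expanding `w` in the
generators of `K` that are independent over `Aₖ` (`Filtr.exists_sumExt_add`) gives `w = w' + a`,
where `w'` lies in an extension `L` of `K` by sums of level `≤ k` and `a ∈ Aₖ`. The difference `σ(x
+ a) - (x + a)` lies in `Aₖ ∩ L`, which is the `k`-th level of `L`, so `x + a` can be adjoined to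
`L` as a sum of level `k + 1`. -/

open Polynomial

/-! ### Stable subfields and polynomials under the shift `z ↦ z + b`. -/

section Karr

variable {U : Type*} [Field U]

/-- The subfield `N` is mapped into itself by `σ`. -/
def SigmaStable (σ : U →+* U) (N : Subfield U) : Prop := ∀ x ∈ N, σ x ∈ N

/-- The restriction of `σ` to a stable subfield. -/
def SigmaStable.res {σ : U →+* U} {N : Subfield U} (h : SigmaStable σ N) : N →+* N :=
  σ.restrict N N h

@[simp] theorem SigmaStable.coe_res {σ : U →+* U} {N : Subfield U} (h : SigmaStable σ N) (x : N) :
    ((h.res x : N) : U) = σ x := rfl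

theorem le_sup_closure (N : Subfield U) (S : Set U) : N ≤ N ⊔ Subfield.closure S := le_sup_left

theorem mem_sup_closure {N : Subfield U} {S : Set U} {x : U} (hx : x ∈ S) :
    x ∈ N ⊔ Subfield.closure S :=
  (le_sup_right : Subfield.closure S ≤ _) (Subfield.subset_closure hx)

theorem mem_sup_closure_singleton {N : Subfield U} {x : U} : x ∈ N ⊔ Subfield.closure {x} :=
  mem_sup_closure rfl

theorem sup_closure_le {N M : Subfield U} {S : Set U} (h : N ≤ M) (hS : S ⊆ M) :
    N ⊔ Subfield.closure S ≤ M :=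
  sup_le h (Subfield.closure_le.2 hS)

theorem adjoin_toSubfield (N : Subfield U) (S : Set U) :
    (IntermediateField.adjoin N S).toSubfield = N ⊔ Subfield.closure S := by
  change Subfield.closure _ = _
  rw [Subfield.closure_union]
  congr 1
  have : Set.range (algebraMap N U) = (N : Set U) := by
    ext x; constructor
    · rintro ⟨y, rfl⟩; exact y.2
    · intro hx; exact ⟨⟨x, hx⟩, rfl⟩
  rw [this, Subfield.closure_eq]

theorem exists_aeval_of_mem {N : Subfield U} {z w : U} (hw : w ∈ N ⊔ Subfield.closure {z}) :
    ∃ p q : N[X], aeval z q ≠ 0 ∧ w * aeval z q = aeval z p := by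
  rw [← adjoin_toSubfield] at hw
  obtain ⟨r, s, h⟩ := (IntermediateField.mem_adjoin_simple_iff N w).1 hw
  by_cases hs : aeval z s = 0
  · refine ⟨0, 1, by simp, ?_⟩
    rw [h, hs]; simp
  · exact ⟨r, s, hs, by rw [h]; field_simp⟩

theorem sigma_aeval {σ : U →+* U} {N : Subfield U} (hN : SigmaStable σ N) (z : U) (p : N[X]) :
    σ (aeval z p) = aeval (σ z) (p.map hN.res) := by
  rw [aeval_def, hom_eval₂, aeval_def, eval₂_map]
  rfl

theorem aeval_add_const {N : Subfield U} (z : U) (b : N) (p : N[X]) :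
    aeval (z + (b : U)) p = aeval z (taylor b p) := by
  rw [taylor_apply, aeval_comp]
  simp
  rfl

theorem SigmaStable.sup_closure {σ : U →+* U} {N : Subfield U} (hN : SigmaStable σ N) {S : Set U}
    (hS : ∀ x ∈ S, σ x ∈ N ⊔ Subfield.closure S) : SigmaStable σ (N ⊔ Subfield.closure S) := by
  have : N ⊔ Subfield.closure S ≤ (N ⊔ Subfield.closure S).comap σ :=
    sup_closure_le (fun x hx => le_sup_closure _ _ (hN x hx)) hS
  exact this

theorem SigmaStable.sup {σ : U →+* U} {N M : Subfield U} (hN : SigmaStable σ N)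
    (hM : SigmaStable σ M) : SigmaStable σ (N ⊔ M) := by
  have : N ⊔ M ≤ (N ⊔ M).comap σ :=
    sup_le (fun x hx => (le_sup_left : N ≤ N ⊔ M) (hN x hx))
      (fun x hx => (le_sup_right : M ≤ N ⊔ M) (hM x hx))
  exact this

theorem SigmaStable.adjoin_sum {σ : U →+* U} {N : Subfield U} (hN : SigmaStable σ N) {z : U}
    (hz : σ z - z ∈ N) : SigmaStable σ (N ⊔ Subfield.closure {z}) := by
  refine hN.sup_closure ?_
  rintro x rfl
  have := add_mem (le_sup_closure N {x} hz) (mem_sup_closure_singleton (N := N) (x := x))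
  simpa using this

theorem transcendental_mono {N M : Subfield U} (h : N ≤ M) {z : U} (hz : Transcendental M z) :
    Transcendental N z := by
  intro hz'
  apply hz
  obtain ⟨p, hp, h0⟩ := hz'
  refine ⟨p.map (Subfield.inclusion h), ?_, ?_⟩
  · rwa [Polynomial.map_ne_zero_iff (Subfield.inclusion h).injective]
  · rw [aeval_def, eval₂_map]
    exact h0

theorem not_transcendental_of_mem {N : Subfield U} {z : U} (hz : z ∈ N) : ¬ Transcendental N z :=
  fun h => h (isAlgebraic_algebraMap (⟨z, hz⟩ : N))

theorem coeff_taylor_pred {K : Type*} [Field K] (b : K) (p : K[X]) {n : ℕ}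
    (hn : p.natDegree = n + 1) :
    (taylor b p).coeff n = p.coeff n + (n + 1) * b * p.coeff (n + 1) := by
  have hd : (hasseDeriv n p).natDegree < 2 :=
    lt_of_le_of_lt (natDegree_hasseDeriv_le p n) (by omega)
  rw [taylor_coeff, eval_eq_sum_range' hd]
  simp [Finset.sum_range_succ, hasseDeriv_coeff]
  rw [add_comm 1 n]
  simp [Nat.choose_succ_self_right]
  ring

theorem coeff_taylor_top {K : Type*} [Field K] (b : K) (p : K[X]) {n : ℕ}
    (hn : p.natDegree = n) : (taylor b p).coeff n = p.coeff n := by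
  subst hn; exact coeff_taylor_natDegree b p

/-- If the two top coefficients of `p` satisfy `p^s(X + b) = u p`, then `b` telescopes. -/
theorem telescope_of_top_coeffs {K : Type*} [Field K] [CharZero K] (s : K →+* K) (b u : K) (p : K[X])
    {n : ℕ} (hn : p.natDegree = n + 1)
    (h1 : (taylor b (p.map s)).coeff (n + 1) = u * p.coeff (n + 1))
    (h0 : (taylor b (p.map s)).coeff n = u * p.coeff n) : ∃ v, s v - v = b := by
  have hn' : (p.map s).natDegree = n + 1 := by rw [natDegree_map, hn]
  rw [coeff_taylor_top b _ hn', coeff_map] at h1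
  rw [coeff_taylor_pred b _ hn', coeff_map, coeff_map, h1] at h0
  have hc : p.coeff (n + 1) ≠ 0 := by
    rw [← hn]; exact leadingCoeff_ne_zero.2 (by rintro rfl; simp at hn)
  have hu : u ≠ 0 := by
    rintro rfl
    rw [zero_mul] at h1
    exact hc ((map_eq_zero s).1 h1)
  have hnn : (n : K) + 1 ≠ 0 := by exact_mod_cast Nat.succ_ne_zero n
  -- The coefficient of `Xⁿ` gives `s(pₙ) + (n + 1) b s(pₙ₊₁) = u pₙ`, while `s(pₙ₊₁) = u pₙ₊₁`;
  -- solving for `b` shows the telescoper.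
  refine ⟨-(p.coeff n / ((n + 1) * p.coeff (n + 1))), ?_⟩
  rw [map_neg, map_div₀, map_mul, h1]
  have : s (p.coeff n) = u * p.coeff n - (n + 1) * b * (u * p.coeff (n + 1)) := by
    rw [← h0]; ring
  rw [this]
  simp
  field_simp
  ring

end Karr

/-! ### Karr's structure theorems for sums and products. -/

section Karr

variable {U : Type*} [Field U] [CharZero U] {σ : U →+* U} {N : Subfield U}

/-- A solution of a telescoping equation that is algebraic over `N` lies in `N`. -/
theorem mem_of_sum_of_not_transcendental (hN : SigmaStable σ N) (hC : ∀ x, σ x = x → x ∈ N) {z : U}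
    (hz : σ z - z ∈ N) (halg : ¬ Transcendental N z) : z ∈ N := by
  have hint : IsIntegral N z := (not_not.1 halg).isIntegral
  set b : N := ⟨σ z - z, hz⟩ with hb
  have hσz : σ z = z + (b : U) := by simp [hb]
  set m := minpoly N z with hm
  have hmon : m.Monic := minpoly.monic hint
  obtain ⟨n, hn⟩ : ∃ n, m.natDegree = n + 1 :=
    Nat.exists_eq_succ_of_ne_zero (minpoly.natDegree_pos hint).ne'
  -- `m^σ(X + b)` is monic of the degree of `m` and kills `z`, so it is `m`. Its two top
  -- coefficients then yield `v ∈ N` with the same difference as `z`, and `z - v` is a constant.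
  have h0 : aeval z (taylor b (m.map hN.res)) = 0 := by
    rw [← aeval_add_const, ← hσz, ← sigma_aeval hN, hm, minpoly.aeval, map_zero]
  have hdeg : (taylor b (m.map hN.res)).natDegree = n + 1 := by
    rw [natDegree_taylor, natDegree_map, hn]
  have hmon' : (taylor b (m.map hN.res)).Monic := by
    rw [Monic, leadingCoeff_taylor]
    exact hmon.map _
  have heq : taylor b (m.map hN.res) = m :=
    eq_of_monic_of_dvd_of_natDegree_le hmon hmon' (minpoly.dvd _ _ h0) (by rw [hdeg, hn])
  obtain ⟨v, hv⟩ := telescope_of_top_coeffs hN.res b 1 m hn (by rw [heq, one_mul])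
    (by rw [heq, one_mul])
  have hc : z - v ∈ N := by
    apply hC
    have : σ v = v + b := by
      have := congrArg (Subtype.val) hv
      simp at this
      rw [← this]; ring
    rw [map_sub, hσz, this]; ring
  simpa using N.add_mem hc v.2

-- If `m` is the minimal polynomial of `z`, of degree `d`, then `m^σ(aX)` kills `z` as well and must
-- be `aᵈ m`. Hence `m₀` and `zᵈ` both satisfy `σ(x) = aᵈ x`, and their quotient is a constant.
omit [CharZero U] in
theorem exists_pow_mem_of_not_transcendental (hN : SigmaStable σ N) (hC : ∀ x, σ x = x → x ∈ N)
    {z a : U} (ha : a ∈ N) (hz : σ z = a * z) (halg : ¬ Transcendental N z) :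
    ∃ m : ℕ, 0 < m ∧ z ^ m ∈ N := by
  by_cases hz0 : z = 0
  · exact ⟨1, one_pos, by simp [hz0]⟩
  have hint : IsIntegral N z := (not_not.1 halg).isIntegral
  have ha0 : a ≠ 0 := by
    rintro rfl
    rw [zero_mul] at hz
    exact hz0 ((map_eq_zero σ).1 hz)
  set a' : N := ⟨a, ha⟩ with ha'
  have ha'0 : a' ≠ 0 := fun h => ha0 (congrArg Subtype.val h)
  set m := minpoly N z with hm
  have hmon : m.Monic := minpoly.monic hint
  set t := (m.map hN.res).comp (C a' * X) with ht
  have h0 : aeval z t = 0 := by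
    rw [ht, aeval_comp]
    have : (aeval z) (C a' * X) = σ z := by rw [map_mul, aeval_C, aeval_X, hz]; rfl
    rw [this, ← sigma_aeval hN, hm, minpoly.aeval, map_zero]
  have hdeg : t.natDegree = m.natDegree := by
    rw [ht, natDegree_comp, natDegree_C_mul_X _ ha'0, natDegree_map, mul_one]
  have heq := eq_leadingCoeff_mul_of_monic_of_dvd_of_natDegree_le hmon (minpoly.dvd _ _ h0) hdeg.le
  have hlead : t.leadingCoeff = a' ^ m.natDegree := by
    rw [leadingCoeff, hdeg, ht, comp_C_mul_X_coeff, coeff_map, hmon.coeff_natDegree]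
    simp
  have hc0 : hN.res (m.coeff 0) = a' ^ m.natDegree * m.coeff 0 := by
    have := congrArg (fun p => coeff p 0) heq
    simp only [coeff_C_mul, hlead] at this
    rw [← this, ht, comp_C_mul_X_coeff, coeff_map]
    simp
  have hm0 : m.coeff 0 ≠ 0 := minpoly.coeff_zero_ne_zero hint hz0
  have hm0' : ((m.coeff 0 : N) : U) ≠ 0 := fun h => hm0 (Subtype.ext h)
  refine ⟨m.natDegree, minpoly.natDegree_pos hint, ?_⟩
  have hconst : (m.coeff 0 : U) / z ^ m.natDegree ∈ N := by
    apply hC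
    have h1 : σ (m.coeff 0 : U) = a ^ m.natDegree * (m.coeff 0 : U) := by
      have := congrArg Subtype.val hc0
      simpa using this
    rw [map_div₀, h1, map_pow, hz, mul_pow]
    field_simp
  have := N.div_mem (m.coeff 0).2 hconst
  rwa [div_div_cancel₀ hm0'] at this

omit [CharZero U] in
theorem exists_coprime_of_mem {z w : U} (hz : Transcendental N z)
    (hw : w ∈ N ⊔ Subfield.closure {z}) :
    ∃ p q : N[X], IsCoprime p q ∧ q.Monic ∧ aeval z q ≠ 0 ∧ w * aeval z q = aeval z p := by
  classical
  obtain ⟨p, q, hq, h⟩ := exists_aeval_of_mem hw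
  have hinj := transcendental_iff_injective.1 hz
  have hq0 : q ≠ 0 := by rintro rfl; simp at hq
  obtain ⟨p₁, hp₁⟩ := EuclideanDomain.gcd_dvd_left p q
  obtain ⟨q₁, hq₁⟩ := EuclideanDomain.gcd_dvd_right p q
  have hg0 : EuclideanDomain.gcd p q ≠ 0 := fun h => hq0 (EuclideanDomain.gcd_eq_zero_iff.1 h).2
  have hcop : IsCoprime p₁ q₁ := by
    have := EuclideanDomain.gcd_eq_gcd_ab p q
    refine ⟨EuclideanDomain.gcdA p q, EuclideanDomain.gcdB p q, mul_left_cancel₀ hg0 ?_⟩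
    rw [mul_one]
    calc _ = (EuclideanDomain.gcd p q * p₁) * EuclideanDomain.gcdA p q +
          (EuclideanDomain.gcd p q * q₁) * EuclideanDomain.gcdB p q := by ring
      _ = _ := by rw [← hp₁, ← hq₁, ← this]
  generalize EuclideanDomain.gcd p q = g at *
  subst hp₁ hq₁
  have hgz : aeval z g ≠ 0 := fun h => hg0 (hinj (by rw [h, map_zero]))
  have hq10 : q₁ ≠ 0 := by rintro rfl; simp at hq0
  have hl : q₁.leadingCoeff⁻¹ ≠ 0 := inv_ne_zero (leadingCoeff_ne_zero.2 hq10)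
  have hu : IsUnit (C q₁.leadingCoeff⁻¹) := isUnit_C.2 hl.isUnit
  refine ⟨C q₁.leadingCoeff⁻¹ * p₁, C q₁.leadingCoeff⁻¹ * q₁, ?_, ?_, ?_, ?_⟩
  · exact (isCoprime_mul_unit_left hu _ _).2 hcop
  · rw [mul_comm]; exact monic_mul_leadingCoeff_inv hq10
  · intro h0
    have := hinj (h0.trans (map_zero _).symm)
    exact (mul_ne_zero hu.ne_zero hq10) this
  · rw [map_mul, map_mul] at h
    rw [map_mul, map_mul]
    have : w * aeval z q₁ = aeval z p₁ := mul_left_cancel₀ hgz (by rw [← h]; ring)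
    rw [← this]; ring

/-- Rational solutions of `σ(w) = u w + f` in an extension `N(z)` with `σ(z) = z + b` are
polynomials of degree at most one. -/
theorem exists_aeval_of_first_order (hN : SigmaStable σ N) {z b u f w : U} (hb : b ∈ N)
    (hz : σ z = z + b) (hzt : Transcendental N z) (hno : ∀ v ∈ N, σ v - v ≠ b)
    (hw : w ∈ N ⊔ Subfield.closure {z}) (hu : u ∈ N) (hu0 : u ≠ 0) (hf : f ∈ N)
    (h : σ w = u * w + f) :
    ∃ p : N[X], w = aeval z p ∧ p.natDegree ≤ 1 ∧ (f = 0 → p.natDegree = 0) := by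
  obtain ⟨p, q, hcop, hqm, hqz, hpq⟩ := exists_coprime_of_mem hzt hw
  have hinj := transcendental_iff_injective.1 hzt
  lift b to N using hb
  lift u to N using hu
  lift f to N using hf
  have hu0' : u ≠ 0 := by rintro rfl; simp at hu0
  have hno' : ∀ v : N, hN.res v - v ≠ b := fun v hv => hno v v.2 (congrArg Subtype.val hv)
  let tr : N[X] →+* N[X] := (taylorAlgHom b).toRingHom.comp (mapRingHom hN.res)
  have htr : ∀ r : N[X], tr r = taylor b (r.map hN.res) := fun r => rfl
  have hσ : ∀ r : N[X], σ (aeval z r) = aeval z (tr r) := fun r => by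
    rw [sigma_aeval hN, hz, aeval_add_const, htr]
  have hCu : ∀ c : N, aeval z (C c) = (c : U) := fun c => by rw [aeval_C]; rfl
  -- The equation for `w = p / q` with denominators cleared. Since `tr p` and `tr q` are coprime,
  -- `tr q` divides `q`, and equal degrees force `tr q = q`.
  have key : tr p * q = (C u * p + C f * q) * tr q := by
    apply hinj
    have h1 := congrArg σ hpq
    rw [map_mul, hσ, hσ, h] at h1
    simp only [map_mul, map_add, hCu]
    rw [← h1, ← hpq]; ring
  have hdvd : tr q ∣ q := by
    have hc : IsCoprime (tr p) (tr q) := hcop.map tr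
    exact hc.symm.dvd_of_dvd_mul_left ⟨_, key.trans (mul_comm _ _)⟩
  have hqdeg : (tr q).natDegree = q.natDegree := by rw [htr, natDegree_taylor, natDegree_map]
  have htrm : (tr q).Monic := by
    rw [htr, Monic, leadingCoeff_taylor]; exact hqm.map _
  have htrq : tr q = q :=
    (eq_of_monic_of_dvd_of_natDegree_le htrm hqm hdvd hqdeg.ge).symm
  have hq1 : q = 1 := by
    rcases Nat.eq_zero_or_eq_succ_pred q.natDegree with h0 | h0
    · exact hqm.natDegree_eq_zero.1 h0
    -- A nonconstant polynomial invariant under `tr` would telescope `b` within `N`.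
    · exfalso
      obtain ⟨v, hv⟩ := telescope_of_top_coeffs hN.res b 1 q h0 (by rw [← htr, htrq, one_mul])
        (by rw [← htr, htrq, one_mul])
      exact hno' v hv
  subst hq1
  simp only [map_one, mul_one] at key hpq
  -- The inhomogeneous part `f` only affects the constant coefficient, so the two top coefficients
  -- are compared undisturbed unless `n = 0` and `f ≠ 0`.
  have hdeg : ∀ n, p.natDegree = n + 1 → (n ≠ 0 ∨ f = 0) → False := by
    intro n hn hnf
    have hc : ∀ k, (k ≠ 0 ∨ f = 0) → (tr p).coeff k = u * p.coeff k := by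
      intro k hk
      rw [key, coeff_add, coeff_C_mul, coeff_C]
      rcases hk with hk | hk <;> simp [hk]
    obtain ⟨v, hv⟩ := telescope_of_top_coeffs hN.res b u p hn
      (by rw [← htr, hc _ (Or.inl (Nat.succ_ne_zero n))]) (by rw [← htr, hc _ hnf])
    exact hno' v hv
  refine ⟨p, hpq, ?_, ?_⟩
  · by_contra hlt
    exact hdeg (p.natDegree - 1) (by omega) (Or.inl (by omega))
  · intro hf0
    by_contra hlt
    exact hdeg (p.natDegree - 1) (by omega) (Or.inr (Subtype.ext hf0))

theorem not_telescope_of_not_mem (hC : ∀ x, σ x = x → x ∈ N) {z : U} (hz : z ∉ N) :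
    ∀ v ∈ N, σ v - v ≠ σ z - z := by
  intro v hv h
  apply hz
  have : z - v ∈ N := hC _ (by rw [map_sub]; linear_combination -h)
  simpa using N.add_mem this hv

theorem transcendental_of_sum (hN : SigmaStable σ N) (hC : ∀ x, σ x = x → x ∈ N) {z : U}
    (hz : σ z - z ∈ N) (hzN : z ∉ N) : Transcendental N z := by
  by_contra h
  exact hzN (mem_of_sum_of_not_transcendental hN hC hz h)

/-- The homogeneous case of `exists_aeval_of_first_order`: the solution has degree `0` in `z`. Thus
adjoining a sum creates no new solutions of `σ(h) = αh`. -/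
theorem mem_of_hyperexponential (hN : SigmaStable σ N) (hC : ∀ x, σ x = x → x ∈ N) {z h α : U}
    (hz : σ z - z ∈ N) (hα : α ∈ N) (hh : h ∈ N ⊔ Subfield.closure {z}) (hσ : σ h = α * h) :
    h ∈ N := by
  by_cases hzN : z ∈ N
  · exact sup_closure_le le_rfl (by simpa using hzN) hh
  by_cases hα0 : α = 0
  · rw [hα0, zero_mul] at hσ
    rw [(map_eq_zero σ).1 hσ]; exact N.zero_mem
  obtain ⟨p, hp, -, h0⟩ := exists_aeval_of_first_order hN hz (by ring)
    (transcendental_of_sum hN hC hz hzN) (not_telescope_of_not_mem hC hzN) hh hα hα0 N.zero_mem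
    (by rw [hσ, add_zero])
  rw [hp, eq_C_of_natDegree_eq_zero (h0 rfl), aeval_C]
  exact (p.coeff 0).2

theorem sup_closure_insert {U : Type*} [Field U] (N : Subfield U) (a : U) (S : Set U) :
    N ⊔ Subfield.closure (insert a S) = (N ⊔ Subfield.closure S) ⊔ Subfield.closure {a} := by
  rw [Set.insert_eq, Subfield.closure_union, sup_comm (Subfield.closure {a}), sup_assoc]

theorem exists_finset_of_mem_sup_closure {U : Type*} [Field U] {N : Subfield U} {S : Set U} {x : U}
    (hx : x ∈ N ⊔ Subfield.closure S) :
    ∃ T : Finset U, ↑T ⊆ S ∧ x ∈ N ⊔ Subfield.closure (T : Set U) := by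
  rw [← adjoin_toSubfield] at hx
  obtain ⟨T, hT, h⟩ := IntermediateField.exists_finset_of_mem_adjoin hx
  exact ⟨T, hT, by rw [← adjoin_toSubfield]; exact h⟩

theorem mem_of_hyperexponential_of_sums (hN : SigmaStable σ N) (hC : ∀ x, σ x = x → x ∈ N)
    {S : Set U} (hS : ∀ x ∈ S, σ x - x ∈ N) {h α : U} (hα : α ∈ N)
    (hh : h ∈ N ⊔ Subfield.closure S) (hσ : σ h = α * h) : h ∈ N := by
  classical
  obtain ⟨T, hT, hh⟩ := exists_finset_of_mem_sup_closure hh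
  induction T using Finset.induction_on with
  | empty => simpa using hh
  | insert a T _ ih =>
    rw [Finset.coe_insert] at hT hh
    rw [sup_closure_insert] at hh
    have hTS : (T : Set U) ⊆ S := fun x hx => hT (Set.mem_insert_of_mem _ hx)
    refine ih hTS (mem_of_hyperexponential (z := a) ?_ ?_ ?_ ?_ hh hσ)
    · refine hN.sup_closure fun x hx => ?_
      have := add_mem (le_sup_closure N T (hS x (hTS hx))) (mem_sup_closure (N := N) hx)
      simpa using this
    · exact fun x hx => le_sup_closure _ _ (hC x hx)
    · exact le_sup_closure _ _ (hS a (hT (Set.mem_insert _ _)))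
    · exact le_sup_closure _ _ hα

/-- Products do not contribute to telescoping solutions. -/
theorem mem_of_sum_of_product (hN : SigmaStable σ N) (hC : ∀ x, σ x = x → x ∈ N) {z g a : U}
    (ha : a ∈ N) (hz : σ z = a * z) (hg : g ∈ N ⊔ Subfield.closure {z}) (hg' : σ g - g ∈ N) :
    g ∈ N := by
  by_contra hgN
  have hgt := transcendental_of_sum hN hC hg' hgN
  -- Writing `g = p(z) / q(z)`, the polynomial `p - g q` kills `z`. If it were zero, comparing the
  -- coefficients at the degree of `q` would give `g ∈ N`.
  have halg : ¬ Transcendental (N ⊔ Subfield.closure {g} : Subfield U) z := by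
    intro hzt
    obtain ⟨p, q, hq, h⟩ := exists_aeval_of_mem hg
    have hle : N ≤ N ⊔ Subfield.closure {g} := le_sup_left
    set M := N ⊔ Subfield.closure {g} with hM
    set g' : M := ⟨g, mem_sup_closure_singleton⟩
    have hmap : ∀ r : N[X], aeval z (r.map (Subfield.inclusion hle)) = aeval z r := fun r => by
      rw [aeval_def, eval₂_map]; rfl
    have h0 : p.map (Subfield.inclusion hle) = C g' * q.map (Subfield.inclusion hle) := by
      apply transcendental_iff_injective.1 hzt
      rw [map_mul, hmap, hmap, aeval_C, ← h]; rfl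
    have hq0 : q ≠ 0 := by rintro rfl; simp at hq
    have hco := congrArg (fun r => ((coeff r q.natDegree : M) : U)) h0
    simp only [coeff_map, coeff_C_mul] at hco
    have hl : ((q.leadingCoeff : N) : U) ≠ 0 := fun h =>
      leadingCoeff_ne_zero.2 hq0 (Subtype.ext h)
    apply hgN
    have : g = (p.coeff q.natDegree : U) / (q.leadingCoeff : U) := by
      rw [eq_div_iff hl]; exact hco.symm
    rw [this]
    exact N.div_mem (p.coeff _).2 q.leadingCoeff.2
  -- A power of `z` lies in `N(g)`; being a product over `N`, it cannot involve the sum `g` and lies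
  -- in `N`.
  obtain ⟨m, hm, hmem⟩ := exists_pow_mem_of_not_transcendental (hN.adjoin_sum hg')
    (fun x hx => le_sup_closure _ _ (hC x hx)) (le_sup_closure _ _ ha) hz halg
  have hzm : z ^ m ∈ N := mem_of_hyperexponential hN hC hg' (N.pow_mem ha m) hmem
    (by rw [map_pow, hz, mul_pow])
  -- now `z`, and hence `g`, is algebraic over `N`
  have hzalg : IsAlgebraic N z := by
    have h1 : IsAlgebraic N (z ^ m) := isAlgebraic_algebraMap (⟨z ^ m, hzm⟩ : N)
    exact IsAlgebraic.of_pow hm h1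
  have : Algebra.IsAlgebraic N (IntermediateField.adjoin N {z}) :=
    IntermediateField.isAlgebraic_adjoin_simple hzalg.isIntegral
  have hg2 : g ∈ IntermediateField.adjoin N {z} := by
    rw [← adjoin_toSubfield] at hg; exact hg
  exact hgt ((IntermediateField.isAlgebraic_iff (x := (⟨g, hg2⟩ : IntermediateField.adjoin N {z}))).1
    (Algebra.IsAlgebraic.isAlgebraic _))

/-- Karr's structure theorem for telescoping solutions, one sum. -/
theorem exists_const_mul_of_sum (hN : SigmaStable σ N) (hC : ∀ x, σ x = x → x ∈ N) {z g : U}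
    (hz : σ z - z ∈ N) (hg : g ∈ N ⊔ Subfield.closure {z}) (hg' : σ g - g ∈ N) :
    ∃ c, σ c = c ∧ g - c * z ∈ N := by
  by_cases hzN : z ∈ N
  · refine ⟨0, map_zero σ, ?_⟩
    simpa using sup_closure_le le_rfl (by simpa using hzN) hg
  have hzt := transcendental_of_sum hN hC hz hzN
  obtain ⟨p, hp, h1, -⟩ := exists_aeval_of_first_order hN hz (by ring) hzt
    (not_telescope_of_not_mem hC hzN) hg N.one_mem one_ne_zero hg' (by ring)
  have hp' : g = (p.coeff 1 : U) * z + (p.coeff 0 : U) := by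
    rw [hp]
    conv_lhs => rw [eq_X_add_C_of_natDegree_le_one h1]
    simp; rfl
  refine ⟨p.coeff 1, ?_, ?_⟩
  -- Otherwise `z` appears in `σ(g) - g ∈ N` with the nonzero coefficient `σ(p₁) - p₁`, which forces
  -- `z ∈ N`.
  · by_contra hne
    have hd : σ (p.coeff 1 : U) - p.coeff 1 ≠ 0 := sub_ne_zero.2 hne
    have hmem : (σ (p.coeff 1 : U) - p.coeff 1) * z ∈ N := by
      have h2 : (σ (p.coeff 1 : U) - p.coeff 1) * z = (σ g - g) -
          σ (p.coeff 1 : U) * (σ z - z) - (σ (p.coeff 0 : U) - p.coeff 0) := by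
        rw [hp']; simp only [map_add, map_mul]; ring
      rw [h2]
      exact N.sub_mem (N.sub_mem hg' (N.mul_mem (hN _ (p.coeff 1).2) hz))
        (N.sub_mem (hN _ (p.coeff 0).2) (p.coeff 0).2)
    apply hzN
    have := N.div_mem hmem (N.sub_mem (hN _ (p.coeff 1).2) (p.coeff 1).2)
    rwa [mul_div_cancel_left₀ _ hd] at this
  · rw [hp']; simp

/-- Karr's structure theorem for telescoping solutions: only sums contribute, and linearly. -/
theorem exists_sum_add_of_telescope {A : Subfield U} (hN : SigmaStable σ N)
    (hAN : A ≤ N) (hC : ∀ x, σ x = x → x ∈ A) {S : Set U}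
    (hS : ∀ x ∈ S, σ x - x ∈ A ∨ ∃ a ∈ A, σ x = a * x) {g : U}
    (hg : g ∈ N ⊔ Subfield.closure S) (hg' : σ g - g ∈ N) :
    ∃ x w, σ x - x ∈ A ∧ w ∈ N ∧ g = x + w := by
  classical
  obtain ⟨T, hT, hgT⟩ := exists_finset_of_mem_sup_closure hg
  clear hg
  induction T using Finset.induction_on generalizing g with
  | empty => exact ⟨0, g, by simp, by simpa using hgT, by simp⟩
  | insert s T _ ih =>
    rw [Finset.coe_insert] at hT hgT
    rw [sup_closure_insert] at hgT
    have hTS : (T : Set U) ⊆ S := fun x hx => hT (Set.mem_insert_of_mem _ hx)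
    have hst : SigmaStable σ (N ⊔ Subfield.closure (T : Set U)) := by
      refine hN.sup_closure fun x hx => ?_
      rcases hS x (hTS hx) with h | ⟨a, ha, h⟩
      · have := add_mem (le_sup_closure N T (hAN h)) (mem_sup_closure (N := N) hx)
        simpa using this
      · rw [h]
        exact mul_mem (le_sup_closure N T (hAN ha)) (mem_sup_closure (N := N) hx)
    have hC' : ∀ x, σ x = x → x ∈ N ⊔ Subfield.closure (T : Set U) :=
      fun x hx => le_sup_closure _ _ (hAN (hC x hx))
    rcases hS s (hT (Set.mem_insert _ _)) with h | ⟨a, ha, h⟩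
    · obtain ⟨c, hc, hgc⟩ := exists_const_mul_of_sum hst hC' (le_sup_closure _ _ (hAN h)) hgT
        (le_sup_closure _ _ hg')
      have hcs : σ (c * s) - c * s ∈ A := by
        rw [map_mul, hc, ← mul_sub]
        exact A.mul_mem (hC c hc) h
      obtain ⟨x, w, hx, hw, he⟩ := ih (g := g - c * s) (by
        rw [map_sub]
        have := N.sub_mem hg' (hAN hcs)
        convert this using 1; ring) hTS hgc
      refine ⟨x + c * s, w, ?_, hw, by linear_combination he⟩
      rw [map_add]
      have := A.add_mem hx hcs
      convert this using 1; ring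
    -- A product contributes nothing, so it is simply dropped.
    · exact ih hg' hTS (mem_of_sum_of_product hst hC' (le_sup_closure _ _ (hAN ha)) h hgT
        (le_sup_closure _ _ hg'))

end Karr

/-! ### Laurent expansions at the place `u = 0`. -/

section LeadingCoefficient

variable {U : Type*} [Field U] {N : Subfield U} {u w w' c c' : U} {k : ℕ}

/-- `w = c u⁻ᵏ + (higher order terms in u)`, for `w ∈ N(u)`. -/
def HasLeadCoeff (N : Subfield U) (u w : U) (k : ℕ) (c : U) : Prop :=
  ∃ p q : N[X], q.coeff 0 = 1 ∧ (p.coeff 0 : U) = c ∧ w * u ^ k * aeval u q = aeval u p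

theorem aeval_X_mul_subfield (p : N[X]) : aeval u (X * p) = u * aeval u p := by
  rw [map_mul, aeval_X]

theorem aeval_C_subfield (a : N) : aeval u (C a : N[X]) = (a : U) := by rw [aeval_C]; rfl

theorem HasLeadCoeff.mem (h : HasLeadCoeff N u w k c) : c ∈ N := by
  obtain ⟨p, q, -, rfl, -⟩ := h
  exact (p.coeff 0).2

theorem ne_zero_of_transcendental (hu : Transcendental N u) : u ≠ 0 := by
  rintro rfl
  exact not_transcendental_of_mem N.zero_mem hu

theorem hasLeadCoeff_of_mem (hw : w ∈ N) : HasLeadCoeff N u w 0 w :=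
  ⟨C ⟨w, hw⟩, 1, by simp, by simp, by rw [aeval_C_subfield]; simp⟩

/-- The coefficient may vanish: `k` is only a bound for the pole order. -/
theorem HasLeadCoeff.succ (h : HasLeadCoeff N u w k c) : HasLeadCoeff N u w (k + 1) 0 := by
  obtain ⟨p, q, hq, -, h⟩ := h
  refine ⟨X * p, q, hq, by simp, ?_⟩
  rw [aeval_X_mul_subfield, ← h]; ring

theorem hasLeadCoeff_of_mem_succ (hw : w ∈ N) : HasLeadCoeff N u w (k + 1) 0 := by
  induction k with
  | zero => exact (hasLeadCoeff_of_mem hw).succ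
  | succ k ih => exact ih.succ

theorem HasLeadCoeff.sub (h : HasLeadCoeff N u w k c) (h' : HasLeadCoeff N u w' k c') :
    HasLeadCoeff N u (w - w') k (c - c') := by
  obtain ⟨p, q, hq, rfl, h⟩ := h
  obtain ⟨p', q', hq', rfl, h'⟩ := h'
  refine ⟨p * q' - p' * q, q * q', by simp [mul_coeff_zero, hq, hq'],
    by simp [mul_coeff_zero, hq, hq'], ?_⟩
  rw [map_mul, map_sub, map_mul, map_mul, ← h, ← h']; ring

theorem HasLeadCoeff.eq_zero (hu : Transcendental N u) (h : HasLeadCoeff N u 0 k c) : c = 0 := by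
  obtain ⟨p, q, -, rfl, h⟩ := h
  rw [zero_mul, zero_mul] at h
  have : p = 0 := transcendental_iff_injective.1 hu (by rw [← h, map_zero])
  simp [this]

theorem HasLeadCoeff.unique (hu : Transcendental N u) (h : HasLeadCoeff N u w k c)
    (h' : HasLeadCoeff N u w k c') : c = c' := by
  have := h.sub h'
  rw [sub_self] at this
  exact sub_eq_zero.1 (this.eq_zero hu)

/-- As `q(0) = 1`, the polynomial `p - p(0) q` vanishes at `0`, and one factor `u` cancels. -/
theorem HasLeadCoeff.peel (hu0 : u ≠ 0) (h : HasLeadCoeff N u w (k + 1) c) :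
    ∃ c', HasLeadCoeff N u (w - c * (u ^ (k + 1))⁻¹) k c' := by
  obtain ⟨p, q, hq, rfl, h⟩ := h
  obtain ⟨r, hr⟩ : X ∣ p - C (p.coeff 0) * q := by
    rw [X_dvd_iff]; simp [hq]
  refine ⟨_, r, q, hq, rfl, ?_⟩
  apply mul_left_cancel₀ hu0
  have := congrArg (aeval u) hr
  rw [aeval_X_mul_subfield, map_sub, map_mul, aeval_C_subfield, ← h] at this
  rw [← this, pow_succ]
  field_simp

theorem HasLeadCoeff.of_zero (hu0 : u ≠ 0) (h : HasLeadCoeff N u w (k + 1) 0) :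
    ∃ c', HasLeadCoeff N u w k c' := by
  simpa using h.peel hu0

/-- The multiplicity of the root `0` of a denominator bounds the pole order; the cofactor is scaled
to have constant term `1`. -/
theorem exists_hasLeadCoeff (hw : w ∈ N ⊔ Subfield.closure {u}) :
    ∃ k c, HasLeadCoeff N u w k c := by
  obtain ⟨p, q, hq, h⟩ := exists_aeval_of_mem hw
  have hq0 : q ≠ 0 := by rintro rfl; simp at hq
  obtain ⟨r, hr, hr'⟩ := exists_eq_pow_rootMultiplicity_mul_and_not_dvd q hq0 0
  rw [C_0, sub_zero] at hr hr'
  rw [X_dvd_iff] at hr'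
  set m := rootMultiplicity 0 q
  have ha : ((r.coeff 0 : N) : U) ≠ 0 := fun h => hr' (Subtype.ext h)
  refine ⟨m, _, C (r.coeff 0)⁻¹ * p, C (r.coeff 0)⁻¹ * r, by simp [hr'], rfl, ?_⟩
  rw [map_mul, map_mul, ← h, hr, map_mul, map_pow, aeval_X]; ring

theorem HasLeadCoeff.mono {R : Subfield U} (hR : R ≤ N) (h : HasLeadCoeff R u w k c) :
    HasLeadCoeff N u w k c := by
  obtain ⟨p, q, hq, rfl, h⟩ := h
  have hmap : ∀ r : R[X], aeval u (r.map (Subfield.inclusion hR)) = aeval u r := fun r => by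
    rw [aeval_def, eval₂_map]; rfl
  exact ⟨p.map (Subfield.inclusion hR), q.map (Subfield.inclusion hR),
    by rw [coeff_map, hq, map_one], by rw [coeff_map]; rfl, by rw [hmap, hmap, h]⟩

/-- The leading coefficient over `N` of an element of `R(u)`, for `R ≤ N`, lies in `R`. -/
theorem HasLeadCoeff.mem_of_mem {R : Subfield U} (hR : R ≤ N) (hu : Transcendental N u)
    (hw : w ∈ R ⊔ Subfield.closure {u}) (h : HasLeadCoeff N u w k c) : c ∈ R := by
  have hu0 := ne_zero_of_transcendental hu
  obtain ⟨k', c', h'⟩ := exists_hasLeadCoeff hw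
  have hup : ∀ {c'' : U} (j i : ℕ), HasLeadCoeff N u w j c'' → HasLeadCoeff N u w (j + (i + 1)) 0 := by
    intro c'' j i hj
    induction i with
    | zero => exact hj.succ
    | succ i ih => exact ih.succ
  induction k' generalizing c' with
  | zero =>
    rcases k with _ | k
    · rw [h.unique hu (h'.mono hR)]; exact h'.mem
    · have := hup 0 k (h'.mono hR)
      rw [zero_add] at this
      rw [h.unique hu this]; exact R.zero_mem
  | succ k' ih =>
    -- The pole bounds over `N` and over `R` may differ. The larger one belongs to a vanishing
    -- coefficient; if that is the bound over `R`, it is lowered by one.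
    rcases lt_trichotomy k (k' + 1) with hlt | heq | hgt
    · obtain ⟨i, hi⟩ := Nat.exists_eq_add_of_lt hlt
      have := hup k i h
      rw [← add_assoc, ← hi] at this
      have hc' := (h'.mono hR).unique hu this
      subst hc'
      obtain ⟨c'', h''⟩ := h'.of_zero hu0
      exact ih c'' h''
    · subst heq
      rw [h.unique hu (h'.mono hR)]; exact h'.mem
    · obtain ⟨i, hi⟩ := Nat.exists_eq_add_of_lt hgt
      have := hup _ i (h'.mono hR)
      rw [← add_assoc, ← hi] at this
      rw [h.unique hu this]; exact R.zero_mem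

/-- `v = au / (1 + bu)` vanishes where `u` does, and the factor `1 + bu` has value `1` there.
Clearing denominators therefore leaves the constant coefficient unchanged. -/
theorem exists_homogenization {a b v : U} (ha : a ∈ N) (hb : b ∈ N) (hv : v * (1 + b * u) = a * u)
    (p : N[X]) : ∃ (m : ℕ) (r : N[X]), r.coeff 0 = p.coeff 0 ∧
      aeval v p * (1 + b * u) ^ m = aeval u r := by
  lift a to N using ha
  lift b to N using hb
  have hl : aeval u (1 + C b * X : N[X]) = 1 + (b : U) * u := by
    rw [map_add, map_mul, map_one, aeval_X, aeval_C_subfield]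
  induction p using Polynomial.induction_on' with
  | add p q hp hq =>
    obtain ⟨m, r, hr, h⟩ := hp
    obtain ⟨m', r', hr', h'⟩ := hq
    refine ⟨m + m', r * (1 + C b * X) ^ m' + r' * (1 + C b * X) ^ m, ?_, ?_⟩
    · simp [coeff_zero_eq_eval_zero] at hr hr' ⊢
      rw [hr, hr']
    · simp only [map_add, map_mul, map_pow, hl] at *
      rw [← h, ← h']; ring
  | monomial n x =>
    refine ⟨n, C x * (C a * X) ^ n, ?_, ?_⟩
    · rcases n with _ | n <;> simp [coeff_zero_eq_eval_zero]
    · rw [← C_mul_X_pow_eq_monomial, map_mul, map_mul, map_pow, map_pow, map_mul, aeval_X, aeval_X,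
        aeval_C_subfield, aeval_C_subfield, aeval_C_subfield, ← hv, mul_pow]
      ring

/-- The place `u = 0` is invariant, with `σ(u) = au + O(u²)`, so `c u⁻ᵏ` is sent to `σ(c) a⁻ᵏ u⁻ᵏ`
plus terms of higher order. -/
theorem HasLeadCoeff.sigma {σ : U →+* U} (hN : SigmaStable σ N) {a b : U}
    (ha : a ∈ N) (ha0 : a ≠ 0) (hb : b ∈ N) (hσ : σ u * (1 + b * u) = a * u)
    (h : HasLeadCoeff N u w k c) : HasLeadCoeff N u (σ w) k (σ c * (a ^ k)⁻¹) := by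
  obtain ⟨p, q, hq, rfl, h⟩ := h
  obtain ⟨m, r, hr, hpr⟩ := exists_homogenization ha hb hσ (p.map hN.res)
  obtain ⟨m', r', hr', hqr⟩ := exists_homogenization ha hb hσ (q.map hN.res)
  rw [← sigma_aeval hN] at hpr hqr
  lift a to N using ha
  lift b to N using hb
  have hl : aeval u (1 + C b * X : N[X]) = 1 + (b : U) * u := by
    rw [map_add, map_mul, map_one, aeval_X, aeval_C_subfield]
  rw [coeff_map] at hr hr'
  have h1 := congrArg σ h
  rw [map_mul, map_mul, map_pow] at h1
  refine ⟨C (a ^ k)⁻¹ * (r * (1 + C b * X) ^ (k + m')), r' * (1 + C b * X) ^ m, ?_, ?_, ?_⟩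
  · simp [coeff_zero_eq_eval_zero] at hq hr' ⊢
    rw [hr', hq, map_one]
  · have : (C (a ^ k)⁻¹ * (r * (1 + C b * X) ^ (k + m'))).coeff 0 = (a ^ k)⁻¹ * r.coeff 0 := by
      simp [coeff_zero_eq_eval_zero]
    rw [this, hr]
    simp [mul_comm]
  · have hak : (a : U) ^ k ≠ 0 := pow_ne_zero _ ha0
    simp only [map_mul, map_pow, hl, aeval_C_subfield]
    rw [← hpr, ← hqr, ← h1]
    push_cast
    field_simp
    have : σ u ^ k * (1 + (b : U) * u) ^ k = (a : U) ^ k * u ^ k := by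
      rw [← mul_pow, hσ, mul_pow]
    rw [pow_add]
    linear_combination (-(σ w * σ (aeval u q) * (1 + ↑b * u) ^ m * (1 + ↑b * u) ^ m')) * this

end LeadingCoefficient

/-! ### The tower of all sums, and telescoping with sums of bounded level. -/

section Engine

variable {U : Type*} [Field U]

/-- The fields `A₀ = G₀` and `Aₖ₊₁`, obtained from `Aₖ` by adjoining all sums over `Aₖ` and those
products over `Aₖ` that lie in `Pₖ`. -/
def sumTower (σ : U →+* U) (G₀ : Subfield U) (P : ℕ → Set U) : ℕ → Subfield U
  | 0 => G₀
  | k + 1 => sumTower σ G₀ P k ⊔ Subfield.closure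
      {x | σ x - x ∈ sumTower σ G₀ P k ∨ x ∈ P k ∧ ∃ a ∈ sumTower σ G₀ P k, σ x = a * x}

/-- `(M, P)` arises from `(A, B)` by adjoining the same sums and products to `A` and `B`. -/
inductive TowerLift (σ : U →+* U) (A B : Subfield U) : Subfield U → Subfield U → Prop
  | base : TowerLift σ A B A B
  | step {M P : Subfield U} {z a : U} : TowerLift σ A B M P → Transcendental M z → a ∈ P →
      (σ z = z + a ∨ σ z = a * z) →
      TowerLift σ A B (M ⊔ Subfield.closure {z}) (P ⊔ Subfield.closure {z})

/-- A field with an increasing sequence of subfields. -/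
@[ext] structure Filtr (U : Type*) [Field U] where
  lev : ℕ → Subfield U
  top : Subfield U

/-- Adjoin `y` at level `m`. -/
def Filtr.add (K : Filtr U) (y : U) (m : ℕ) : Filtr U where
  lev k := if m ≤ k then K.lev k ⊔ Subfield.closure {y} else K.lev k
  top := K.top ⊔ Subfield.closure {y}

/-- The generators of `K` of level greater than `k` are independent over `A k`. -/
structure Filtr.Good (σ : U →+* U) (G₀ : Subfield U) (A : ℕ → Subfield U) (K : Filtr U) :
    Prop where
  mono : Monotone K.lev
  le_top : ∀ k, K.lev k ≤ K.top
  base_le : ∀ k, G₀ ≤ K.lev k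
  le_tower : ∀ k, K.lev k ≤ A k
  stable : ∀ k, SigmaStable σ (K.lev k)
  stable_top : SigmaStable σ K.top
  lift : ∀ k, TowerLift σ (A k) (K.lev k) (K.top ⊔ A k) K.top

/-- `L` is obtained from `K` by adjoining sums of level at most `d`. -/
inductive Filtr.SumExt (σ : U →+* U) (d : ℕ) (K : Filtr U) : Filtr U → Prop
  | refl : Filtr.SumExt σ d K K
  | step {L : Filtr U} {y : U} {m : ℕ} : Filtr.SumExt σ d K L → m < d → σ y - y ∈ L.lev m →
      y ∉ L.top → Filtr.SumExt σ d K (L.add y (m + 1))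

variable {σ : U →+* U} {G₀ : Subfield U} {P : ℕ → Set U}

theorem sumTower_le_succ (k : ℕ) : sumTower σ G₀ P k ≤ sumTower σ G₀ P (k + 1) := le_sup_left

theorem sumTower_mono : Monotone (sumTower σ G₀ P) := monotone_nat_of_le_succ sumTower_le_succ

theorem le_sumTower (k : ℕ) : G₀ ≤ sumTower σ G₀ P k := sumTower_mono (Nat.zero_le k)

theorem mem_sumTower_of_sum {k : ℕ} {x : U} (h : σ x - x ∈ sumTower σ G₀ P k) :
    x ∈ sumTower σ G₀ P (k + 1) := mem_sup_closure (Or.inl h)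

theorem mem_sumTower_of_product {k : ℕ} {x a : U} (hx : x ∈ P k) (ha : a ∈ sumTower σ G₀ P k)
    (h : σ x = a * x) : x ∈ sumTower σ G₀ P (k + 1) := mem_sup_closure (Or.inr ⟨hx, a, ha, h⟩)

theorem sumTower_stable (hG : SigmaStable σ G₀) (k : ℕ) : SigmaStable σ (sumTower σ G₀ P k) := by
  induction k with
  | zero => exact hG
  | succ k ih =>
    refine ih.sup_closure fun x hx => ?_
    have hx' := mem_sup_closure (N := sumTower σ G₀ P k) hx
    rcases hx with h | ⟨-, a, ha, h⟩
    · have := add_mem (le_sup_closure _ _ h) hx'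
      simpa using this
    · rw [h]; exact mul_mem (le_sup_closure _ _ ha) hx'

/-- An element of `M ∩ P(z)` lies in `P`, if `z` is transcendental over `M ≥ P`. -/
theorem mem_of_mem_adjoin_transcendental {M P : Subfield U} (h : P ≤ M) {x z : U}
    (hz : Transcendental M z) (hxM : x ∈ M) (hx : x ∈ P ⊔ Subfield.closure {z}) : x ∈ P := by
  -- Over `M`, the element `x` is its own coefficient of order `0`; as an element of `P(z)` it has
  -- this coefficient in `P`.
  have hz' := hasLeadCoeff_of_mem (u := z) hxM
  exact hz'.mem_of_mem h hz hx

theorem SigmaStable.adjoin_step {M : Subfield U} (hM : SigmaStable σ M) {z a : U} (ha : a ∈ M)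
    (h : σ z = z + a ∨ σ z = a * z) : SigmaStable σ (M ⊔ Subfield.closure {z}) := by
  refine hM.sup_closure ?_
  rintro x rfl
  have hx := mem_sup_closure_singleton (N := M) (x := x)
  rcases h with h | h <;> rw [h]
  · exact add_mem hx (le_sup_closure _ _ ha)
  · exact mul_mem (le_sup_closure _ _ ha) hx

namespace TowerLift

variable {A B M P M' P' : Subfield U}

theorem le (h : TowerLift σ A B M P) (hBA : B ≤ A) : P ≤ M := by
  induction h with
  | base => exact hBA
  | step _ _ _ _ ih => exact sup_le_sup_right ih _

/-- Transcendence is required over the first field only, so the second one may grow freely. -/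
theorem enlarge (h : TowerLift σ A B M P) {Q : Subfield U} :
    TowerLift σ A (B ⊔ Q) M (P ⊔ Q) := by
  induction h with
  | base => exact base
  | @step M P z a _ hz ha hσ ih =>
    rw [sup_right_comm]
    exact ih.step hz ((le_sup_left : P ≤ P ⊔ Q) ha) hσ

theorem trans (h : TowerLift σ A B M P) (h' : TowerLift σ M P M' P') : TowerLift σ A B M' P' := by
  induction h' with
  | base => exact h
  | step _ hz ha hσ ih => exact ih.step hz ha hσ

theorem base_le (h : TowerLift σ A B M P) : A ≤ M := by
  induction h with
  | base => exact le_rfl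
  | step _ _ _ _ ih => exact ih.trans le_sup_left

/-- This is how independence is used: `A ∩ P = B`, by removing the generators from the top. -/
theorem mem_of_mem (h : TowerLift σ A B M P) (hBA : B ≤ A) {x : U} (hxA : x ∈ A) (hx : x ∈ P) :
    x ∈ B := by
  induction h with
  | base => exact hx
  | step h' hz _ _ ih =>
    exact ih (mem_of_mem_adjoin_transcendental (h'.le hBA) hz (h'.base_le hxA) hx)

theorem base_le_right (h : TowerLift σ A B M P) : B ≤ P := by
  induction h with
  | base => exact le_rfl
  | step _ _ _ _ ih => exact ih.trans le_sup_left

theorem stable (h : TowerLift σ A B M P) (hBA : B ≤ A) (hA : SigmaStable σ A)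
    (hB : SigmaStable σ B) : SigmaStable σ M ∧ SigmaStable σ P := by
  induction h with
  | base => exact ⟨hA, hB⟩
  | @step M P z a h hz ha hσ ih =>
    exact ⟨ih.1.adjoin_step (h.le hBA ha) hσ, ih.2.adjoin_step ha hσ⟩

end TowerLift

namespace Filtr

variable {K L L' : Filtr U} {d d' : ℕ}

theorem SumExt.mono (h : SumExt σ d K L) (hd : d ≤ d') : SumExt σ d' K L := by
  induction h with
  | refl => exact .refl
  | step _ hm hy hy' ih => exact ih.step (hm.trans_le hd) hy hy'

theorem SumExt.trans (h : SumExt σ d K L) (h' : SumExt σ d L L') : SumExt σ d K L' := by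
  induction h' with
  | refl => exact h
  | step _ hm hy hy' ih => exact ih.step hm hy hy'

theorem lev_le_add (y : U) (m k : ℕ) : K.lev k ≤ (K.add y m).lev k := by
  simp only [add]
  split_ifs
  · exact le_sup_left
  · exact le_rfl

theorem SumExt.lev_le (h : SumExt σ d K L) (k : ℕ) : K.lev k ≤ L.lev k := by
  induction h with
  | refl => exact le_rfl
  | step _ _ _ _ ih => exact ih.trans (lev_le_add _ _ _)

theorem SumExt.top_le (h : SumExt σ d K L) : K.top ≤ L.top := by
  induction h with
  | refl => exact le_rfl
  | step _ _ _ _ ih => exact ih.trans le_sup_left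

theorem SumExt.top_eq (h : SumExt σ d K L) (hK : K.lev d ≤ K.top) : L.top = K.top ⊔ L.lev d := by
  induction h with
  | refl => exact (sup_eq_left.2 hK).symm
  | @step L y m _ hm hy hy' ih =>
    simp only [add, ih]
    rw [if_pos (by omega), sup_assoc]

/-- The adjoined sums have level `≤ d` and are absorbed by `A d`. -/
theorem Good.sup_eq {A : ℕ → Subfield U} (hL : L.Good σ G₀ A) (h : SumExt σ d K L)
    (hK : K.lev d ≤ K.top) : L.top ⊔ A d = K.top ⊔ A d := by
  rw [h.top_eq hK, sup_assoc, sup_eq_right.2 (hL.le_tower d)]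

/-- For `k > m` the new element lies in `A k` and only enlarges the base of the lift; for `k ≤ m` it
is a further generator, transcendental over `K.top ⊔ A m` and hence over `K.top ⊔ A k`. -/
theorem Good.add {A : ℕ → Subfield U} (hA : Monotone A) (hK : K.Good σ G₀ A) {y a : U} {m : ℕ}
    (ha : a ∈ K.lev m) (hy : σ y = y + a ∨ σ y = a * y) (hyA : y ∈ A (m + 1))
    (ht : Transcendental (K.top ⊔ A m : Subfield U) y) : (K.add y (m + 1)).Good σ G₀ A := by
  have hyk : ∀ k, m + 1 ≤ k → y ∈ A k := fun k hk => hA hk hyA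
  refine ⟨?_, ?_, ?_, ?_, ?_, ?_, ?_⟩
  · intro i j hij
    simp only [Filtr.add]
    split_ifs
    · exact sup_le_sup_right (hK.mono hij) _
    · omega
    · exact (hK.mono hij).trans le_sup_left
    · exact hK.mono hij
  · intro k
    simp only [Filtr.add]
    split_ifs
    · exact sup_le_sup_right (hK.le_top k) _
    · exact (hK.le_top k).trans le_sup_left
  · exact fun k => (hK.base_le k).trans (lev_le_add _ _ _)
  · intro k
    simp only [Filtr.add]
    split_ifs with h
    · exact sup_closure_le (hK.le_tower k) (Set.singleton_subset_iff.2 (hyk k h))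
    · exact hK.le_tower k
  · intro k
    simp only [Filtr.add]
    split_ifs with h
    · exact (hK.stable k).adjoin_step (hK.mono (by omega) ha) hy
    · exact hK.stable k
  · exact hK.stable_top.adjoin_step (hK.le_top m ha) hy
  · intro k
    simp only [Filtr.add]
    split_ifs with h
    · have : K.top ⊔ Subfield.closure {y} ⊔ A k = K.top ⊔ A k := by
        have hle : Subfield.closure {y} ≤ A k :=
          Subfield.closure_le.2 (Set.singleton_subset_iff.2 (hyk k h))
        rw [sup_assoc, sup_eq_right.2 hle]
      rw [this]
      exact (hK.lift k).enlarge
    · rw [sup_right_comm]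
      exact (hK.lift k).step (transcendental_mono (sup_le_sup_left (hA (by omega)) _) ht)
        (hK.le_top m ha) hy

theorem good_base (hG : SigmaStable σ G₀) :
    (⟨fun _ => G₀, G₀⟩ : Filtr U).Good σ G₀ (sumTower σ G₀ P) where
  mono := monotone_const
  le_top _ := le_rfl
  base_le _ := le_rfl
  le_tower k := le_sumTower k
  stable _ := hG
  stable_top := hG
  lift k := by
    have : G₀ ⊔ sumTower σ G₀ P k = sumTower σ G₀ P k := sup_eq_right.2 (le_sumTower k)
    simp only [this]
    exact .base

/-- The inductive step: if telescoping problems over `K` that are solvable in `K A_d` are solvable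
in an extension of `K` by sums of level `≤ d`, then every `w ∈ M` that telescopes to
an element of `K + A_d` is the sum of an element of such an extension and of an element of `A_d`. -/
theorem exists_sumExt_add {A : ℕ → Subfield U} (hAs : ∀ k, SigmaStable σ (A k))
    (hT : ∀ K : Filtr U, K.Good σ G₀ A → ∀ g ∈ K.top ⊔ A d, σ g - g ∈ K.top →
      ∃ L, SumExt σ d K L ∧ L.Good σ G₀ A ∧ g ∈ L.top)
    {B M P : Subfield U} (hBA : B ≤ A d) (hB : SigmaStable σ B) (hL : TowerLift σ (A d) B M P)
    (K : Filtr U) (hK : K.Good σ G₀ A) (hBK : B ≤ K.lev d)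
    (hMK : TowerLift σ M (P ⊔ K.lev d) (K.top ⊔ A d) K.top) (w f β : U) (hw : w ∈ M)
    (hf : f ∈ P ⊔ K.lev d) (hβ : β ∈ A d) (hwf : σ w - w = f - β) :
    ∃ L, SumExt σ d K L ∧ L.Good σ G₀ A ∧ ∃ w' ∈ L.top, ∃ a ∈ A d, w = w' + a := by
  -- Outer induction on the generators of `M` over `A d`. The filtration `K` is generalized because
  -- it grows on the way.
  induction hL generalizing K w f β with
  | base => exact ⟨K, .refl, hK, 0, K.top.zero_mem, w, hw, by simp⟩
  | @step M P z a hL hz ha hσz ih =>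
    have hst := hL.stable hBA (hAs d) hB
    have hPM : P ≤ M := hL.le hBA
    have hz0 : z ≠ 0 := ne_zero_of_transcendental hz
    -- a uniformizer `u` of `M(z)` with `σ(u) = α u / (1 + b u)`
    obtain ⟨u, α, b, hu0, hcl, hut, hα, hα0, hb, hσu, hcase⟩ : ∃ u α b : U, u ≠ 0 ∧
        (∀ N : Subfield U, N ⊔ Subfield.closure {u} = N ⊔ Subfield.closure {z}) ∧
        Transcendental M u ∧ α ∈ P ∧ α ≠ 0 ∧ b ∈ P ∧ σ u * (1 + b * u) = α * u ∧
        (α = 1 ∨ b = 0) := by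
      rcases hσz with h | h
      · refine ⟨z⁻¹, 1, a, inv_ne_zero hz0, fun N => ?_, ?_, P.one_mem, one_ne_zero, ha, ?_,
          Or.inl rfl⟩
        · apply le_antisymm
          · exact sup_closure_le le_sup_left
              (by simpa using mem_sup_closure_singleton)
          · refine sup_closure_le le_sup_left ?_
            have := inv_mem (mem_sup_closure_singleton (N := N) (x := z⁻¹))
            simpa using this
        · intro h'
          exact hz (by simpa using h'.inv)
        · have hσ0 : z + a ≠ 0 := by
            rw [← h]; exact fun h0 => hz0 ((map_eq_zero σ).1 h0)
          rw [map_inv₀, h]; field_simp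
      · refine ⟨z, a, 0, hz0, fun N => rfl, hz, ha, ?_, P.zero_mem, by rw [h]; ring, Or.inr rfl⟩
        rintro rfl
        rw [zero_mul] at h
        exact hz0 ((map_eq_zero σ).1 h)
    have hMu := hst.1
    have hut0 : ∀ Q : Subfield U, u ∈ Q ⊔ Subfield.closure {z} := fun Q => by
      rw [← hcl]; exact mem_sup_closure_singleton
    -- Inner induction on the pole order `k` of `w` at `u = 0`: the polar terms are removed one by
    -- one, until the constant term `c ∈ M` passes to the outer induction.
    obtain ⟨k, c, hk⟩ := exists_hasLeadCoeff (N := M) (u := u) (by rw [hcl]; exact hw)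
    -- lowering the base of the lift
    have hlow : ∀ K : Filtr U,
        TowerLift σ (M ⊔ Subfield.closure {z}) (P ⊔ Subfield.closure {z} ⊔ K.lev d)
          (K.top ⊔ A d) K.top → TowerLift σ M (P ⊔ K.lev d) (K.top ⊔ A d) K.top := by
      intro K hMK
      rw [sup_right_comm] at hMK
      exact (TowerLift.base.step hz ((le_sup_left : P ≤ _) ha) hσz).trans hMK
    induction k generalizing K w f β c with
    | zero =>
      have hRM : P ⊔ K.lev d ≤ M := sup_le hPM ((hK.le_tower d).trans hL.base_le)
      -- The coefficient of order `0` in `f = (σ(w) - w) + β`; by `mem_of_mem` it already lies in `P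
      -- ⊔ K.lev d`.
      have hγ : HasLeadCoeff M u f 0 (σ c - c - -β) := by
        have h1 := hk.sigma hMu (hPM hα) hα0 (hPM hb) hσu
        have h2 := (h1.sub hk).sub (hasLeadCoeff_of_mem (neg_mem (hL.base_le hβ)))
        rw [hwf] at h2
        simpa using h2
      have hγR := hγ.mem_of_mem hRM hut (by rw [hcl, sup_right_comm]; exact hf)
      -- The constant term satisfies an equation of the same shape one generator lower, with the
      -- same `β`.
      obtain ⟨L, hKL, hLg, c', hc', a', ha', hcc⟩ := ih K hK hBK (hlow K hMK) c _ β hk.mem hγR hβ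
        (by ring)
      -- In the equation for `w - c` the part `β` has cancelled, so its right-hand side lies in
      -- `K.top` and `hT` applies.
      obtain ⟨L', hLL', hLg', hwc⟩ := hT L hLg (w - c) (by
          rw [hLg.sup_eq hKL (hK.le_top d)]
          exact hMK.base_le (sub_mem hw (le_sup_closure _ _ hk.mem))) (by
          have h1 : σ (w - c) - (w - c) = f - (σ c - c - -β) := by
            rw [map_sub]; linear_combination hwf
          rw [h1]
          refine hKL.top_le (hMK.base_le_right (sub_mem hf ?_))
          exact (sup_le_sup_right le_sup_left _ : P ⊔ K.lev d ≤ _) hγR)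
      refine ⟨L', hKL.trans hLL', hLg', w - c + c', add_mem hwc (hLL'.top_le hc'), a', ha', ?_⟩
      rw [add_assoc, ← hcc]; ring
    | succ k ihk =>
      have hRM : P ⊔ K.lev d ≤ M := sup_le hPM ((hK.le_tower d).trans hL.base_le)
      -- In positive pole order `β ∈ A d` makes no contribution.
      have hγ : HasLeadCoeff M u f (k + 1) (σ c * (α ^ (k + 1))⁻¹ - c) := by
        have h1 := hk.sigma hMu (hPM hα) hα0 (hPM hb) hσu
        have h2 := (h1.sub hk).sub (hasLeadCoeff_of_mem_succ (k := k) (neg_mem (hL.base_le hβ)))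
        rw [hwf] at h2
        simpa using h2
      have hγR := hγ.mem_of_mem hRM hut (by rw [hcl, sup_right_comm]; exact hf)
      have hγK : σ c * (α ^ (k + 1))⁻¹ - c ∈ K.top :=
        hMK.base_le_right ((sup_le_sup_right le_sup_left _ : P ⊔ K.lev d ≤ _) hγR)
      have huK : u ∈ K.top := hMK.base_le_right ((le_sup_left : P ⊔ Subfield.closure {z} ≤ _) (hut0 P))
      have hcM : c ∈ M ⊔ Subfield.closure {z} := le_sup_closure _ _ hk.mem
      -- For a sum `α = 1`, and `c` itself telescopes into `K.top`. For a product `σ(u) = αu`, and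
      -- `c u⁻⁽ᵏ⁺¹⁾` does, the factor `α` being absorbed by the power of `u`.
      obtain ⟨L, hKL, hLg, hcL⟩ : ∃ L, SumExt σ d K L ∧ L.Good σ G₀ A ∧ c ∈ L.top := by
        rcases hcase with rfl | rfl
        · exact hT K hK c (hMK.base_le hcM) (by simpa using hγK)
        · have hσu' : σ u = α * u := by simpa using hσu
          obtain ⟨L, hKL, hLg, hcL⟩ := hT K hK (c * (u ^ (k + 1))⁻¹)
            (hMK.base_le (mul_mem hcM (inv_mem (pow_mem (hut0 M) _)))) (by
              have h1 : σ (c * (u ^ (k + 1))⁻¹) - c * (u ^ (k + 1))⁻¹ =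
                  (σ c * (α ^ (k + 1))⁻¹ - c) * (u ^ (k + 1))⁻¹ := by
                rw [map_mul, map_inv₀, map_pow, hσu', mul_pow, mul_inv]; ring
              rw [h1]
              exact mul_mem hγK (inv_mem (pow_mem huK _)))
          refine ⟨L, hKL, hLg, ?_⟩
          have := mul_mem hcL (pow_mem (hKL.top_le huK) (k + 1))
          rwa [inv_mul_cancel_right₀ (pow_ne_zero _ hu0)] at this
      have hMK' : TowerLift σ (M ⊔ Subfield.closure {z}) (P ⊔ Subfield.closure {z} ⊔ L.lev d)
          (L.top ⊔ A d) L.top := by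
        have := hMK.enlarge (Q := L.lev d)
        rwa [sup_assoc, sup_eq_right.2 (hKL.lev_le d), ← hKL.top_eq (hK.le_top d),
          ← hLg.sup_eq hKL (hK.le_top d)] at this
      -- Independence of the higher generators, applied to `c ∈ M ∩ L.top`; it keeps the modified
      -- right-hand side `f - (σ(e) - e)` in the required field.
      have hcR : c ∈ P ⊔ L.lev d := (hlow L hMK').mem_of_mem
        (sup_le hPM ((hLg.le_tower d).trans hL.base_le)) hk.mem hcL
      obtain ⟨c'', hk'⟩ := hk.peel hu0
      set e := c * (u ^ (k + 1))⁻¹ with he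
      have heR : e ∈ P ⊔ Subfield.closure {z} ⊔ L.lev d :=
        mul_mem ((sup_le_sup_right le_sup_left _ : P ⊔ L.lev d ≤ _) hcR) (inv_mem (pow_mem
          ((le_sup_left : P ⊔ Subfield.closure {z} ≤ _) (hut0 P)) _))
      have hRst : SigmaStable σ (P ⊔ Subfield.closure {z} ⊔ L.lev d) :=
        (hst.2.adjoin_step ha hσz).sup (hLg.stable d)
      obtain ⟨L', hLL', hLg', w', hw', a', ha', h⟩ := ihk L hLg (hBK.trans (hKL.lev_le d)) hMK'
        (w - e) (f - (σ e - e)) β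
        (sub_mem hw (mul_mem hcM (inv_mem (pow_mem (hut0 M) _))))
        (sub_mem (sup_le_sup_left (hKL.lev_le d) _ hf) (sub_mem (hRst _ heR) heR)) hβ
        (by rw [map_sub]; linear_combination hwf) c'' hk'
      exact ⟨L', hKL.trans hLL', hLg', w' + e, add_mem hw' (hLL'.top_le (hMK'.base_le_right heR)),
        a', ha', by linear_combination h⟩

/-- Telescoping problems over a good filtration that are solvable with sums and products of level
at most `d` are solvable in an extension by sums of level at most `d`. -/
theorem exists_sumExt_mem [CharZero U] (hG : SigmaStable σ G₀) (hC : ∀ x, σ x = x → x ∈ G₀)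
    {S : ℕ → Set U} (d : ℕ) (K : Filtr U) (hK : K.Good σ G₀ (sumTower σ G₀ S)) (g : U)
    (hg : g ∈ K.top ⊔ sumTower σ G₀ S d) (hg' : σ g - g ∈ K.top) :
    ∃ L, SumExt σ d K L ∧ L.Good σ G₀ (sumTower σ G₀ S) ∧ g ∈ L.top := by
  induction d generalizing K g with
  | zero =>
    refine ⟨K, .refl, hK, ?_⟩
    have : sumTower σ G₀ S 0 ≤ K.top := (hK.base_le 0).trans (hK.le_top 0)
    rwa [sup_eq_left.2 this] at hg
  | succ d ih =>
    set A := sumTower σ G₀ S with hA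
    have hAs : ∀ k, SigmaStable σ (A k) := sumTower_stable hG
    have hNs : SigmaStable σ (K.top ⊔ A d) := hK.stable_top.sup (hAs d)
    have hg2 : g ∈ (K.top ⊔ A d) ⊔ Subfield.closure
        {x | σ x - x ∈ A d ∨ x ∈ S d ∧ ∃ a ∈ A d, σ x = a * x} := by
      rw [sup_assoc]; exact hg
    -- Karr's theorem over `K.top ⊔ A d`: the part of `g` of level `d + 1` is a single sum `x` over
    -- `A d`.
    obtain ⟨x, w, hx, hw, rfl⟩ := exists_sum_add_of_telescope hNs le_sup_right
      (fun x hx => le_sumTower d (hC x hx)) (by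
        rintro x (h | ⟨-, h⟩)
        · exact Or.inl h
        · exact Or.inr h) hg2 ((le_sup_left : K.top ≤ _) hg')
    have hKd := hK.lift d
    obtain ⟨L, hKL, hL, w', hw', a, ha, rfl⟩ := exists_sumExt_add hAs ih (hK.le_tower d)
      (hK.stable d) hKd K hK le_rfl (by
        rw [sup_eq_left.2 (hK.le_top d)]; exact .base) w _ _ hw
        ((le_sup_left : K.top ≤ _) hg') hx (by rw [map_add]; ring)
    -- This difference lies both in `A d` and in `L.top`, and their intersection is `L.lev d`.
    have hxa : σ (x + a) - (x + a) ∈ L.lev d := by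
      refine (hL.lift d).mem_of_mem (hL.le_tower d) ?_ ?_
      · rw [map_add, add_sub_add_comm]
        exact add_mem hx (sub_mem (hAs d a ha) ha)
      · have h1 : σ (x + a) - (x + a) = (σ (x + (w' + a)) - (x + (w' + a))) - (σ w' - w') := by
          simp only [map_add]; ring
        rw [h1]
        exact sub_mem (hKL.top_le hg') (sub_mem (hL.stable_top _ hw') hw')
    obtain ⟨L', hLL', hL', hxL'⟩ : ∃ L', SumExt σ (d + 1) L L' ∧ L'.Good σ G₀ A ∧ x + a ∈ L'.top := by
      -- Either the remaining sum is already expressible at level `d` and the induction hypothesis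
      -- applies again, or it is transcendental and is adjoined as a new generator of level `d + 1`.
      by_cases hmem : x + a ∈ L.top ⊔ A d
      · obtain ⟨L', h, h1, h2⟩ := ih L hL (x + a) hmem (hL.le_top d hxa)
        exact ⟨L', h.mono (Nat.le_succ d), h1, h2⟩
      · have ht : Transcendental (L.top ⊔ A d : Subfield U) (x + a) :=
          transcendental_of_sum (hL.stable_top.sup (hAs d))
            (fun y hy => (le_sup_right : A d ≤ _) (le_sumTower d (hC y hy)))
            ((le_sup_left : L.top ≤ _) (hL.le_top d hxa)) hmem
        refine ⟨L.add (x + a) (d + 1), SumExt.refl.step (Nat.lt_succ_self d) hxa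
          fun h => hmem ((le_sup_left : L.top ≤ _) h), ?_, mem_sup_closure_singleton⟩
        exact hL.add sumTower_mono hxa (Or.inl (by ring))
          (mem_sumTower_of_sum (hL.le_tower d hxa)) ht
    refine ⟨L', (hKL.mono (Nat.le_succ d)).trans hLL', hL', ?_⟩
    have := add_mem (hLL'.top_le hw') hxL'
    convert this using 1; ring

end Filtr

end Engine

/-! ### Reduced fractions and the subfields generated by some of the variables. -/

section Occurrence

variable {G X : Type u} [Field G] [Field X] [Algebra G X] {n : ℕ} {T : Fin n → X} {g : X}

theorem aeval_mem_adjoin_image (S : Set (Fin n)) (p : MvPolynomial (Fin n) G) (hp : ↑p.vars ⊆ S) :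
    MvPolynomial.aeval T p ∈ IntermediateField.adjoin G (T '' S) := by
  obtain ⟨r, rfl⟩ := MvPolynomial.exists_rename_eq_of_vars_subset_range p (Subtype.val : S → Fin n)
    Subtype.val_injective (by simpa using hp)
  rw [MvPolynomial.aeval_rename]
  apply IntermediateField.algebra_adjoin_le_adjoin
  have : T '' S = Set.range (T ∘ (Subtype.val : S → Fin n)) := by
    rw [Set.range_comp, Subtype.range_val]
  rw [this, Algebra.adjoin_range_eq_range_aeval]
  exact ⟨r, rfl⟩

theorem exists_fraction_of_mem_adjoin_image {S : Set (Fin n)}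
    (hg : g ∈ IntermediateField.adjoin G (T '' S)) :
    ∃ p q : MvPolynomial (Fin n) G, ↑p.vars ⊆ S ∧ ↑q.vars ⊆ S ∧ MvPolynomial.aeval T q ≠ 0 ∧
      g = MvPolynomial.aeval T p / MvPolynomial.aeval T q := by
  classical
  have : T '' S = Set.range (T ∘ (Subtype.val : S → Fin n)) := by
    rw [Set.range_comp, Subtype.range_val]
  rw [this, IntermediateField.mem_adjoin_range_iff] at hg
  obtain ⟨r, s, h⟩ := hg
  have hv : ∀ r : MvPolynomial S G, ↑(MvPolynomial.rename Subtype.val r).vars ⊆ S := by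
    intro r x hx
    have := MvPolynomial.vars_rename Subtype.val r hx
    obtain ⟨y, -, rfl⟩ := Finset.mem_image.1 this
    exact y.2
  by_cases hs : MvPolynomial.aeval (T ∘ (Subtype.val : S → Fin n)) s = 0
  · exact ⟨0, 1, by simp, by simp, by simp, by rw [h, hs]; simp⟩
  · refine ⟨MvPolynomial.rename Subtype.val r, MvPolynomial.rename Subtype.val s, hv r, hv s, ?_, ?_⟩
    · rwa [MvPolynomial.aeval_rename]
    · rw [MvPolynomial.aeval_rename, MvPolynomial.aeval_rename, h]

theorem vars_subset_of_dvd {p q : MvPolynomial (Fin n) G} (h : p ∣ q) (hq : q ≠ 0) :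
    p.vars ⊆ q.vars := by
  classical
  obtain ⟨r, rfl⟩ := h
  rw [MvPolynomial.vars_def, MvPolynomial.vars_def,
    MvPolynomial.degrees_mul_eq (left_ne_zero_of_mul hq) (right_ne_zero_of_mul hq)]
  simp

theorem vars_eq_empty_of_isUnit {q : MvPolynomial (Fin n) G} (hq : IsUnit q) : q.vars = ∅ := by
  have := vars_subset_of_dvd hq.dvd (one_ne_zero (α := MvPolynomial (Fin n) G))
  simpa using this

/-- The variables of a reduced representation of an element of `G(Tⱼ : j ∈ S)` belong to `S`. -/
theorem vars_subset_of_reduced (hT : AlgebraicIndependent G T) {S : Set (Fin n)}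
    (hg : g ∈ IntermediateField.adjoin G (T '' S)) {p q : MvPolynomial (Fin n) G}
    (hpq : IsRelPrime p q) (hq : MvPolynomial.aeval T q ≠ 0)
    (h : g = MvPolynomial.aeval T p / MvPolynomial.aeval T q) :
    ↑p.vars ⊆ S ∧ ↑q.vars ⊆ S := by
  obtain ⟨p', q', hp', hq', hq0, h'⟩ := exists_fraction_of_mem_adjoin_image hg
  have hq'0 : q' ≠ 0 := by rintro rfl; simp at hq0
  have hqne : q ≠ 0 := by rintro rfl; simp at hq
  -- Algebraic independence turns the equality of fractions into a polynomial identity; as `p` and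
  -- `q` are coprime, `p ∣ p'` and `q ∣ q'`.
  have key : p * q' = p' * q := by
    apply hT
    rw [h, div_eq_div_iff hq hq0] at h'
    rw [map_mul, map_mul, h']
  by_cases hp0 : p = 0
  · subst hp0
    have : IsUnit q := isRelPrime_zero_left.1 hpq
    rw [vars_eq_empty_of_isUnit this]
    simp
  have hp'0 : p' ≠ 0 := by
    rintro rfl
    rw [zero_mul] at key
    exact mul_ne_zero hp0 hq'0 key
  have h1 : p ∣ p' := hpq.dvd_of_dvd_mul_right ⟨q', key.symm⟩
  have h2 : q ∣ q' := hpq.symm.dvd_of_dvd_mul_left ⟨p', by rw [key, mul_comm]⟩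
  exact ⟨fun x hx => hp' (vars_subset_of_dvd h1 hp'0 hx),
    fun x hx => hq' (vars_subset_of_dvd h2 hq'0 hx)⟩

theorem exists_reduced_of_mem
    (hg : g ∈ IntermediateField.adjoin G (Set.range T)) :
    ∃ p q : MvPolynomial (Fin n) G, IsRelPrime p q ∧ MvPolynomial.aeval T q ≠ 0 ∧
      g = MvPolynomial.aeval T p / MvPolynomial.aeval T q := by
  rw [← Set.image_univ] at hg
  obtain ⟨p, q, -, -, hq, h⟩ := exists_fraction_of_mem_adjoin_image hg
  have hq0 : q ≠ 0 := by rintro rfl; simp at hq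
  obtain ⟨a, b, c, hab, rfl, rfl⟩ := UniqueFactorizationMonoid.exists_reduced_factors' p q hq0
  rw [map_mul] at hq
  refine ⟨a, b, hab, right_ne_zero_of_mul hq, ?_⟩
  rw [h, map_mul, map_mul, mul_div_mul_left _ _ (left_ne_zero_of_mul hq)]

theorem Occurs.mem_of_mem_adjoin (hT : AlgebraicIndependent G T) {i : Fin n} (h : Occurs G T g i)
    {S : Set (Fin n)} (hg : g ∈ IntermediateField.adjoin G (T '' S)) : i ∈ S := by
  obtain ⟨p, q, hpq, hq, h, hi⟩ := h
  obtain ⟨h1, h2⟩ := vars_subset_of_reduced hT hg hpq hq h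
  exact hi.elim (fun h => h1 h) (fun h => h2 h)

theorem mem_adjoin_occurs
    (hg : g ∈ IntermediateField.adjoin G (Set.range T)) :
    g ∈ IntermediateField.adjoin G (T '' {i | Occurs G T g i}) := by
  obtain ⟨p, q, hpq, hq, h⟩ := exists_reduced_of_mem hg
  rw [h]
  exact div_mem
    (aeval_mem_adjoin_image _ p fun i hi => by rw [← h]; exact ⟨p, q, hpq, hq, h, Or.inl hi⟩)
    (aeval_mem_adjoin_image _ q fun i hi => by rw [← h]; exact ⟨p, q, hpq, hq, h, Or.inr hi⟩)

/-- Translates occurrence into membership in subfields, so that fractions need not be handled any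
more. -/
theorem mem_adjoin_image_iff (hT : AlgebraicIndependent G T)
    (hg : g ∈ IntermediateField.adjoin G (Set.range T)) {S : Set (Fin n)} :
    g ∈ IntermediateField.adjoin G (T '' S) ↔ ∀ i, Occurs G T g i → i ∈ S :=
  ⟨fun h _ hi => hi.mem_of_mem_adjoin hT h, fun h =>
    IntermediateField.adjoin.mono _ _ _ (Set.image_mono h) (mem_adjoin_occurs hg)⟩

end Occurrence

/-! ### Depth in towers and its invariance under embeddings. -/

section Depth

variable {G X : Type u} [Field G] [Field X] [Algebra G X]

theorem belowField_eq_adjoin_image {n : ℕ} (T : Fin n → X) (i : ℕ) :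
    belowField G T i = IntermediateField.adjoin G (T '' {j | (j : ℕ) < i}) := rfl

/-- A tower of sums and products over `G` without new constants. -/
structure DiffTower (G : Type u) {X : Type u} [Field G] [Field X] [Algebra G X] (σ : X ≃+* X)
    {n : ℕ} (T : Fin n → X) : Prop where
  indep : AlgebraicIndependent G T
  top : IntermediateField.adjoin G (Set.range T) = ⊤
  base : ∀ x : G, σ (algebraMap G X x) ∈ Set.range (algebraMap G X)
  step : ∀ i : Fin n, ∃ a ∈ belowField G T i, a ≠ 0 ∧ (σ (T i) = T i + a ∨ σ (T i) = a * T i)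
  const : ∀ x, σ x = x → x ∈ Set.range (algebraMap G X)

namespace DiffTower

variable {σ : X ≃+* X} {n : ℕ} {T : Fin n → X}

theorem mem_range (hT : DiffTower G σ T) (g : X) : g ∈ IntermediateField.adjoin G (Set.range T) := by
  rw [hT.top]; trivial

theorem mem_iff (hT : DiffTower G σ T) {g : X} {S : Set (Fin n)} :
    g ∈ IntermediateField.adjoin G (T '' S) ↔ ∀ i, Occurs G T g i → i ∈ S :=
  mem_adjoin_image_iff hT.indep (hT.mem_range g)

theorem not_mem_of_not_mem (hT : DiffTower G σ T) {S : Set (Fin n)} {i : Fin n} (hi : i ∉ S) :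
    T i ∉ IntermediateField.adjoin G (T '' S) := by
  intro h
  have h1 : MvPolynomial.aeval T (MvPolynomial.X i : MvPolynomial (Fin n) G) = T i := by simp
  have h2 := (vars_subset_of_reduced (p := (MvPolynomial.X i : MvPolynomial (Fin n) G)) (q := 1)
    hT.indep h isRelPrime_one_right (by simp) (by simp)).1
  rw [MvPolynomial.vars_X] at h2
  exact hi (h2 (by simp))

theorem not_mem_below (hT : DiffTower G σ T) (i : Fin n) : T i ∉ belowField G T i :=
  hT.not_mem_of_not_mem (S := {j | (j : ℕ) < i}) (lt_irrefl (i : ℕ))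

theorem ne_zero (hT : DiffTower G σ T) (i : Fin n) : T i ≠ 0 :=
  fun h => hT.not_mem_below i (h ▸ zero_mem _)

/-- The two cases of the definition of `genCoeff`. -/
theorem genCoeff_spec (hT : DiffTower G σ T) (i : Fin n) :
    genCoeff G σ T i ∈ belowField G T i ∧ genCoeff G σ T i ≠ 0 ∧
    ((σ (T i) - T i ∈ belowField G T i ∧ σ (T i) = T i + genCoeff G σ T i) ∨
      (σ (T i) - T i ∉ belowField G T i ∧ σ (T i) = genCoeff G σ T i * T i)) := by
  obtain ⟨a, ha, ha0, h⟩ := hT.step i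
  by_cases hs : σ (T i) - T i ∈ belowField G T i
  · have hgc : genCoeff G σ T i = σ (T i) - T i := by rw [genCoeff, if_pos hs]
    rw [hgc]
    refine ⟨hs, ?_, Or.inl ⟨hs, by ring⟩⟩
    intro h0
    obtain ⟨c, hc⟩ := hT.const (T i) (sub_eq_zero.1 h0)
    exact hT.not_mem_below i (hc ▸ (belowField G T i).algebraMap_mem c)
  · have hgc : genCoeff G σ T i = σ (T i) / T i := by rw [genCoeff, if_neg hs]
    have hm : σ (T i) = a * T i := by
      rcases h with h | h
      · exact absurd (by rw [h]; simpa using ha) hs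
      · exact h
    have : genCoeff G σ T i = a := by
      rw [hgc, hm, mul_div_assoc, div_self (hT.ne_zero i), mul_one]
    rw [this]
    exact ⟨ha, ha0, Or.inr ⟨hs, hm⟩⟩

theorem lt_of_occurs_genCoeff (hT : DiffTower G σ T) {i j : Fin n}
    (h : Occurs G T (genCoeff G σ T i) j) : j < i :=
  h.mem_of_mem_adjoin hT.indep (hT.genCoeff_spec i).1

theorem genDepth_eq (hT : DiffTower G σ T) (i : Fin n) :
    genDepth G σ T i = elemDepth G σ T (genCoeff G σ T i) + 1 := by
  classical
  rw [genDepth, elemDepth]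
  congr 1
  refine Finset.sup_congr rfl fun j _ => ?_
  by_cases h : Occurs G T (genCoeff G σ T i) j
  · rw [dif_pos ⟨hT.lt_of_occurs_genCoeff h, h⟩, if_pos h]
  · rw [dif_neg fun h' => h h'.2, if_neg h]

/-- The form in which depth is used throughout: a bound on it is membership in the field generated
by the shallow generators. -/
theorem elemDepth_le_iff (hT : DiffTower G σ T) {g : X} {k : ℕ} :
    elemDepth G σ T g ≤ k ↔ g ∈ IntermediateField.adjoin G (T '' {j | genDepth G σ T j ≤ k}) := by
  classical
  rw [hT.mem_iff, elemDepth, Finset.sup_le_iff]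
  refine ⟨fun h i hi => ?_, fun h i _ => ?_⟩
  · simpa [hi] using h i (Finset.mem_univ i)
  · split_ifs with hi
    · exact h i hi
    · exact Nat.zero_le _

theorem genDepth_le_of_occurs (hT : DiffTower G σ T) {i : Fin n} {g : X} (h : Occurs G T g i) :
    genDepth G σ T i ≤ elemDepth G σ T g :=
  h.mem_of_mem_adjoin hT.indep (hT.elemDepth_le_iff.1 le_rfl)

theorem genCoeff_mem (hT : DiffTower G σ T) (i : Fin n) :
    genCoeff G σ T i ∈ IntermediateField.adjoin G
      (T '' {j | (j : ℕ) < i ∧ genDepth G σ T j ≤ elemDepth G σ T (genCoeff G σ T i)}) := by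
  rw [hT.mem_iff]
  exact fun j hj => ⟨hT.lt_of_occurs_genCoeff hj, hT.genDepth_le_of_occurs hj⟩

/-- The element `a` with `σ(Tᵢ) = Tᵢ + a` or `σ(Tᵢ) = a Tᵢ` bounds the depth of `Tᵢ`. -/
theorem genDepth_le (hT : DiffTower G σ T) {i : Fin n} {a : X} {k : ℕ} {S : Set (Fin n)}
    (ha : σ (T i) - T i = a) (haS : a ∈ IntermediateField.adjoin G (T '' S))
    (hlt : ∀ j ∈ S, j < i) (hS : ∀ j ∈ S, genDepth G σ T j ≤ k) :
    genDepth G σ T i ≤ k + 1 := by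
  have hab : σ (T i) - T i ∈ belowField G T i := by
    rw [ha]
    exact IntermediateField.adjoin.mono _ _ _ (Set.image_mono hlt) haS
  have hgc : genCoeff G σ T i = a := by rw [genCoeff, if_pos hab, ha]
  rw [hT.genDepth_eq, hgc]
  apply Nat.succ_le_succ
  rw [hT.elemDepth_le_iff]
  exact IntermediateField.adjoin.mono _ _ _ (Set.image_mono hS) haS

end DiffTower

/-! ### Embeddings of towers -/

variable {Y : Type u} [Field Y] [Algebra G Y] {σ : X ≃+* X} {τ : Y ≃+* Y} {n m : ℕ}
  {T : Fin n → X} {T' : Fin m → Y}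

theorem mem_adjoin_map_iff (φ : X →ₐ[G] Y) (S : Set X) (x : X) :
    φ x ∈ IntermediateField.adjoin G (φ '' S) ↔ x ∈ IntermediateField.adjoin G S := by
  rw [← IntermediateField.adjoin_map]
  constructor
  · rintro ⟨y, hy, h⟩
    rwa [← φ.injective h]
  · exact fun h => ⟨x, h, rfl⟩

section

variable (hT : DiffTower G σ T) (hT' : DiffTower G τ T') (φ : X →ₐ[G] Y)
  (hφ : ∀ x, φ (σ x) = τ (φ x)) (hnm : n ≤ m) (hc : ∀ j, T' (Fin.castLE hnm j) = φ (T j))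

include hc in
theorem image_castLE (S : Set (Fin n)) : T' '' (Fin.castLE hnm '' S) = φ '' (T '' S) := by
  rw [Set.image_image, Set.image_image]
  exact Set.image_congr fun j _ => hc j

include hc in
theorem mem_belowField_castLE (i : Fin n) (x : X) :
    φ x ∈ belowField G T' (Fin.castLE hnm i) ↔ x ∈ belowField G T i := by
  rw [belowField_eq_adjoin_image, belowField_eq_adjoin_image, ← mem_adjoin_map_iff φ,
    ← image_castLE φ hnm hc]
  have : {j : Fin m | (j : ℕ) < (Fin.castLE hnm i : ℕ)} =
      Fin.castLE hnm '' {j | (j : ℕ) < i} := by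
    ext j
    constructor
    · intro hj
      exact ⟨⟨j, lt_trans hj i.2⟩, hj, rfl⟩
    · rintro ⟨k, hk, rfl⟩
      exact hk
  rw [this]

-- Occurrence depends only on which subfields generated by generators contain `g`, and `φ`
-- identifies those of the two towers.
include hT hT' hc in
theorem occurs_castLE (g : X) (j : Fin n) :
    Occurs G T' (φ g) (Fin.castLE hnm j) ↔ Occurs G T g j := by
  have h1 : ∀ S : Set (Fin n), φ g ∈ IntermediateField.adjoin G (T' '' (Fin.castLE hnm '' S)) ↔
      g ∈ IntermediateField.adjoin G (T '' S) := fun S => by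
    rw [image_castLE φ hnm hc, mem_adjoin_map_iff]
  constructor
  · intro h
    obtain ⟨k, hk, hkj⟩ := h.mem_of_mem_adjoin hT'.indep
      ((h1 _).2 (mem_adjoin_occurs (hT.mem_range g)))
    rwa [← Fin.castLE_injective hnm hkj]
  · intro h
    by_contra hno
    have hr : φ g ∈ IntermediateField.adjoin G (T' '' (Fin.castLE hnm '' Set.univ)) := by
      rw [h1, Set.image_univ]; exact hT.mem_range g
    have : g ∈ IntermediateField.adjoin G (T '' {j}ᶜ) := by
      rw [← h1, hT'.mem_iff]
      intro k hk
      obtain ⟨l, -, rfl⟩ := hk.mem_of_mem_adjoin hT'.indep hr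
      exact ⟨l, fun hl => hno (by rw [← Set.mem_singleton_iff.1 hl]; exact hk), rfl⟩
    exact h.mem_of_mem_adjoin hT.indep this rfl

include hφ hc in
theorem genCoeff_castLE (i : Fin n) :
    genCoeff G τ T' (Fin.castLE hnm i) = φ (genCoeff G σ T i) := by
  have h : τ (T' (Fin.castLE hnm i)) - T' (Fin.castLE hnm i) = φ (σ (T i) - T i) := by
    rw [hc, map_sub, hφ]
  have h' : τ (T' (Fin.castLE hnm i)) / T' (Fin.castLE hnm i) = φ (σ (T i) / T i) := by
    rw [hc, map_div₀, hφ]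
  have hiff : τ (T' (Fin.castLE hnm i)) - T' (Fin.castLE hnm i) ∈
      belowField G T' (Fin.castLE hnm i) ↔ σ (T i) - T i ∈ belowField G T i := by
    rw [h, mem_belowField_castLE φ hnm hc]
  by_cases hb : σ (T i) - T i ∈ belowField G T i
  · rw [genCoeff, genCoeff, if_pos hb, if_pos (hiff.2 hb), h]
  · rw [genCoeff, genCoeff, if_neg hb, if_neg (mt hiff.1 hb), h']

include hT hT' hφ hc

omit hφ in
theorem elemDepth_castLE_aux (g : X)
    (ih : ∀ j, Occurs G T g j → genDepth G τ T' (Fin.castLE hnm j) = genDepth G σ T j) :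
    elemDepth G τ T' (φ g) = elemDepth G σ T g := by
  have h1 : ∀ S : Set (Fin n), φ g ∈ IntermediateField.adjoin G (T' '' (Fin.castLE hnm '' S)) ↔
      g ∈ IntermediateField.adjoin G (T '' S) := fun S => by
    rw [image_castLE φ hnm hc, mem_adjoin_map_iff]
  apply le_antisymm
  · rw [hT'.elemDepth_le_iff]
    have := (h1 _).2 (mem_adjoin_occurs (hT.mem_range g))
    refine IntermediateField.adjoin.mono _ _ _ (Set.image_mono ?_) this
    rintro _ ⟨j, hj, rfl⟩
    change genDepth G τ T' _ ≤ _
    rw [ih j hj]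
    exact hT.genDepth_le_of_occurs hj
  · rw [hT.elemDepth_le_iff, hT.mem_iff]
    intro j hj
    change genDepth G σ T _ ≤ _
    rw [← ih j hj]
    exact hT'.genDepth_le_of_occurs ((occurs_castLE hT hT' φ hnm hc g j).2 hj)

/-- Later generators do not influence depth. This makes depths in truncations, in `F`, in `E` and in
`H` comparable. -/
theorem genDepth_castLE (i : Fin n) :
    genDepth G τ T' (Fin.castLE hnm i) = genDepth G σ T i := by
  induction i using WellFoundedLT.induction with
  | ind i ih =>
    rw [hT.genDepth_eq, hT'.genDepth_eq, genCoeff_castLE φ hφ hnm hc,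
      elemDepth_castLE_aux hT hT' φ hnm hc]
    exact fun j hj => ih j (hT.lt_of_occurs_genCoeff hj)

theorem elemDepth_castLE (g : X) : elemDepth G τ T' (φ g) = elemDepth G σ T g :=
  elemDepth_castLE_aux hT hT' φ hnm hc g fun j _ => genDepth_castLE hT hT' φ hφ hnm hc j

end

end Depth

/-! ### Towers from the definitions, concatenation and truncation. -/

section TowerConstruction

variable {G F E : Type u} [Field G] [Field F] [Field E] [Algebra G F] [Algebra G E] [Algebra F E]

theorem belowField_mono {n : ℕ} (t : Fin n → F) {i j : ℕ} (h : i ≤ j) :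
    belowField G t i ≤ belowField G t j :=
  IntermediateField.adjoin.mono _ _ _ (fun _ ⟨k, hk, hx⟩ => ⟨k, hk.trans_le h, hx⟩)

theorem belowField_zero {n : ℕ} (t : Fin n → F) : belowField G t 0 = ⊥ := by
  rw [belowField, IntermediateField.adjoin_eq_bot_iff]
  rintro x ⟨j, hj, -⟩
  exact absurd hj (Nat.not_lt_zero _)

theorem belowField_last {n : ℕ} (t : Fin n → F) :
    belowField G t n = IntermediateField.adjoin G (Set.range t) := by
  rw [belowField_eq_adjoin_image]
  congr 1
  ext x
  constructor
  · rintro ⟨j, -, rfl⟩; exact ⟨j, rfl⟩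
  · rintro ⟨j, rfl⟩; exact ⟨j, j.2, rfl⟩

theorem algebraicIndependent_of_transcendental_below {n : ℕ} {t : Fin n → F}
    (h : ∀ i : Fin n, Transcendental (belowField G t i) (t i)) : AlgebraicIndependent G t := by
  have key : ∀ i : ℕ, i ≤ n → AlgebraicIndepOn G t {j : Fin n | (j : ℕ) < i} := by
    intro i hi
    induction i with
    | zero =>
      have : {j : Fin n | (j : ℕ) < 0} = ∅ := by ext; simp
      rw [this]
      exact algebraicIndependent_empty_type_iff.2 (algebraMap G F).injective
    | succ i ih =>
      have hs : {j : Fin n | (j : ℕ) < i + 1} = insert ⟨i, hi⟩ {j : Fin n | (j : ℕ) < i} := by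
        ext j
        simp [Fin.ext_iff]
        omega
      rw [hs]
      refine (ih (by omega)).insert ?_
      have := h ⟨i, hi⟩
      rw [belowField_eq_adjoin_image] at this
      rintro ⟨p, hp, hp0⟩
      refine this ⟨p.map (Subalgebra.inclusion
        (IntermediateField.algebra_adjoin_le_adjoin G _)).toRingHom, ?_, ?_⟩
      · rwa [Polynomial.map_ne_zero_iff (Subalgebra.inclusion_injective _)]
      · rw [aeval_def, eval₂_map]
        exact hp0
  have h1 := key n le_rfl
  have h2 : {j : Fin n | (j : ℕ) < n} = Set.univ := by ext j; simp
  rw [h2] at h1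
  exact h1.comp (fun i => (⟨i, trivial⟩ : (Set.univ : Set (Fin n))))
    (fun i j hij => congrArg (Subtype.val) hij)

theorem IsPiSigmaStarExt.const_mem {σG : G ≃+* G} {σF : F ≃+* F} {n : ℕ} {t : Fin n → F}
    (h : IsPiSigmaStarExt σG σF t) (x : F) (hx : σF x = x) : x ∈ Set.range (algebraMap G F) := by
  obtain ⟨-, htop, hgen⟩ := h
  have key : ∀ i : ℕ, i ≤ n → constIn σF (belowField G t i) = constIn σF (belowField G t 0) := by
    intro i hi
    induction i with
    | zero => rfl
    | succ i ih =>
      rw [← ih (by omega)]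
      rcases hgen ⟨i, hi⟩ with h | h
      · exact h.2.2
      · exact h.2.2
  have : x ∈ constIn σF (belowField G t n) := by
    refine ⟨?_, hx⟩
    rw [belowField_last, htop]; trivial
  rw [key n le_rfl, belowField_zero] at this
  exact IntermediateField.mem_bot.1 this.1

theorem IsPiSigmaStarExt.diffTower {σG : G ≃+* G} {σF : F ≃+* F} {n : ℕ} {t : Fin n → F}
    (h : IsPiSigmaStarExt σG σF t) : DiffTower G σF t where
  indep := algebraicIndependent_of_transcendental_below fun i =>
    (h.2.2 i).elim (fun h => h.1) (fun h => h.1)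
  top := h.2.1
  base x := ⟨σG x, (h.1 x).symm⟩
  step i := by
    rcases h.2.2 i with ⟨-, ⟨a, ha, ha0, hσ⟩, -⟩ | ⟨-, ⟨a, ha, ha0, hσ⟩, -⟩
    · exact ⟨a, ha, ha0, Or.inl hσ⟩
    · exact ⟨a, ha, ha0, Or.inr hσ⟩
  const := h.const_mem

theorem IsSigmaStarExt.isPiSigmaStarExt {σG : G ≃+* G} {σF : F ≃+* F} {n : ℕ} {t : Fin n → F}
    (h : IsSigmaStarExt σG σF t) : IsPiSigmaStarExt σG σF t :=
  ⟨h.1, h.2.1, fun i => Or.inl (h.2.2 i)⟩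

variable [IsScalarTower G F E]

theorem mem_of_mem_adjoin_tower {n : ℕ} {t : Fin n → F}
    (ht : IntermediateField.adjoin G (Set.range t) = ⊤) {K : IntermediateField G E}
    (hK : ∀ j, algebraMap F E (t j) ∈ K) {S : Set E} (hS : S ⊆ K) {x : E}
    (hx : x ∈ IntermediateField.adjoin F S) : x ∈ K := by
  have hF : ∀ y : F, algebraMap F E y ∈ K := by
    intro y
    have hy : y ∈ IntermediateField.adjoin G (Set.range t) := by rw [ht]; trivial
    rw [← mem_adjoin_map_iff (IsScalarTower.toAlgHom G F E)] at hy
    refine IntermediateField.adjoin_le_iff.2 ?_ hy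
    rintro _ ⟨_, ⟨j, rfl⟩, rfl⟩
    exact hK j
  induction hx using IntermediateField.adjoin_induction with
  | mem x hx => exact hS hx
  | algebraMap x => exact hF x
  | add x y _ _ hx hy => exact add_mem hx hy
  | inv x _ hx => exact inv_mem hx
  | mul x y _ _ hx hy => exact mul_mem hx hy

variable {n m : ℕ} {t : Fin n → F} {s : Fin m → E}

omit [Algebra G F] [Algebra G E] [IsScalarTower G F E] in
@[simp] theorem towerAppend_castAdd (i : Fin n) :
    towerAppend t s (Fin.castAdd m i) = algebraMap F E (t i) := Fin.append_left _ _ _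

omit [Algebra G F] [Algebra G E] [IsScalarTower G F E] in
@[simp] theorem towerAppend_natAdd (i : Fin m) :
    towerAppend t s (Fin.natAdd n i) = s i := Fin.append_right _ _ _

theorem mem_belowField_towerAppend (ht : IntermediateField.adjoin G (Set.range t) = ⊤) {l : ℕ}
    {x : E} : x ∈ belowField G (towerAppend t s) (n + l) ↔ x ∈ belowField F s l := by
  constructor
  · intro hx
    have : belowField G (towerAppend t s) (n + l) ≤ (belowField F s l).restrictScalars G := by
      rw [belowField, IntermediateField.adjoin_le_iff]
      rintro _ ⟨j, hj, rfl⟩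
      induction j using Fin.addCases with
      | left j =>
        rw [towerAppend_castAdd]
        exact (belowField F s l).algebraMap_mem _
      | right j =>
        rw [towerAppend_natAdd]
        refine IntermediateField.subset_adjoin F _ ⟨j, ?_, rfl⟩
        simpa using hj
    exact this hx
  · refine mem_of_mem_adjoin_tower ht (fun j => ?_) ?_
    · refine IntermediateField.subset_adjoin G _ ⟨Fin.castAdd m j, ?_, towerAppend_castAdd j⟩
      have := j.2
      simp
      omega
    · rintro _ ⟨j, hj, rfl⟩
      refine IntermediateField.subset_adjoin G _ ⟨Fin.natAdd n j, ?_, towerAppend_natAdd j⟩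
      simpa using hj

theorem DiffTower.append {σF : F ≃+* F} {σE : E ≃+* E} (ht : DiffTower G σF t)
    (hs : DiffTower F σE s) (hFE : IsDiffExt σF σE) : DiffTower G σE (towerAppend t s) where
  indep := by
    have h := ht.indep.sumElim_comp hs.indep
    -- The independence statement lists the outer generators `s` first, whereas `towerAppend` lists
    -- them last.
    have h' := h.comp (Sum.swap ∘ finSumFinEquiv.symm : Fin (n + m) → Fin m ⊕ Fin n)
      (Sum.swap_leftInverse.injective.comp finSumFinEquiv.symm.injective)
    convert h' using 1
    ext j
    induction j using Fin.addCases with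
    | left j => simp
    | right j => simp
  top := by
    rw [eq_top_iff]
    intro x _
    rw [← belowField_last, mem_belowField_towerAppend ht.top, belowField_last, hs.top]
    trivial
  base x := by
    obtain ⟨y, hy⟩ := ht.base x
    refine ⟨y, ?_⟩
    rw [IsScalarTower.algebraMap_apply G F E, IsScalarTower.algebraMap_apply G F E, hy, hFE]
  step i := by
    induction i using Fin.addCases with
    | left i =>
      obtain ⟨a, ha, ha0, h⟩ := ht.step i
      refine ⟨algebraMap F E a, ?_, by simpa using ha0, ?_⟩
      · exact (mem_belowField_castLE (IsScalarTower.toAlgHom G F E) (Nat.le_add_right n m)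
          (T' := towerAppend t s) (fun j => towerAppend_castAdd j) i a).2 ha
      · rw [towerAppend_castAdd, hFE, ← map_add, ← map_mul]
        exact h.imp (congrArg _) (congrArg _)
    | right i =>
      obtain ⟨a, ha, ha0, h⟩ := hs.step i
      refine ⟨a, ?_, ha0, ?_⟩
      · have := mem_belowField_towerAppend (G := G) (s := s) ht.top (l := i) (x := a)
        simpa using this.2 ha
      · rwa [towerAppend_natAdd]
  const x hx := by
    obtain ⟨y, rfl⟩ := hs.const x hx
    rw [hFE] at hx
    obtain ⟨z, rfl⟩ := ht.const y ((algebraMap F E).injective hx)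
    exact ⟨z, IsScalarTower.algebraMap_apply G F E z⟩

theorem DiffTower.trunc {σF : F ≃+* F} (ht : DiffTower G σF t) (i : Fin n)
    {σK : belowField G t i ≃+* belowField G t i}
    (hσK : ∀ y : belowField G t i, ((σK y : belowField G t i) : F) = σF (y : F)) :
    DiffTower G σK (truncTower G t i) := by
  have hi : (i : ℕ) ≤ n := i.2.le
  have hc : ∀ j : Fin i, t (Fin.castLE hi j) = (belowField G t i).val (truncTower G t i j) :=
    fun j => rfl
  refine ⟨?_, ?_, ?_, ?_, ?_⟩
  · rw [← (belowField G t i).val.algebraicIndependent_iff (belowField G t i).val.injective]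
    exact ht.indep.comp (Fin.castLE hi) (Fin.castLE_injective hi)
  · rw [eq_top_iff]
    intro x _
    rw [← mem_adjoin_map_iff (belowField G t i).val]
    have : (belowField G t i).val '' (Set.range (truncTower G t i)) =
        {x | ∃ j : Fin n, (j : ℕ) < i ∧ t j = x} := by
      ext y
      constructor
      · rintro ⟨_, ⟨j, rfl⟩, rfl⟩
        exact ⟨Fin.castLE hi j, j.2, rfl⟩
      · rintro ⟨j, hj, rfl⟩
        exact ⟨_, ⟨⟨j, hj⟩, rfl⟩, rfl⟩
    rw [this]
    exact x.2
  · intro x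
    obtain ⟨y, hy⟩ := ht.base x
    exact ⟨y, Subtype.ext (by rw [hσK]; exact hy)⟩
  · intro j
    obtain ⟨a, ha, ha0, h⟩ := ht.step (Fin.castLE hi j)
    have ha' : a ∈ belowField G t i := belowField_mono t (by simp) ha
    refine ⟨⟨a, ha'⟩, ?_, fun h0 => ha0 (congrArg Subtype.val h0), ?_⟩
    · rw [← mem_belowField_castLE (belowField G t i).val hi hc j]
      exact ha
    · refine h.imp (fun h => Subtype.ext ?_) (fun h => Subtype.ext ?_)
      · rw [hσK]; exact h
      · rw [hσK]; exact h
  · intro x hx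
    obtain ⟨y, hy⟩ := ht.const x (by rw [← hσK, hx])
    exact ⟨y, Subtype.ext hy⟩

end TowerConstruction

/-! ### Extensions by sums as sequences of generators. -/

section Sequences

variable {U : Type*} [Field U] {σ : U →+* U} {d : ℕ} {K L : Filtr U}

omit [Field U] in
theorem range_finSnoc {r : ℕ} (y : Fin r → U) (z : U) :
    Set.range (Fin.snoc y z : Fin (r + 1) → U) = insert z (Set.range y) := by
  ext x
  constructor
  · rintro ⟨j, rfl⟩
    induction j using Fin.lastCases with
    | last => simp
    | cast j => simp
  · rintro (rfl | ⟨j, rfl⟩)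
    · exact ⟨Fin.last r, by simp⟩
    · exact ⟨j.castSucc, by simp⟩

/-- An extension by sums of level at most `d`, written as a sequence of generators. -/
theorem Filtr.SumExt.exists_seq (h : Filtr.SumExt σ d K L) :
    ∃ (r : ℕ) (y : Fin r → U) (m : Fin r → ℕ), (∀ j, m j < d) ∧
      L.top = K.top ⊔ Subfield.closure (Set.range y) ∧
      (∀ k, L.lev k = K.lev k ⊔ Subfield.closure (y '' {j | m j < k})) ∧
      (∀ j, σ (y j) - y j ∈ K.lev (m j) ⊔ Subfield.closure (y '' {l | l < j ∧ m l < m j})) ∧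
      ∀ j, y j ∉ K.top ⊔ Subfield.closure (y '' {l | l < j}) := by
  induction h with
  | refl =>
    exact ⟨0, Fin.elim0, Fin.elim0, fun j => j.elim0, by simp, fun k => by simp,
      fun j => j.elim0, fun j => j.elim0⟩
  | @step L z i _ hi hz hz' ih =>
    obtain ⟨r, y, m, hm, htop, hlev, hsum, hnot⟩ := ih
    have himg : ∀ (p : Fin (r + 1) → Prop), p (Fin.last r) →
        (Fin.snoc y z : Fin (r + 1) → U) '' {j | p j} = insert z (y '' {j | p j.castSucc}) := by
      intro p hp
      ext x
      constructor
      · rintro ⟨j, hj, rfl⟩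
        induction j using Fin.lastCases with
        | last => simp
        | cast j => exact Or.inr ⟨j, hj, by simp⟩
      · rintro (rfl | ⟨j, hj, rfl⟩)
        · exact ⟨Fin.last r, hp, by simp⟩
        · exact ⟨j.castSucc, hj, by simp⟩
    have himg' : ∀ (p : Fin (r + 1) → Prop), ¬ p (Fin.last r) →
        (Fin.snoc y z : Fin (r + 1) → U) '' {j | p j} = y '' {j | p j.castSucc} := by
      intro p hp
      ext x
      constructor
      · rintro ⟨j, hj, rfl⟩
        induction j using Fin.lastCases with
        | last => exact absurd hj hp
        | cast j => exact ⟨j, hj, by simp⟩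
      · rintro ⟨j, hj, rfl⟩
        exact ⟨j.castSucc, hj, by simp⟩
    refine ⟨r + 1, Fin.snoc y z, Fin.snoc m i, ?_, ?_, ?_, ?_, ?_⟩
    · intro j
      induction j using Fin.lastCases with
      | last => simpa using hi
      | cast j => simpa using hm j
    · rw [range_finSnoc, sup_closure_insert, ← htop]
      rfl
    · intro k
      simp only [Filtr.add]
      split_ifs with hk
      · rw [himg _ (by simpa using hk), sup_closure_insert, hlev]
        simp
      · rw [himg' _ (by simpa using hk), hlev]
        simp
    · intro j
      induction j using Fin.lastCases with
      | last =>
        rw [himg' _ (by simp)]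
        simpa [hlev] using hz
      | cast j =>
        rw [himg' _ (by simpa using fun h => absurd h (not_lt.2 (Fin.le_last _)))]
        simpa using hsum j
    · intro j
      induction j using Fin.lastCases with
      | last =>
        rw [himg' _ (by simp)]
        have : y '' {l | l.castSucc < Fin.last r} = Set.range y := by
          ext x
          constructor
          · rintro ⟨l, -, rfl⟩; exact ⟨l, rfl⟩
          · rintro ⟨l, rfl⟩; exact ⟨l, Fin.castSucc_lt_last l, rfl⟩
        rw [this, ← htop]
        simpa using hz'
      | cast j =>
        rw [himg' _ (by simpa using not_lt.2 (Fin.le_last _))]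
        simpa using hnot j

/-- The ambient map is only an endomorphism; a difference field needs an automorphism, so
surjectivity on `L.top` has to be derived from that on `K.top`. -/
theorem Filtr.SumExt.surj (h : Filtr.SumExt σ d K L) (hK : ∀ k, K.lev k ≤ K.top)
    (hs : K.top ≤ K.top.map σ) : (∀ k, L.lev k ≤ L.top) ∧ L.top ≤ L.top.map σ := by
  induction h with
  | refl => exact ⟨hK, hs⟩
  | @step L z i _ hi hz hz' ih =>
    refine ⟨?_, ?_⟩
    · intro k
      simp only [Filtr.add]
      split_ifs
      · exact sup_le_sup_right (ih.1 k) _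
      · exact (ih.1 k).trans le_sup_left
    · simp only [Filtr.add]
      have hle : L.top ≤ (L.top ⊔ Subfield.closure {z}).map σ := by
        intro x hx
        obtain ⟨w, hw, rfl⟩ := ih.2 hx
        exact ⟨w, le_sup_closure _ _ hw, rfl⟩
      refine sup_closure_le hle ?_
      rintro x rfl
      have h1 : σ x ∈ (L.top ⊔ Subfield.closure {x}).map σ := ⟨x, mem_sup_closure_singleton, rfl⟩
      have := sub_mem h1 (hle (ih.1 _ hz))
      simpa using this

end Sequences

/-! ### The depth filtration of an embedded tower. -/

section Embedding

variable {G X U : Type u} [Field G] [Field X] [Field U] [Algebra G X] [Algebra G U]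

theorem adjoin_toSubfield_eq (S : Set U) :
    (IntermediateField.adjoin G S).toSubfield =
      (algebraMap G U).fieldRange ⊔ Subfield.closure S := by
  change Subfield.closure _ = _
  rw [Subfield.closure_union]
  congr 1
  rw [← RingHom.coe_fieldRange, Subfield.closure_eq]

theorem mem_sup_closure_iff (S : Set U) (x : U) :
    x ∈ (algebraMap G U).fieldRange ⊔ Subfield.closure S ↔ x ∈ IntermediateField.adjoin G S := by
  rw [← adjoin_toSubfield_eq]; rfl

theorem map_mem_sup_closure_iff (φ : X →ₐ[G] U) (S : Set X) (x : X) :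
    φ x ∈ (algebraMap G U).fieldRange ⊔ Subfield.closure (φ '' S) ↔
      x ∈ IntermediateField.adjoin G S := by
  rw [mem_sup_closure_iff, mem_adjoin_map_iff]

theorem exists_of_mem_sup_closure (φ : X →ₐ[G] U) {S : Set X} {y : U}
    (hy : y ∈ (algebraMap G U).fieldRange ⊔ Subfield.closure (φ '' S)) :
    ∃ x ∈ IntermediateField.adjoin G S, φ x = y := by
  rw [mem_sup_closure_iff, ← IntermediateField.adjoin_map] at hy
  exact hy

/-- The filtration by depth of the field generated by the first `i` entries of `h`. -/
def towerFiltr (G₀ : Subfield U) {n : ℕ} (h : Fin n → U) (δ : Fin n → ℕ) (i : ℕ) : Filtr U where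
  lev k := G₀ ⊔ Subfield.closure (h '' {j | (j : ℕ) < i ∧ δ j ≤ k})
  top := G₀ ⊔ Subfield.closure (h '' {j | (j : ℕ) < i})

theorem towerFiltr_lev_le (G₀ : Subfield U) {n : ℕ} (h : Fin n → U) (δ : Fin n → ℕ) (i k : ℕ) :
    (towerFiltr G₀ h δ i).lev k ≤ (towerFiltr G₀ h δ i).top :=
  sup_le_sup_left (Subfield.closure_mono (Set.image_mono fun _ hj => hj.1)) _

theorem towerFiltr_zero (G₀ : Subfield U) {n : ℕ} (h : Fin n → U) (δ : Fin n → ℕ) :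
    towerFiltr G₀ h δ 0 = ⟨fun _ => G₀, G₀⟩ := by
  simp [towerFiltr]

/-- A tower generator enters at the level of its depth, so `Good` can be propagated along the tower
by `Good.add`. -/
theorem towerFiltr_succ (G₀ : Subfield U) {n : ℕ} (h : Fin n → U) (δ : Fin n → ℕ) (i : Fin n) :
    towerFiltr G₀ h δ (i + 1) = (towerFiltr G₀ h δ i).add (h i) (δ i) := by
  have h1 : {j : Fin n | (j : ℕ) < i + 1} = insert i {j : Fin n | (j : ℕ) < i} := by
    ext j
    simp [Fin.ext_iff]
    omega
  ext1
  · funext k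
    simp only [towerFiltr, Filtr.add]
    split_ifs with hk
    · have : {j : Fin n | (j : ℕ) < i + 1 ∧ δ j ≤ k} =
          insert i {j : Fin n | (j : ℕ) < i ∧ δ j ≤ k} := by
        ext j
        simp only [Set.mem_ofPred_eq, Set.mem_insert_iff, Fin.ext_iff]
        constructor
        · rintro ⟨h1, h2⟩
          by_cases h3 : (j : ℕ) = i
          · exact Or.inl h3
          · exact Or.inr ⟨by omega, h2⟩
        · rintro (h3 | ⟨h3, h4⟩)
          · exact ⟨by omega, by rw [Fin.ext h3]; exact hk⟩
          · exact ⟨by omega, h4⟩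
      rw [this, Set.image_insert_eq, sup_closure_insert]
    · congr 3
      ext j
      simp only [Set.mem_ofPred_eq]
      constructor
      · rintro ⟨h1, h2⟩
        refine ⟨?_, h2⟩
        by_contra h3
        have : j = i := Fin.ext (by omega)
        exact hk (this ▸ h2)
      · rintro ⟨h1, h2⟩
        exact ⟨by omega, h2⟩
  · simp only [towerFiltr, Filtr.add]
    rw [h1, Set.image_insert_eq, sup_closure_insert]

end Embedding

/-! ### A criterion for extensions by sums. -/

section SumSequence

variable {K L : Type u} [Field K] [Field L] [Algebra K L] [CharZero L]

/-- A sequence of sums, each of which is not contained in the field below it, generates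
a `Σ*`-extension, if all constants come from the ground field. -/
theorem isSigmaStarExt_of_sums {σ : K ≃+* K} {τ : L ≃+* L} {r : ℕ} {x : Fin r → L}
    (hext : IsDiffExt σ τ) (htop : IntermediateField.adjoin K (Set.range x) = ⊤)
    (hconst : ∀ c, τ c = c → c ∈ Set.range (algebraMap K L))
    (hsum : ∀ j : Fin r, τ (x j) - x j ∈ belowField K x j)
    (hnot : ∀ j : Fin r, x j ∉ belowField K x j) : IsSigmaStarExt σ τ x := by
  have hC : ∀ (i : ℕ) (c : L), τ c = c → c ∈ belowField K x i := by
    intro i c hc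
    obtain ⟨a, rfl⟩ := hconst c hc
    exact (belowField K x i).algebraMap_mem a
  have hstable : ∀ i : ℕ, SigmaStable (τ : L →+* L) (belowField K x i).toSubfield := by
    intro i y hy
    change τ y ∈ belowField K x i
    change y ∈ belowField K x i at hy
    induction hy using IntermediateField.adjoin_induction with
    | mem y hy =>
      obtain ⟨j, hj, rfl⟩ := hy
      have h1 := belowField_mono x hj.le (hsum j)
      have h2 : x j ∈ belowField K x i := IntermediateField.subset_adjoin _ _ ⟨j, hj, rfl⟩
      simpa using add_mem h1 h2
    | algebraMap y => rw [hext]; exact (belowField K x i).algebraMap_mem _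
    | add y z _ _ hy hz => rw [map_add]; exact add_mem hy hz
    | inv y _ hy => rw [map_inv₀]; exact inv_mem hy
    | mul y z _ _ hy hz => rw [map_mul]; exact mul_mem hy hz
  refine ⟨hext, htop, fun j => ⟨?_, ⟨_, hsum j, ?_, by ring⟩, ?_⟩⟩
  · exact transcendental_of_sum (σ := (τ : L →+* L)) (hstable j) (hC j) (hsum j) (hnot j)
  · intro h0
    exact hnot j (hC j _ (sub_eq_zero.1 h0))
  · ext c
    exact ⟨fun h => ⟨hC _ _ h.2, h.2⟩, fun h => ⟨hC _ _ h.2, h.2⟩⟩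

end SumSequence

/-! ### From extensions by sums of low level to shallow solutions. -/

section Extraction

variable {G X U : Type u} [Field G] [Field X] [Field U] [Algebra G X] [Algebra G U] [CharZero U]

/-- An extension of the field below `Tᵢ` by sums of level at most `d ≤ δ(f)` that contains a
solution of the telescoping problem for `f` is a shallow solution. -/
theorem hasShallowSolution_of_sumExt {σ : X ≃+* X} {σU : U →+* U} {N : ℕ} {T : Fin N → X}
    (hT : DiffTower G σ T) (φ : X →ₐ[G] U) (hφ : ∀ x, φ (σ x) = σU (φ x))
    (hC : ∀ x, σU x = x → x ∈ (algebraMap G U).fieldRange) (i : Fin N)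
    {σK : belowField G T i ≃+* belowField G T i}
    (hσK : ∀ y : belowField G T i, ((σK y : belowField G T i) : X) = σ (y : X))
    (f : belowField G T i) {d : ℕ} (hd : d ≤ elemDepth G σK (truncTower G T i) f) {L : Filtr U}
    (hL : Filtr.SumExt σU d
      (towerFiltr (algebraMap G U).fieldRange (φ ∘ T) (genDepth G σ T) i) L)
    {g : U} (hg : g ∈ L.top) (hgf : σU g - g = φ f) :
    HasShallowSolution G σK (truncTower G T i) f := by
  set K₀ := towerFiltr (algebraMap G U).fieldRange (φ ∘ T) (genDepth G σ T) i with hK₀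
  have hKtop : ∀ x : X, φ x ∈ K₀.top ↔ x ∈ belowField G T i := by
    intro x
    rw [belowField_eq_adjoin_image, ← map_mem_sup_closure_iff φ, Set.image_image]
    rfl
  have hKtop' : ∀ y ∈ K₀.top, ∃ x : belowField G T i, φ x = y := by
    intro y hy
    have hy' : y ∈ (algebraMap G U).fieldRange ⊔
        Subfield.closure (φ '' (T '' {j | (j : ℕ) < i})) := by
      rw [Set.image_image]; exact hy
    obtain ⟨x, hx, rfl⟩ := exists_of_mem_sup_closure φ hy'
    exact ⟨⟨x, hx⟩, rfl⟩
  -- On `K₀.top` surjectivity comes from the automorphism `σK`.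
  obtain ⟨hLlev, hLsurj⟩ := hL.surj (towerFiltr_lev_le _ _ _ _) (by
    intro y hy
    obtain ⟨x, rfl⟩ := hKtop' y hy
    refine ⟨φ (σK.symm x : belowField G T i), (hKtop _).2 (σK.symm x).2, ?_⟩
    rw [← hφ, ← hσK, RingEquiv.apply_symm_apply])
  have hKL : K₀.top ≤ L.top := hL.top_le
  obtain ⟨r, y, m, hm, htop, hlev, hsum, hnot⟩ := hL.exists_seq
  have hylt : ∀ j, σU (y j) - y j ∈ K₀.top ⊔ Subfield.closure (y '' {l | l < j}) := fun j =>
    (sup_le_sup (towerFiltr_lev_le _ _ _ _ _)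
      (Subfield.closure_mono (Set.image_mono fun l hl => hl.1)) :
        K₀.lev (m j) ⊔ _ ≤ _) (hsum j)
  have hyL : ∀ j, y j ∈ L.top := fun j => by rw [htop]; exact mem_sup_closure ⟨j, rfl⟩
  have hLst : SigmaStable σU L.top := by
    have h1 : SigmaStable σU K₀.top := by
      intro y hy
      obtain ⟨x, rfl⟩ := hKtop' y hy
      rw [← hφ, ← hσK]
      exact (hKtop _).2 (σK x).2
    rw [htop]
    refine h1.sup_closure ?_
    rintro _ ⟨j, rfl⟩
    have h2 : K₀.top ⊔ Subfield.closure (y '' {l | l < j}) ≤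
        K₀.top ⊔ Subfield.closure (Set.range y) :=
      sup_le_sup_left (Subfield.closure_mono (Set.image_subset_range _ _)) _
    simpa using add_mem (h2 (hylt j)) (mem_sup_closure (N := K₀.top) ⟨j, rfl⟩)
  -- the difference field `L`
  let τ : L.top ≃+* L.top := RingEquiv.ofBijective hLst.res
    ⟨hLst.res.injective, fun x => by
      obtain ⟨w, hw, h⟩ := hLsurj x.2
      exact ⟨⟨w, hw⟩, Subtype.ext h⟩⟩
  have hτ : ∀ x : L.top, ((τ x : L.top) : U) = σU x := fun x => rfl
  let ψ : belowField G T i →+* L.top :=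
    ((φ : X →+* U).comp (belowField G T i).val.toRingHom).codRestrict L.top
      (fun x => hKL ((hKtop _).2 x.2))
  have hψ : ∀ x, ((ψ x : L.top) : U) = φ x := fun x => rfl
  let _ : Algebra (belowField G T i) L.top := ψ.toAlgebra
  let _ : Algebra G L.top := (ψ.comp (algebraMap G (belowField G T i))).toAlgebra
  have : IsScalarTower G (belowField G T i) L.top := IsScalarTower.of_algebraMap_eq fun _ => rfl
  have hψ' : ∀ x, ((algebraMap (belowField G T i) L.top x : L.top) : U) = φ x := fun x => rfl
  let ι : L.top →ₐ[G] U :=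
    { L.top.subtype with
      commutes' := fun c => by
        change φ (algebraMap G X c) = _
        rw [AlgHom.commutes] }
  have hι : ∀ x, ι x = (x : U) := fun x => rfl
  let x : Fin r → L.top := fun j => ⟨y j, hyL j⟩
  -- subfields of `L` generated by some of the `x`
  have himg : ∀ (S : Set (Fin r)) (w : L.top),
      w ∈ IntermediateField.adjoin (belowField G T i) (x '' S) ↔
        (w : U) ∈ K₀.top ⊔ Subfield.closure (y '' S) := by
    intro S w
    have h1 : (IntermediateField.adjoin (belowField G T i) (x '' S)).toSubfield.map L.top.subtype =
        K₀.top ⊔ Subfield.closure (y '' S) := by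
      change (Subfield.closure _).map _ = _
      rw [RingHom.map_field_closure, Set.image_union, Subfield.closure_union]
      congr 1
      · rw [← K₀.top.closure_eq]
        congr 1
        ext z
        constructor
        · rintro ⟨_, ⟨v, rfl⟩, rfl⟩
          exact (hKtop _).2 v.2
        · intro hz
          obtain ⟨v, rfl⟩ := hKtop' z hz
          exact ⟨_, ⟨v, rfl⟩, rfl⟩
      · rw [Set.image_image]; rfl
    rw [← h1]
    constructor
    · intro h; exact ⟨w, h, rfl⟩
    · rintro ⟨w', h, hw⟩
      rwa [← Subtype.ext hw]
  have hbelow : ∀ (j : Fin r), belowField (belowField G T i) x j =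
      IntermediateField.adjoin (belowField G T i) (x '' {l | l < j}) := fun j => rfl
  have hext : IsDiffExt σK τ := by
    intro v
    apply Subtype.ext
    rw [hτ, hψ', hψ', hσK, hφ]
  have hstar : IsSigmaStarExt σK τ x := by
    refine isSigmaStarExt_of_sums hext ?_ ?_ ?_ ?_
    · rw [eq_top_iff]
      intro w _
      rw [← Set.image_univ, himg, Set.image_univ, ← htop]
      exact w.2
    · intro c hc
      obtain ⟨a, ha⟩ := hC c (by rw [← hτ, hc])
      refine ⟨algebraMap G _ a, Subtype.ext ?_⟩
      rw [hψ', ← ha]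
      exact φ.commutes a
    · intro j
      rw [hbelow, himg]
      exact hylt j
    · intro j
      rw [hbelow, himg]
      exact hnot j
  have htrunc := hT.trunc i hσK
  have hTA : DiffTower G τ (towerAppend (truncTower G T i) x) :=
    htrunc.append hstar.isPiSigmaStarExt.diffTower hext
  have hdep₁ : ∀ l : Fin i, genDepth G τ (towerAppend (truncTower G T i) x) (Fin.castAdd r l) =
      genDepth G σ T (Fin.castLE i.2.le l) := by
    intro l
    have h1 := genDepth_castLE htrunc hTA (IsScalarTower.toAlgHom G (belowField G T i) L.top)
      (fun v => (hext v).symm) (Nat.le_add_right i r) (fun j => towerAppend_castAdd j) l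
    have h2 := genDepth_castLE htrunc hT (belowField G T i).val hσK i.2.le (fun j => rfl) l
    exact h1.trans h2.symm
  have hdep₂ : ∀ j : Fin r,
      genDepth G τ (towerAppend (truncTower G T i) x) (Fin.natAdd i j) ≤ m j + 1 := by
    intro j
    induction j using WellFoundedLT.induction with
    | ind j ih =>
      -- The difference of `yⱼ` involves only tower generators of depth `≤ mⱼ` and earlier `yₗ` with
      -- `mₗ < mⱼ`, which by induction have depth `≤ mₗ + 1 ≤ mⱼ`.
      refine hTA.genDepth_le (S := (Fin.castAdd r '' {l | genDepth G σ T (Fin.castLE i.2.le l) ≤ m j})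
        ∪ (Fin.natAdd i '' {l | l < j ∧ m l < m j})) rfl ?_ ?_ ?_
      · rw [← map_mem_sup_closure_iff ι, Set.image_union, Set.image_union, Subfield.closure_union,
          ← sup_assoc]
        have h1 : ι '' (towerAppend (truncTower G T i) x '' (Fin.castAdd r ''
            {l | genDepth G σ T (Fin.castLE i.2.le l) ≤ m j})) =
            (φ ∘ T) '' {l | (l : ℕ) < i ∧ genDepth G σ T l ≤ m j} := by
          ext z
          constructor
          · rintro ⟨_, ⟨_, ⟨l, hl, rfl⟩, rfl⟩, rfl⟩
            refine ⟨Fin.castLE i.2.le l, ⟨l.2, hl⟩, ?_⟩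
            rw [towerAppend_castAdd]
            rfl
          · rintro ⟨l, ⟨hl, hl'⟩, rfl⟩
            refine ⟨_, ⟨_, ⟨⟨l, hl⟩, hl', rfl⟩, rfl⟩, ?_⟩
            rw [towerAppend_castAdd]
            rfl
        have h2 : ι '' (towerAppend (truncTower G T i) x '' (Fin.natAdd i ''
            {l | l < j ∧ m l < m j})) = y '' {l | l < j ∧ m l < m j} := by
          rw [Set.image_image, Set.image_image]
          refine Set.image_congr fun l _ => ?_
          rw [towerAppend_natAdd]
          rfl
        rw [h1, h2, towerAppend_natAdd]
        exact hsum j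
      · rintro _ (⟨l, -, rfl⟩ | ⟨l, hl, rfl⟩)
        · have := l.2
          exact Fin.lt_def.2 (by simp only [Fin.val_castAdd, Fin.val_natAdd]; omega)
        · simpa using hl.1
      · rintro _ (⟨l, hl, rfl⟩ | ⟨l, hl, rfl⟩)
        · rw [hdep₁]; exact hl
        · exact (ih l hl.1).trans hl.2
  refine ⟨L.top, inferInstance, inferInstance, inferInstance, inferInstance, τ, r, x, hstar, ?_,
    ⟨g, hg⟩, ?_⟩
  · refine le_trans ?_ hd
    rw [extDepth, Finset.sup_le_iff]
    exact fun j _ => (hdep₂ j).trans (hm j)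
  · exact Subtype.ext hgf

end Extraction

/-! ### Amalgamating an extension by sums with an arbitrary extension. -/

section SumAdjunction

/-- A difference field can be extended by a solution of a telescoping problem
without adding constants. -/
theorem exists_extension_with_sum {U : Type u} [Field U] [CharZero U] (σ : U →+* U) (β : U) :
    ∃ (V : Type u) (_ : Field V) (j : U →+* V) (τ : V →+* V) (y : V),
      (∀ x, τ (j x) = j (σ x)) ∧ τ y - y = j β ∧ ∀ c, τ c = c → ∃ c₀, σ c₀ = c₀ ∧ j c₀ = c := by
  -- If `β` already telescopes, a new indeterminate `X` would produce the new constant `X - v`, so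
  -- nothing is adjoined.
  by_cases hv : ∃ v, σ v - v = β
  · obtain ⟨v, hv⟩ := hv
    exact ⟨U, inferInstance, RingHom.id U, σ, v, fun x => rfl, hv, fun c hc => ⟨c, hc, rfl⟩⟩
  push Not at hv
  let θ : U[X] →+* U[X] := (taylorAlgHom β).toRingHom.comp (mapRingHom σ)
  have hθ : ∀ p, θ p = taylor β (p.map σ) := fun p => rfl
  have hθi : Function.Injective θ := by
    intro p q hpq
    rw [hθ, hθ] at hpq
    exact map_injective σ σ.injective (taylor_injective β hpq)
  have hinj : Function.Injective ((algebraMap U[X] (RatFunc U)).comp θ) :=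
    (IsFractionRing.injective U[X] (RatFunc U)).comp hθi
  let τ : RatFunc U →+* RatFunc U := IsFractionRing.lift hinj
  have hτ : ∀ p : U[X], τ (algebraMap _ _ p) = algebraMap _ _ (θ p) := fun p =>
    IsFractionRing.lift_algebraMap hinj p
  let j : U →+* RatFunc U := algebraMap U (RatFunc U)
  have hj : ∀ x, j x = algebraMap U[X] (RatFunc U) (C x) := fun x => by
    rw [RatFunc.algebraMap_C]; rfl
  have hτj : ∀ x, τ (j x) = j (σ x) := fun x => by
    rw [hj, hτ, hθ, hj]; simp
  have hτX : τ RatFunc.X = RatFunc.X + j β := by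
    rw [← RatFunc.algebraMap_X, hτ, hθ, hj, ← map_add]; simp
  refine ⟨RatFunc U, inferInstance, j, τ, RatFunc.X, hτj, by rw [hτX]; ring, fun c hc => ?_⟩
  have : CharZero (RatFunc U) := charZero_of_injective_ringHom j.injective
  have hN : SigmaStable τ j.fieldRange := by
    rintro _ ⟨x, rfl⟩
    exact ⟨σ x, (hτj x).symm⟩
  have htr : Transcendental j.fieldRange (RatFunc.X : RatFunc U) := by
    rintro ⟨p, hp, hp0⟩
    refine RatFunc.transcendental_X ⟨p.map j.rangeRestrictFieldEquiv.symm.toRingHom, ?_, ?_⟩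
    · rwa [Polynomial.map_ne_zero_iff j.rangeRestrictFieldEquiv.symm.injective]
    · rw [aeval_def, eval₂_map, ← hp0, aeval_def]
      congr 1
      ext x
      exact RingHom.rangeRestrictFieldEquiv_apply_symm_apply j x
  have hmem : c ∈ j.fieldRange ⊔ Subfield.closure {(RatFunc.X : RatFunc U)} := by
    rw [mem_sup_closure_iff, RatFunc.adjoin_X]
    trivial
  -- A constant solves the homogeneous equation with `u = 1`, hence has degree `0` in `X`.
  obtain ⟨p, hp, -, h0⟩ := exists_aeval_of_first_order (u := 1) (f := 0) hN ⟨β, rfl⟩ hτX htr (by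
    rintro _ ⟨v, rfl⟩ h
    rw [hτj, ← map_sub] at h
    exact hv v (j.injective h)) hmem (one_mem _) one_ne_zero (zero_mem _) (by rw [hc]; ring)
  obtain ⟨c₀, hc₀⟩ := (p.coeff 0).2
  have hcc : j c₀ = c := by
    rw [hp, eq_C_of_natDegree_eq_zero (h0 rfl), aeval_C]
    exact hc₀
  refine ⟨c₀, j.injective ?_, hcc⟩
  rw [← hτj, hcc, hc]

variable {F E H : Type u} [Field F] [Field E] [Field H] [Algebra F E] [Algebra F H]

/-- The subfield `M` of `(E, σE)` and `(H, σH)` have a common extension over `F`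
without new constants. -/
def HasJointExtension (σE : E ≃+* E) (σH : H ≃+* H) (M : Subfield E) : Prop :=
  ∃ (U : Type u) (_ : Field U) (j : H →+* U) (σ : U →+* U) (ψ : M →+* U),
    (∀ x, σ (j x) = j (σH x)) ∧ (∀ c, σ c = c → ∃ c₀, σH c₀ = c₀ ∧ j c₀ = c) ∧
    (∀ x y : M, (y : E) = σE x → ψ y = σ (ψ x)) ∧
    ∀ (a : F) (x : M), (x : E) = algebraMap F E a → ψ x = j (algebraMap F H a)

theorem HasJointExtension.base {σF : F ≃+* F} {σE : E ≃+* E} {σH : H ≃+* H}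
    (hE : IsDiffExt σF σE) (hH : IsDiffExt σF σH) :
    HasJointExtension (F := F) σE σH (algebraMap F E).fieldRange := by
  have hsymm : ∀ (a : F) (x : (algebraMap F E).fieldRange), (x : E) = algebraMap F E a →
      (algebraMap F E).rangeRestrictFieldEquiv.symm x = a := by
    intro a x hx
    apply (algebraMap F E).injective
    rw [RingHom.rangeRestrictFieldEquiv_apply_symm_apply, hx]
  refine ⟨H, inferInstance, RingHom.id H, σH,
    (algebraMap F H).comp (algebraMap F E).rangeRestrictFieldEquiv.symm.toRingHom,
    fun x => rfl, fun c hc => ⟨c, hc, rfl⟩, ?_, ?_⟩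
  · rintro ⟨_, a, rfl⟩ y hy
    rw [hE] at hy
    exact (congrArg (algebraMap F H) (hsymm _ y hy)).trans ((hH a).symm.trans
      (congrArg (fun v => σH (algebraMap F H v)) (hsymm a _ rfl).symm))
  · intro a x hx
    exact congrArg (algebraMap F H) (hsymm a x hx)

/-- Adjoin to `U` a solution `y` of the telescoping equation of `z`. It may already lie in `U`, but
not in the image of `M`, since then `z` would differ from an element of `M` by a constant. So `y` is
transcendental over that image, and `z ↦ y` extends the embedding. -/
theorem HasJointExtension.adjoin [CharZero E] [CharZero H] {σE : E ≃+* E} {σH : H ≃+* H}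
    (hCH : ∀ c, σH c = c → c ∈ Set.range (algebraMap F H)) {M : Subfield E}
    (h : HasJointExtension (F := F) σE σH M) (hFM : (algebraMap F E).fieldRange ≤ M)
    (hM : SigmaStable (σE : E →+* E) M) (hCM : ∀ x, σE x = x → x ∈ M) {z : E}
    (hz : σE z - z ∈ M) (hzM : z ∉ M) :
    HasJointExtension (F := F) σE σH (M ⊔ Subfield.closure {z}) := by
  obtain ⟨U, _, j, σ, ψ, hj, hC, hψ, hF⟩ := h
  have : CharZero U := charZero_of_injective_ringHom j.injective
  obtain ⟨V, _, j', τ, y, hj', hy, hC'⟩ := exists_extension_with_sum σ (ψ ⟨_, hz⟩)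
  have : CharZero V := charZero_of_injective_ringHom j'.injective
  let χ : M →+* V := j'.comp ψ
  have hχ : ∀ x y : M, (y : E) = σE x → χ y = τ (χ x) := fun x y hxy => by
    change j' _ = τ (j' _)
    rw [hψ x y hxy, hj']
  have hN : SigmaStable τ χ.fieldRange := by
    rintro _ ⟨x, rfl⟩
    exact ⟨⟨σE x, hM x x.2⟩, hχ _ _ rfl⟩
  have hNC : ∀ c, τ c = c → c ∈ χ.fieldRange := by
    intro c hc
    obtain ⟨c₁, hc₁, rfl⟩ := hC' c hc
    obtain ⟨c₂, hc₂, rfl⟩ := hC c₁ hc₁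
    obtain ⟨a, rfl⟩ := hCH c₂ hc₂
    exact ⟨⟨algebraMap F E a, hFM ⟨a, rfl⟩⟩, by
      change j' (ψ _) = _
      rw [hF a _ rfl]⟩
  have hyN : y ∉ χ.fieldRange := by
    rintro ⟨v, rfl⟩
    have h1 : χ (⟨σE v, hM v v.2⟩ - v) = χ ⟨_, hz⟩ := by
      rw [map_sub, hχ v _ rfl]
      exact hy
    have h2 := congrArg (Subtype.val) (χ.injective h1)
    have h3 : z - (v : E) ∈ M := hCM _ (by
      rw [map_sub]
      have h2' : σE v - v = σE z - z := h2
      linear_combination -h2')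
    exact hzM (by simpa using add_mem h3 v.2)
  have hyt : Transcendental χ.fieldRange y := transcendental_of_sum hN hNC
    (by rw [hy]; exact ⟨_, rfl⟩) hyN
  let _ : Algebra M V := χ.toAlgebra
  have hytM : Transcendental M y := by
    rintro ⟨p, hp, hp0⟩
    refine hyt ⟨p.map χ.rangeRestrictField, ?_, ?_⟩
    · rwa [Polynomial.map_ne_zero_iff χ.rangeRestrictField.injective]
    · rw [aeval_def, eval₂_map]
      exact hp0
  have hzt : Transcendental M z :=
    transcendental_of_sum (σ := (σE : E →+* E)) hM hCM hz hzM
  let ρ : IntermediateField.adjoin M {z} →ₐ[M] V :=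
    (IntermediateField.val _).comp ((RatFunc.algEquivOfTranscendental z hzt).symm.trans
      (RatFunc.algEquivOfTranscendental y hytM)).toAlgHom
  have hρz : ρ (IntermediateField.AdjoinSimple.gen M z) = y := by
    change (IntermediateField.val _) ((RatFunc.algEquivOfTranscendental y hytM)
      ((RatFunc.algEquivOfTranscendental z hzt).symm _)) = y
    rw [RatFunc.algEquivOfTranscendental_symm_gen, IntermediateField.coe_val,
      RatFunc.algEquivOfTranscendental_X]
  let ω : (M ⊔ Subfield.closure {z} : Subfield E) →+* V :=
    (ρ : IntermediateField.adjoin M {z} →+* V).comp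
      (Subfield.inclusion (adjoin_toSubfield M {z}).ge)
  have hωz : ∀ x : (M ⊔ Subfield.closure {z} : Subfield E), (x : E) = z → ω x = y := by
    intro x hx
    rw [← hρz]
    exact congrArg ρ (Subtype.ext hx)
  have hωM : ∀ (x : (M ⊔ Subfield.closure {z} : Subfield E)) (v : M), (x : E) = v → ω x = χ v := by
    intro x v hx
    have : ρ (algebraMap M _ v) = χ v := ρ.commutes v
    rw [← this]
    exact congrArg ρ (Subtype.ext hx)
  have hM' : SigmaStable (σE : E →+* E) (M ⊔ Subfield.closure {z}) := hM.adjoin_sum hz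
  refine ⟨V, inferInstance, j'.comp j, τ, ω, fun x => by
    change τ (j' (j x)) = j' (j _)
    rw [hj', hj], ?_, ?_, ?_⟩
  · intro c hc
    obtain ⟨c₁, hc₁, rfl⟩ := hC' c hc
    obtain ⟨c₂, hc₂, rfl⟩ := hC c₁ hc₁
    exact ⟨c₂, hc₂, rfl⟩
  -- `ω ∘ σ` and `τ ∘ ω` agree on a subfield that contains `M` and `z`.
  · have hle : M ⊔ Subfield.closure {z} ≤
        ((ω.comp hM'.res).eqLocusField (τ.comp ω)).map (Subfield.subtype _) := by
      refine sup_closure_le ?_ ?_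
      · intro x hx
        refine ⟨⟨x, le_sup_closure _ _ hx⟩, ?_, rfl⟩
        change ω _ = τ (ω _)
        rw [hωM (hM'.res _) ⟨σE x, hM x hx⟩ rfl, hωM ⟨x, _⟩ ⟨x, hx⟩ rfl]
        exact hχ _ _ rfl
      · rintro x rfl
        refine ⟨⟨x, mem_sup_closure_singleton⟩, ?_, rfl⟩
        change ω _ = τ (ω _)
        have h1 : hM'.res ⟨x, mem_sup_closure_singleton⟩ = (⟨x, mem_sup_closure_singleton⟩ +
            ⟨σE x - x, le_sup_closure _ _ hz⟩ : (M ⊔ Subfield.closure {x} : Subfield E)) :=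
          Subtype.ext (by
            change σE x = x + (σE x - x)
            ring)
        rw [h1, map_add, hωz _ rfl, hωM _ ⟨_, hz⟩ rfl]
        change y + j' (ψ _) = _
        rw [← hy]; ring
    intro x w hw
    obtain ⟨x', hx', hxx⟩ := hle x.2
    have : x' = x := Subtype.ext hxx
    subst this
    have h2 : ω (hM'.res x') = τ (ω x') := hx'
    rw [← h2]
    exact congrArg ω (Subtype.ext hw)
  · intro a x hx
    rw [hωM x ⟨algebraMap F E a, hFM ⟨a, rfl⟩⟩ hx]
    change j' (ψ _) = j' (j _)
    rw [hF a _ rfl]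

/-- A `Σ*`-extension and an extension without new constants of the same difference field have
a common extension without new constants. -/
theorem IsSigmaStarExt.exists_joint_extension [CharZero F] {σF : F ≃+* F} {σE : E ≃+* E}
    {σH : H ≃+* H} {e : ℕ} {s : Fin e → E} (hE : IsSigmaStarExt σF σE s) (hH : IsDiffExt σF σH)
    (hCH : ∀ c, σH c = c → c ∈ Set.range (algebraMap F H)) :
    ∃ (U : Type u) (_ : Field U) (j : H →+* U) (φ : E →+* U) (σ : U →+* U),
      (∀ x, σ (j x) = j (σH x)) ∧ (∀ x, σ (φ x) = φ (σE x)) ∧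
      (∀ a, φ (algebraMap F E a) = j (algebraMap F H a)) ∧
      ∀ c, σ c = c → ∃ a, j (algebraMap F H a) = c := by
  have : CharZero E := charZero_of_injective_ringHom (algebraMap F E).injective
  have : CharZero H := charZero_of_injective_ringHom (algebraMap F H).injective
  have hCE : ∀ c, σE c = c → c ∈ Set.range (algebraMap F E) := hE.isPiSigmaStarExt.const_mem
  let M : ℕ → Subfield E := fun i =>
    (algebraMap F E).fieldRange ⊔ Subfield.closure (s '' {j | (j : ℕ) < i})
  have hMb : ∀ (i : ℕ) (x : E), x ∈ M i ↔ x ∈ belowField F s i := fun i x =>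
    mem_sup_closure_iff _ x
  have hMmono : Monotone M := fun i j hij => sup_closure_le le_sup_left
    fun x ⟨l, hl, hx⟩ => mem_sup_closure ⟨l, lt_of_lt_of_le hl hij, hx⟩
  have hMsucc : ∀ i : Fin e, M (i + 1) = M i ⊔ Subfield.closure {s i} := by
    intro i
    have h1 : {j : Fin e | (j : ℕ) < i + 1} = insert i {j : Fin e | (j : ℕ) < i} := by
      ext j
      simp [Fin.ext_iff]
      omega
    simp only [M]
    rw [h1, Set.image_insert_eq, sup_closure_insert]
  have hsum : ∀ i : Fin e, σE (s i) - s i ∈ M i := by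
    intro i
    obtain ⟨-, ⟨a, ha, -, h⟩, -⟩ := hE.2.2 i
    rw [hMb, h]
    simpa using ha
  have hstable : ∀ i : ℕ, SigmaStable (σE : E →+* E) (M i) := by
    intro i
    have h0 : SigmaStable (σE : E →+* E) (algebraMap F E).fieldRange := by
      rintro _ ⟨a, rfl⟩
      exact ⟨σF a, (hE.1 a).symm⟩
    refine h0.sup_closure ?_
    rintro _ ⟨j, hj, rfl⟩
    have h1 := hMmono (le_of_lt hj) (hsum j)
    have h2 : s j ∈ M i := mem_sup_closure ⟨j, hj, rfl⟩
    have h3 := add_mem h1 h2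
    rwa [sub_add_cancel] at h3
  -- The generators of `E` are embedded one after the other; each step may enlarge the field
  -- containing `H`.
  have key : ∀ i : ℕ, i ≤ e → HasJointExtension (F := F) σE σH (M i) := by
    intro i hi
    induction i with
    | zero =>
      have : M 0 = (algebraMap F E).fieldRange := by simp [M]
      rw [this]
      exact HasJointExtension.base hE.1 hH
    | succ i ih =>
      have h1 := hMsucc ⟨i, hi⟩
      simp only at h1
      rw [h1]
      refine (ih (by omega)).adjoin hCH le_sup_left (hstable i) ?_ (hsum ⟨i, hi⟩) ?_
      · intro x hx
        exact (le_sup_left : (algebraMap F E).fieldRange ≤ M i) (hCE x hx)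
      · rw [hMb]
        exact hE.isPiSigmaStarExt.diffTower.not_mem_below ⟨i, hi⟩
  obtain ⟨U, _, j, σ, ψ, hj, hC, hψ, hF⟩ := key e le_rfl
  have htop : ∀ x : E, x ∈ M e := by
    intro x
    rw [hMb, belowField_last, hE.2.1]
    trivial
  let φ : E →+* U := ψ.comp ((RingHom.id E).codRestrict (M e) htop)
  refine ⟨U, inferInstance, j, φ, σ, hj, fun x => (hψ _ _ rfl).symm, fun a => hF a _ rfl, ?_⟩
  intro c hc
  obtain ⟨c₀, hc₀, rfl⟩ := hC c hc
  obtain ⟨a, rfl⟩ := hCH c₀ hc₀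
  exact ⟨a, rfl⟩

end SumAdjunction

/-! ### Independence over the tower of sums, for products and for depth-optimal sums. -/

section

variable {G X : Type u} [Field G] [Field X] [Algebra G X] {σ : X ≃+* X} {N : ℕ} {T : Fin N → X}

/-- The coefficient of `Tᵢ` involves only generators of smaller index and smaller depth, so closure
of `S` under these suffices for stability. -/
theorem DiffTower.sigma_mem (hT : DiffTower G σ T) {S : Set (Fin N)}
    (hS : ∀ i ∈ S, ∀ j : Fin N, (j : ℕ) < i → genDepth G σ T j < genDepth G σ T i → j ∈ S) {x : X}
    (hx : x ∈ IntermediateField.adjoin G (T '' S)) :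
    σ x ∈ IntermediateField.adjoin G (T '' S) := by
  induction hx using IntermediateField.adjoin_induction with
  | mem y hy =>
    obtain ⟨i, hi, rfl⟩ := hy
    have h1 : T i ∈ IntermediateField.adjoin G (T '' S) :=
      IntermediateField.subset_adjoin _ _ ⟨i, hi, rfl⟩
    have h2 : genCoeff G σ T i ∈ IntermediateField.adjoin G (T '' S) := by
      refine IntermediateField.adjoin.mono _ _ _ (Set.image_mono ?_) (hT.genCoeff_mem i)
      rintro j ⟨hj, hj'⟩
      refine hS i hi j hj ?_
      rw [hT.genDepth_eq i]
      exact Nat.lt_succ_of_le hj'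
    rcases (hT.genCoeff_spec i).2.2 with ⟨-, h⟩ | ⟨-, h⟩ <;> rw [h]
    · exact add_mem h1 h2
    · exact mul_mem h2 h1
  | algebraMap y =>
    obtain ⟨z, hz⟩ := hT.base y
    rw [← hz]
    exact (IntermediateField.adjoin G (T '' S)).algebraMap_mem z
  | add y z _ _ hy hz => rw [map_add]; exact add_mem hy hz
  | inv y _ hy => rw [map_inv₀]; exact inv_mem hy
  | mul y z _ _ hy hz => rw [map_mul]; exact mul_mem hy hz

theorem DiffTower.elemDepth_sub_le (hT : DiffTower G σ T) (g : X) :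
    elemDepth G σ T (σ g - g) ≤ elemDepth G σ T g := by
  rw [hT.elemDepth_le_iff]
  have h := hT.elemDepth_le_iff.1 (le_refl (elemDepth G σ T g))
  refine sub_mem (hT.sigma_mem ?_ h) h
  intro i hi j _ hj
  exact hj.le.trans hi

theorem DiffTower.pow_not_mem (hT : DiffTower G σ T) {S : Set (Fin N)} {i : Fin N} (hi : i ∉ S)
    {m : ℕ} (hm : 0 < m) : T i ^ m ∉ IntermediateField.adjoin G (T '' S) := by
  intro h
  have h2 := (vars_subset_of_reduced (p := (MvPolynomial.X i ^ m : MvPolynomial (Fin N) G)) (q := 1)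
    hT.indep h isRelPrime_one_right (by simp) (by simp)).1
  have h3 : (MvPolynomial.X i : MvPolynomial (Fin N) G).vars ⊆
      (MvPolynomial.X i ^ m : MvPolynomial (Fin N) G).vars :=
    vars_subset_of_dvd (dvd_pow_self _ hm.ne') (pow_ne_zero _ (MvPolynomial.X_ne_zero i))
  rw [MvPolynomial.vars_X] at h3
  exact hi (h2 (h3 (Finset.mem_singleton_self i)))

variable {U : Type u} [Field U] [Algebra G U] {σU : U →+* U} {P : ℕ → Set U}
  (hT : DiffTower G σ T) (φ : X →ₐ[G] U) (hφ : ∀ x, φ (σ x) = σU (φ x))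
  (hC : ∀ x, σU x = x → x ∈ (algebraMap G U).fieldRange)

theorem image_comp_tower (S : Set (Fin N)) : (φ ∘ T) '' S = φ '' (T '' S) :=
  Set.image_comp _ _ _

include hT hφ in
theorem DiffTower.base_stable : SigmaStable σU (algebraMap G U).fieldRange := by
  rintro _ ⟨x, rfl⟩
  obtain ⟨y, hy⟩ := hT.base x
  refine ⟨y, ?_⟩
  rw [← φ.commutes x, ← hφ, ← hy, φ.commutes]

include hT in
theorem DiffTower.genCoeff_mem_towerFiltr (i : Fin N) :
    φ (genCoeff G σ T i) ∈ (towerFiltr (algebraMap G U).fieldRange (φ ∘ T) (genDepth G σ T) i).lev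
      (elemDepth G σ T (genCoeff G σ T i)) := by
  change _ ∈ _ ⊔ Subfield.closure ((φ ∘ T) '' _)
  rw [image_comp_tower, map_mem_sup_closure_iff]
  exact hT.genCoeff_mem i

include hT hφ in
theorem DiffTower.map_spec (i : Fin N) :
    σU (φ (T i)) = φ (T i) + φ (genCoeff G σ T i) ∨
      σU (φ (T i)) = φ (genCoeff G σ T i) * φ (T i) := by
  rw [← hφ, ← map_add, ← map_mul]
  exact (hT.genCoeff_spec i).2.2.imp (fun h => congrArg φ h.2) (fun h => congrArg φ h.2)

include hT hφ in
/-- Elements of depth at most `k` lie in the `k`-th field of the tower of sums, if this tower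
contains all products of the given tower. -/
theorem DiffTower.map_mem_sumTower
    (hP : ∀ i, φ (T i) ∈ P (elemDepth G σ T (genCoeff G σ T i))) {g : X} {k : ℕ}
    (hg : elemDepth G σ T g ≤ k) : φ g ∈ sumTower σU (algebraMap G U).fieldRange P k := by
  have key : ∀ i, φ (T i) ∈ sumTower σU (algebraMap G U).fieldRange P (genDepth G σ T i) := by
    intro i
    induction i using WellFoundedLT.induction with
    | ind i ih =>
      have hc : φ (genCoeff G σ T i) ∈ sumTower σU (algebraMap G U).fieldRange P
          (elemDepth G σ T (genCoeff G σ T i)) := by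
        refine sup_closure_le (le_sumTower _) ?_ (hT.genCoeff_mem_towerFiltr φ i)
        rintro _ ⟨j, ⟨hj, hj'⟩, rfl⟩
        exact sumTower_mono hj' (ih j hj)
      rw [hT.genDepth_eq i]
      rcases hT.map_spec φ hφ i with h | h
      · exact mem_sumTower_of_sum (by rw [h, add_sub_cancel_left]; exact hc)
      · exact mem_sumTower_of_product (hP i) hc h
  rw [hT.elemDepth_le_iff, ← map_mem_sup_closure_iff φ] at hg
  refine sup_closure_le (le_sumTower _) ?_ hg
  rintro _ ⟨_, ⟨j, hj, rfl⟩, rfl⟩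
  exact sumTower_mono hj (key j)

variable [CharZero U]

include hT hφ hC in
/-- A product of depth greater than `k` is transcendental over the `k`-th field of the tower
of sums, if this contains only the products of depth at most `k`. -/
theorem DiffTower.transcendental_of_product
    (hP : ∀ k, ∀ x ∈ P k, ∃ j, genDepth G σ T j ≤ k + 1 ∧ φ (T j) = x) (i : Fin N)
    (hi : σ (T i) = genCoeff G σ T i * T i) {k : ℕ} (hk : k < genDepth G σ T i) :
    Transcendental ((algebraMap G U).fieldRange ⊔ Subfield.closure ((φ ∘ T) '' {j | (j : ℕ) < i}) ⊔
      sumTower σU (algebraMap G U).fieldRange P k : Subfield U) (φ (T i)) := by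
  set G₀ := (algebraMap G U).fieldRange with hG₀
  -- The field `Q` of these generators is stable, omits `Tᵢ`, and contains all products admitted to
  -- the tower up to level `k`; relative to `Q` that tower adjoins sums only.
  set S : Set (Fin N) := {j | (j : ℕ) < i ∨ genDepth G σ T j ≤ k} with hS
  have hiS : i ∉ S := by
    rintro (h | h)
    · exact lt_irrefl _ h
    · exact absurd h (not_le.2 hk)
  set Q : Subfield U := G₀ ⊔ Subfield.closure (φ '' (T '' S)) with hQ
  have hQs : SigmaStable σU Q := by
    intro y hy
    obtain ⟨x, hx, rfl⟩ := exists_of_mem_sup_closure φ hy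
    rw [← hφ, hQ, map_mem_sup_closure_iff]
    refine hT.sigma_mem ?_ hx
    rintro a (ha | ha) b hb hb'
    · exact Or.inl (hb.trans ha)
    · exact Or.inr (hb'.le.trans ha)
  have hG : SigmaStable σU G₀ := hT.base_stable φ hφ
  have hGQ : G₀ ≤ Q := le_sup_left
  have hAs := sumTower_stable (P := P) hG
  -- products over `Q` do not become trivial by adjoining sums
  have key : ∀ j ≤ k, ∀ u α : U, α ∈ Q → σU u = α * u → u ∈ Q ⊔ sumTower σU G₀ P j → u ∈ Q := by
    intro j hj
    induction j with
    | zero =>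
      intro u α _ _ hu
      have : Q ⊔ sumTower σU G₀ P 0 = Q := sup_eq_left.2 hGQ
      rwa [this] at hu
    | succ j ih =>
      intro u α hα hu hmem
      refine ih (by omega) u α hα hu ?_
      refine mem_of_hyperexponential_of_sums (S := {x | σU x - x ∈ sumTower σU G₀ P j})
        (hQs.sup (hAs j)) (fun x hx => (le_sup_left : Q ≤ _) (hGQ (hC x hx)))
        (fun x hx => (le_sup_right : sumTower σU G₀ P j ≤ _) hx)
        ((le_sup_left : Q ≤ _) hα) ?_ hu
      refine sup_le ((le_sup_left : Q ≤ Q ⊔ sumTower σU G₀ P j).trans le_sup_left) ?_ hmem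
      refine sup_closure_le ((le_sup_right : sumTower σU G₀ P j ≤ Q ⊔ _).trans le_sup_left) ?_
      rintro x (hx | ⟨hx, -⟩)
      · exact mem_sup_closure hx
      -- Products adjoined in passing to level `j + 1` have depth `≤ j + 1 ≤ k` and lie in `Q`
      -- already.
      · obtain ⟨l, hl, rfl⟩ := hP j x hx
        exact le_sup_closure _ _ ((le_sup_left : Q ≤ _)
          (mem_sup_closure ⟨_, ⟨l, Or.inr (hl.trans hj), rfl⟩, rfl⟩))
  have hle : G₀ ⊔ Subfield.closure ((φ ∘ T) '' {j | (j : ℕ) < i}) ⊔ sumTower σU G₀ P k ≤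
      Q ⊔ sumTower σU G₀ P k := by
    refine sup_le_sup_right ?_ _
    rw [image_comp_tower]
    exact sup_le_sup_left (Subfield.closure_mono (Set.image_mono (Set.image_mono
      fun j hj => Or.inl hj))) _
  refine transcendental_mono hle ?_
  by_contra halg
  have hα : φ (genCoeff G σ T i) ∈ Q := by
    rw [hQ, map_mem_sup_closure_iff]
    exact IntermediateField.adjoin.mono _ _ _ (Set.image_mono fun j hj => Or.inl hj.1)
      (hT.genCoeff_mem i)
  have hσ : σU (φ (T i)) = φ (genCoeff G σ T i) * φ (T i) := by rw [← hφ, hi, map_mul]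
  -- Algebraicity would put a power of `Tᵢ` into `Q ⊔ Aₖ`, by `key` into `Q`, against algebraic
  -- independence.
  obtain ⟨m, hm, hmem⟩ := exists_pow_mem_of_not_transcendental (hQs.sup (hAs k))
    (fun x hx => (le_sup_left : Q ≤ _) (hGQ (hC x hx))) ((le_sup_left : Q ≤ _) hα) hσ halg
  have h1 := key k le_rfl (φ (T i) ^ m) _ (pow_mem hα m) (by rw [map_pow, hσ, mul_pow]) hmem
  rw [← map_pow, hQ, map_mem_sup_closure_iff] at h1
  exact hT.pow_not_mem hiS hm h1

include hT hφ hC in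
/-- A depth-optimal sum of depth `k + 1` is transcendental over the `k`-th field of the
tower of sums. -/
theorem DiffTower.transcendental_of_depthOptimal {i : Fin N} (hopt : IsDepthOptimalGen G σ T i)
    (hgood : (towerFiltr (algebraMap G U).fieldRange (φ ∘ T) (genDepth G σ T) i).Good σU
      (algebraMap G U).fieldRange (sumTower σU (algebraMap G U).fieldRange P)) :
    Transcendental ((towerFiltr (algebraMap G U).fieldRange (φ ∘ T) (genDepth G σ T) i).top ⊔
      sumTower σU (algebraMap G U).fieldRange P (elemDepth G σ T (genCoeff G σ T i)) : Subfield U)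
      (φ (T i)) := by
  obtain ⟨σK, hσK, f, hf, hno⟩ := hopt
  have hG := hT.base_stable φ hφ
  have hgc : genCoeff G σ T i = f := by
    rw [genCoeff, if_pos (by rw [hf, add_sub_cancel_left]; exact f.2), hf, add_sub_cancel_left]
  have hΔ : σU (φ (T i)) - φ (T i) = φ f := by rw [← hφ, hf, map_add, add_sub_cancel_left]
  by_contra halg
  -- An algebraic sum already belongs to the field, which makes it a telescoping solution over the
  -- good filtration below `Tᵢ`.
  have hmem := mem_of_sum_of_not_transcendental
    (hgood.stable_top.sup (sumTower_stable (P := P) hG _))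
    (fun x hx => (le_sup_right : sumTower σU _ P _ ≤ _) (le_sumTower _ (hC x hx)))
    (by
      rw [hΔ, ← hgc]
      exact (le_sup_left : (towerFiltr (algebraMap G U).fieldRange (φ ∘ T) (genDepth G σ T) i).top ≤ _)
        (hgood.le_top _ (hT.genCoeff_mem_towerFiltr φ i))) halg
  -- The level bound here is `δ(f)`, precisely what depth-optimality forbids.
  obtain ⟨L, hL, -, hLmem⟩ := Filtr.exists_sumExt_mem hG hC _ _ hgood _ hmem (by
    rw [hΔ, ← hgc]
    exact hgood.le_top _ (hT.genCoeff_mem_towerFiltr φ i))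
  refine hno (hasShallowSolution_of_sumExt hT φ hφ hC i hσK f ?_ hL hLmem hΔ)
  rw [hgc]
  exact (elemDepth_castLE (hT.trunc i hσK) hT (belowField G T i).val hσK i.2.le
    (fun j => rfl) f).le

omit [CharZero U] in
include hT hφ in
theorem DiffTower.good_succ {i : Fin N}
    (hgood : (towerFiltr (algebraMap G U).fieldRange (φ ∘ T) (genDepth G σ T) i).Good σU
      (algebraMap G U).fieldRange (sumTower σU (algebraMap G U).fieldRange P))
    (hP : σU (φ (T i)) = φ (T i) + φ (genCoeff G σ T i) ∨
      φ (T i) ∈ P (elemDepth G σ T (genCoeff G σ T i)))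
    (ht : Transcendental ((towerFiltr (algebraMap G U).fieldRange (φ ∘ T) (genDepth G σ T) i).top ⊔
      sumTower σU (algebraMap G U).fieldRange P (elemDepth G σ T (genCoeff G σ T i)) : Subfield U)
      (φ (T i))) :
    (towerFiltr (algebraMap G U).fieldRange (φ ∘ T) (genDepth G σ T) (i + 1)).Good σU
      (algebraMap G U).fieldRange (sumTower σU (algebraMap G U).fieldRange P) := by
  rw [towerFiltr_succ, hT.genDepth_eq i]
  have hc := hT.genCoeff_mem_towerFiltr φ i
  have hspec := hT.map_spec φ hφ i
  refine hgood.add sumTower_mono hc hspec ?_ ht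
  have hc' := hgood.le_tower _ hc
  have hsum : σU (φ (T i)) = φ (T i) + φ (genCoeff G σ T i) →
      φ (T i) ∈ sumTower σU (algebraMap G U).fieldRange P
        (elemDepth G σ T (genCoeff G σ T i) + 1) := fun h =>
    mem_sumTower_of_sum (by rw [h, add_sub_cancel_left]; exact hc')
  rcases hP with h | h
  · exact hsum h
  · exact hspec.elim hsum (mem_sumTower_of_product h hc')

end

/-! ### Goodness of the depth filtration along a tower. -/

section

variable {G X U : Type u} [Field G] [Field X] [Field U] [Algebra G X] [Algebra G U]

theorem towerFiltr_castLE (G₀ : Subfield U) {n m : ℕ} {h : Fin n → U} {h' : Fin m → U}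
    {δ : Fin n → ℕ} {δ' : Fin m → ℕ} (hnm : n ≤ m) (hh : ∀ j, h' (Fin.castLE hnm j) = h j)
    (hδ : ∀ j, δ' (Fin.castLE hnm j) = δ j) {i : ℕ} (hi : i ≤ n) :
    towerFiltr G₀ h' δ' i = towerFiltr G₀ h δ i := by
  have key : ∀ (p : Fin n → Prop) (p' : Fin m → Prop), (∀ j, p' (Fin.castLE hnm j) ↔ p j) →
      (∀ j, p' j → (j : ℕ) < i) → h' '' {j | p' j} = h '' {j | p j} := by
    intro p p' hp hp'
    ext y
    constructor
    · rintro ⟨j, hj, rfl⟩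
      exact ⟨⟨j, (hp' j hj).trans_le hi⟩, (hp _).1 hj, (hh _).symm⟩
    · rintro ⟨j, hj, rfl⟩
      exact ⟨Fin.castLE hnm j, (hp j).2 hj, hh j⟩
  ext1
  · funext k
    simp only [towerFiltr]
    rw [key (fun j => (j : ℕ) < i ∧ δ j ≤ k) (fun j => (j : ℕ) < i ∧ δ' j ≤ k)
      (fun j => by simp [hδ]) fun j hj => hj.1]
  · simp only [towerFiltr]
    rw [key (fun j => (j : ℕ) < i) (fun j => (j : ℕ) < i) (fun j => by simp) fun j hj => hj]

/-- Induction along the tower. For a depth-optimal sum the required transcendence itself depends on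
goodness of the filtration below it; for a product it is supplied from outside. -/
theorem DiffTower.good_of_le {σ : X ≃+* X} {N : ℕ} {T : Fin N → X} (hT : DiffTower G σ T)
    {σU : U →+* U} {P : ℕ → Set U} [CharZero U] (φ : X →ₐ[G] U) (hφ : ∀ x, φ (σ x) = σU (φ x))
    (hC : ∀ x, σU x = x → x ∈ (algebraMap G U).fieldRange) {m : ℕ}
    (h : ∀ i : Fin N, m ≤ i → IsDepthOptimalGen G σ T i ∨
      φ (T i) ∈ P (elemDepth G σ T (genCoeff G σ T i)) ∧
      Transcendental ((towerFiltr (algebraMap G U).fieldRange (φ ∘ T) (genDepth G σ T) i).top ⊔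
        sumTower σU (algebraMap G U).fieldRange P (elemDepth G σ T (genCoeff G σ T i)) :
          Subfield U) (φ (T i)))
    (hm : (towerFiltr (algebraMap G U).fieldRange (φ ∘ T) (genDepth G σ T) m).Good σU
      (algebraMap G U).fieldRange (sumTower σU (algebraMap G U).fieldRange P))
    {i : ℕ} (hmi : m ≤ i) (hi : i ≤ N) :
    (towerFiltr (algebraMap G U).fieldRange (φ ∘ T) (genDepth G σ T) i).Good σU
      (algebraMap G U).fieldRange (sumTower σU (algebraMap G U).fieldRange P) := by
  induction i, hmi using Nat.le_induction with
  | base => exact hm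
  | succ i hmi ih =>
    have hgood := ih (by omega)
    rcases h ⟨i, hi⟩ hmi with hopt | ⟨hP, htr⟩
    · refine hT.good_succ φ hφ (i := ⟨i, hi⟩) hgood (Or.inl ?_)
        (hT.transcendental_of_depthOptimal φ hφ hC hopt hgood)
      obtain ⟨σK, hσK, f, hf, -⟩ := hopt
      rw [genCoeff, if_pos (by rw [hf, add_sub_cancel_left]; exact f.2), hf,
        add_sub_cancel_left, ← hφ, hf, map_add]
    · exact hT.good_succ φ hφ (i := ⟨i, hi⟩) hgood (Or.inr hP) htr

end

/-! ### The joint extension and the two minimality statements. -/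

section

variable {G F E H : Type u} [Field G] [CharZero G] [Field F] [Field E] [Field H]
  [Algebra G F] [Algebra G E] [Algebra F E] [IsScalarTower G F E]
  [Algebra G H] [Algebra F H] [IsScalarTower G F H]
  {σG : G ≃+* G} {σF : F ≃+* F} {σE : E ≃+* E} {σH : H ≃+* H}
  {n e r : ℕ} {t : Fin n → F} {s : Fin e → E} {x : Fin r → H}

/-- A common extension of a depth-optimal extension `E` and an arbitrary extension `H`, with a
tower of fields that contains the elements of `H` according to their depth, and over which
generators of `E` of larger depth are independent. -/
theorem IsSigmaDeltaExt.exists_joint_extension (hF : IsPiSigmaDeltaExt σG σF t)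
    (hE : IsSigmaDeltaExt G σF σE t s) (hH : IsPiSigmaStarExt σF σH x) :
    ∃ (U : Type u) (_ : Field U) (_ : Algebra G U) (φE : E →ₐ[G] U) (φH : H →ₐ[G] U)
      (σU : U →+* U) (A : ℕ → Subfield U),
      (∀ a, φE (σE a) = σU (φE a)) ∧ (∀ a, φH (σH a) = σU (φH a)) ∧
      (∀ a, φE (algebraMap F E a) = φH (algebraMap F H a)) ∧
      (∀ a, σU a = a → a ∈ (algebraMap G U).fieldRange) ∧
      (∀ h k, elemDepth G σH (towerAppend t x) h ≤ k → φH h ∈ A k) ∧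
      (∀ i, n ≤ i → i ≤ n + e → (towerFiltr (algebraMap G U).fieldRange (φE ∘ towerAppend t s)
        (genDepth G σE (towerAppend t s)) i).Good σU (algebraMap G U).fieldRange A) ∧
      ∀ l : Fin e, Transcendental ((towerFiltr (algebraMap G U).fieldRange
          (φE ∘ towerAppend t s) (genDepth G σE (towerAppend t s)) (n + l)).top ⊔
        A (elemDepth G σE (towerAppend t s)
          (genCoeff G σE (towerAppend t s) (Fin.natAdd n l))) : Subfield U)
        (φE (s l)) := by
  have : CharZero F := charZero_of_injective_algebraMap (algebraMap G F).injective
  have dtF := hF.1.diffTower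
  have dtE := dtF.append hE.1.isPiSigmaStarExt.diffTower hE.1.1
  have dtH := dtF.append hH.diffTower hH.1
  obtain ⟨U, hU, j, φ, σU, hj, hφ, hcomm, hconst⟩ :=
    hE.1.exists_joint_extension hH.1 hH.diffTower.const
  let : Algebra G U := (j.comp (algebraMap G H)).toAlgebra
  have : CharZero U := charZero_of_injective_algebraMap (algebraMap G U).injective
  let φH : H →ₐ[G] U := { j with commutes' := fun _ => rfl }
  let φE : E →ₐ[G] U := { φ with
    commutes' := fun a => by
      change φ (algebraMap G E a) = j (algebraMap G H a)
      rw [IsScalarTower.algebraMap_apply G F E, hcomm, ← IsScalarTower.algebraMap_apply] }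
  let φF : F →ₐ[G] U := φE.comp (IsScalarTower.toAlgHom G F E)
  have hφE : ∀ a, φE (σE a) = σU (φE a) := fun a => (hφ a).symm
  have hφH : ∀ a, φH (σH a) = σU (φH a) := fun a => (hj a).symm
  have hφF : ∀ a, φF (σF a) = σU (φF a) := fun a => by
    change φE (algebraMap F E (σF a)) = σU (φE (algebraMap F E a))
    rw [← hφE, hE.1.1]
  have hEH : ∀ a, φE (algebraMap F E a) = φH (algebraMap F H a) := hcomm
  have hC : ∀ a, σU a = a → a ∈ (algebraMap G U).fieldRange := by
    intro a ha
    obtain ⟨b, hb⟩ := hconst a ha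
    have hb' : φF b = a := (hEH b).trans hb
    have hbσ : σF b = b := φF.injective ((hφF b).trans
      ((congrArg σU hb').trans (ha.trans hb'.symm)))
    obtain ⟨c, rfl⟩ := dtF.const b hbσ
    exact ⟨c, by rw [← hb', φF.commutes]⟩
  -- All generators of `H` of depth `≤ k + 1`, including those of `F`. Products of `H` must be
  -- admitted at their depth for `A` to capture elements of `H`, but not earlier, or products of `F`
  -- would lose their independence.
  let P : ℕ → Set U := fun k =>
    {y | ∃ j, genDepth G σH (towerAppend t x) j ≤ k + 1 ∧ φH (towerAppend t x j) = y}
  have hFH : ∀ a, φH (algebraMap F H a) = φF a := fun a => (hEH a).symm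
  have hδH : ∀ i : Fin n, genDepth G σH (towerAppend t x) (Fin.castLE (Nat.le_add_right n r) i) =
      genDepth G σF t i :=
    genDepth_castLE dtF dtH (IsScalarTower.toAlgHom G F H) (fun a => (hH.1 a).symm)
      (Nat.le_add_right n r) fun i => towerAppend_castAdd i
  have hδE : ∀ i : Fin n, genDepth G σE (towerAppend t s) (Fin.castLE (Nat.le_add_right n e) i) =
      genDepth G σF t i :=
    genDepth_castLE dtF dtE (IsScalarTower.toAlgHom G F E) (fun a => (hE.1.1 a).symm)
      (Nat.le_add_right n e) fun i => towerAppend_castAdd i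
  have hgoodF : (towerFiltr (algebraMap G U).fieldRange (φF ∘ t) (genDepth G σF t) n).Good σU
      (algebraMap G U).fieldRange (sumTower σU (algebraMap G U).fieldRange P) := by
    refine dtF.good_of_le φF hφF hC (m := 0) (fun i _ => ?_) ?_ (Nat.zero_le _) le_rfl
    · by_cases hi : IsSigmaStarGen G σF t i
      · exact Or.inl (hF.2 i hi)
      · have hi' := (hF.1.2.2 i).resolve_left hi
        obtain ⟨hmem, h0, h | ⟨-, h⟩⟩ := dtF.genCoeff_spec i
        · exact absurd ⟨hi'.1, ⟨_, hmem, h0, h.2⟩, hi'.2.2⟩ hi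
        · refine Or.inr ⟨⟨Fin.castLE (Nat.le_add_right n r) i, ?_, ?_⟩, ?_⟩
          · rw [hδH, dtF.genDepth_eq]
          · exact (congrArg φH (towerAppend_castAdd i)).trans (hFH _)
          -- Independence of a product of `F` is shown in the tower of `H`, because `P` also
          -- contains the generators of `H` beyond `F`.
          · have h1 := dtH.transcendental_of_product φH hφH hC (P := P) (fun k y hy => hy)
              (Fin.castLE (Nat.le_add_right n r) i)
              (k := elemDepth G σF t (genCoeff G σF t i)) (by
                rw [genCoeff_castLE (IsScalarTower.toAlgHom G F H) (fun a => (hH.1 a).symm)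
                  (Nat.le_add_right n r) (fun i => towerAppend_castAdd i) i]
                change σH (towerAppend t x (Fin.castAdd r i)) =
                  algebraMap F H _ * towerAppend t x (Fin.castAdd r i)
                rw [towerAppend_castAdd, hH.1, h, map_mul]) (by
                rw [hδH, dtF.genDepth_eq]; exact Nat.lt_succ_self _)
            have h2 : φH (towerAppend t x (Fin.castLE (Nat.le_add_right n r) i)) = φF (t i) :=
              (congrArg φH (towerAppend_castAdd i)).trans (hFH _)
            rw [h2] at h1
            have h3 := towerFiltr_castLE (algebraMap G U).fieldRange (h := φF ∘ t)
              (h' := φH ∘ towerAppend t x) (Nat.le_add_right n r)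
              (fun i => (congrArg φH (towerAppend_castAdd i)).trans (hFH _)) hδH i.2.le
            rw [← h3]
            exact h1
    · rw [towerFiltr_zero]
      exact Filtr.good_base (dtF.base_stable φF hφF)
  have hgoodE : ∀ i, n ≤ i → i ≤ n + e → (towerFiltr (algebraMap G U).fieldRange
      (φE ∘ towerAppend t s) (genDepth G σE (towerAppend t s)) i).Good σU
      (algebraMap G U).fieldRange (sumTower σU (algebraMap G U).fieldRange P) := by
    intro i hni hi
    refine dtE.good_of_le φE hφE hC (m := n) (fun i => ?_) ?_ hni hi
    · induction i using Fin.addCases with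
      | left i => exact fun h => absurd i.2 (not_lt.2 h)
      | right l => exact fun _ => Or.inl (hE.2 l)
    · rwa [towerFiltr_castLE (algebraMap G U).fieldRange (h := φF ∘ t) (δ := genDepth G σF t)
        (Nat.le_add_right n e) (fun i => congrArg φE (towerAppend_castAdd i)) hδE le_rfl]
  refine ⟨U, hU, inferInstance, φE, φH, σU, sumTower σU (algebraMap G U).fieldRange P, hφE, hφH,
    hEH, hC, fun h k hk => dtH.map_mem_sumTower φH hφH (fun i => ?_) hk, hgoodE, fun l => ?_⟩
  · exact ⟨i, (dtH.genDepth_eq i).le, rfl⟩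
  · have h := dtE.transcendental_of_depthOptimal φE hφE hC (hE.2 l)
      (hgoodE _ (Nat.le_add_right n l) (by simp))
    rwa [towerAppend_natAdd] at h

/-- In the joint extension `g` and `g'` differ by a constant, so `g` lies in `A` at level `δ(g')`;
goodness brings it down to the field generated by generators of `E` of depth `≤ δ(g')`. -/
theorem IsSigmaDeltaExt.elemDepth_le (hF : IsPiSigmaDeltaExt σG σF t)
    (hE : IsSigmaDeltaExt G σF σE t s) (hH : IsPiSigmaStarExt σF σH x) {f : F} {g : E} {g' : H}
    (hg : σE g - g = algebraMap F E f) (hg' : σH g' - g' = algebraMap F H f) :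
    elemDepth G σE (towerAppend t s) g ≤ elemDepth G σH (towerAppend t x) g' := by
  have dtE := hF.1.diffTower.append hE.1.isPiSigmaStarExt.diffTower hE.1.1
  obtain ⟨U, _, _, φE, φH, σU, A, hφE, hφH, hEH, hC, hA, hgood, -⟩ :=
    hE.exists_joint_extension hF hH
  have hc : φE g - φH g' ∈ (algebraMap G U).fieldRange := hC _ (by
    have := hEH f
    rw [← hg, ← hg', map_sub, map_sub, hφE, hφH] at this
    rw [map_sub]
    linear_combination this)
  have hn := hgood (n + e) (Nat.le_add_right n e) le_rfl
  have h1 : φE g ∈ A (elemDepth G σH (towerAppend t x) g') := by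
    have := add_mem ((hn.base_le _).trans (hn.le_tower _) hc) (hA g' _ le_rfl)
    simpa using this
  have h2 : φE g ∈ (towerFiltr (algebraMap G U).fieldRange (φE ∘ towerAppend t s)
      (genDepth G σE (towerAppend t s)) (n + e)).top := by
    change _ ∈ _ ⊔ Subfield.closure _
    rw [image_comp_tower, map_mem_sup_closure_iff, ← belowField_eq_adjoin_image, belowField_last]
    exact dtE.mem_range g
  have h3 := (hn.lift _).mem_of_mem (hn.le_tower _) h1 h2
  rw [dtE.elemDepth_le_iff, ← map_mem_sup_closure_iff φE, ← image_comp_tower]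
  refine sup_le_sup_left (Subfield.closure_mono (Set.image_mono ?_)) _ h3
  exact fun j hj => hj.2

/-- If `H` were shallower than the last generator `sₗ`, of depth `k + 1`, then all of `H` would lie
in `B ⊔ A k`, with `B` the field below `sₗ`. So would `g`, which then cannot involve `sₗ`. -/
theorem IsSigmaDeltaExt.extDepth_le (hF : IsPiSigmaDeltaExt σG σF t)
    (hE : IsSigmaDeltaExt G σF σE t s) (hH : IsPiSigmaStarExt σF σH x) {f : F} {g : E} {g' : H}
    (hg : σE g - g = algebraMap F E f) (hg' : σH g' - g' = algebraMap F H f)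
    (hl : ∀ l : Fin e, (l : ℕ) + 1 = e →
      genDepth G σE (towerAppend t s) (Fin.natAdd n l) = extDepth G σE t s ∧
        g ∉ belowField F s l) :
    extDepth G σE t s ≤ extDepth G σH t x := by
  rcases Nat.eq_zero_or_pos e with rfl | he
  · simp [extDepth]
  have dtF := hF.1.diffTower
  have dtE := dtF.append hE.1.isPiSigmaStarExt.diffTower hE.1.1
  have dtH := dtF.append hH.diffTower hH.1
  obtain ⟨l, hle⟩ : ∃ l : Fin e, (l : ℕ) + 1 = e := ⟨⟨e - 1, by omega⟩, by simp; omega⟩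
  obtain ⟨hdepth, hnot⟩ := hl l hle
  by_contra! hlt
  rw [← hdepth, dtE.genDepth_eq, Nat.lt_succ_iff] at hlt
  obtain ⟨U, _, _, φE, φH, σU, A, hφE, hφH, hEH, hC, hA, hgood, htr⟩ :=
    hE.exists_joint_extension hF hH
  have hn := hgood (n + l) (Nat.le_add_right n l) (by omega)
  have ht := htr l
  set k := elemDepth G σE (towerAppend t s) (genCoeff G σE (towerAppend t s) (Fin.natAdd n l))
  set B := (towerFiltr (algebraMap G U).fieldRange (φE ∘ towerAppend t s)
    (genDepth G σE (towerAppend t s)) (n + l)).top with hB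
  have hGB : (algebraMap G U).fieldRange ≤ B := (hn.base_le 0).trans (hn.le_top 0)
  have hmemB : ∀ a, φE a ∈ B ↔ a ∈ belowField F s l := by
    intro a
    rw [← mem_belowField_towerAppend dtF.top, belowField_eq_adjoin_image,
      ← map_mem_sup_closure_iff φE, ← image_comp_tower]
    rfl
  have hc : φE g - φH g' ∈ (algebraMap G U).fieldRange := hC _ (by
    have := hEH f
    rw [← hg, ← hg', map_sub, map_sub, hφE, hφH] at this
    rw [map_sub]
    linear_combination this)
  -- Generators coming from `F` lie in `B` whatever their depth; those of `H` over `F` have depth `≤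
  -- k` and lie in `A k`.
  have hHB : φH g' ∈ B ⊔ A k := by
    have h1 : φH g' ∈ (algebraMap G U).fieldRange ⊔
        Subfield.closure (φH '' Set.range (towerAppend t x)) :=
      (map_mem_sup_closure_iff φH _ _).2 (dtH.mem_range g')
    refine sup_closure_le (hGB.trans le_sup_left) ?_ h1
    rintro _ ⟨_, ⟨i, rfl⟩, rfl⟩
    induction i using Fin.addCases with
    | left i =>
      rw [towerAppend_castAdd, ← hEH]
      exact (le_sup_left : B ≤ _) ((hmemB _).2 ((belowField F s l).algebraMap_mem _))
    | right i =>
      refine (le_sup_right : A k ≤ _) (hA _ _ ?_)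
      rw [dtH.elemDepth_le_iff]
      refine IntermediateField.subset_adjoin _ _ ⟨Fin.natAdd n i, ?_, rfl⟩
      exact (Finset.le_sup (f := fun i : Fin r => genDepth G σH (towerAppend t x)
        (Fin.natAdd n i)) (Finset.mem_univ i)).trans hlt
  have hgB : φE g ∈ B ⊔ A k := by
    have := add_mem ((le_sup_left : B ≤ B ⊔ A k) (hGB hc)) hHB
    simpa using this
  have hgtop : φE g ∈ B ⊔ Subfield.closure {φE (s l)} := by
    have h1 := congrArg Filtr.top (towerFiltr_succ (algebraMap G U).fieldRange
      (φE ∘ towerAppend t s) (genDepth G σE (towerAppend t s)) (Fin.natAdd n l))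
    have h2 : φE g ∈ (towerFiltr (algebraMap G U).fieldRange (φE ∘ towerAppend t s)
        (genDepth G σE (towerAppend t s)) ((Fin.natAdd n l : Fin (n + e)) + 1)).top := by
      change _ ∈ _ ⊔ Subfield.closure _
      rw [image_comp_tower, map_mem_sup_closure_iff, ← belowField_eq_adjoin_image]
      have h3 : ((Fin.natAdd n l : Fin (n + e)) : ℕ) + 1 = n + e := by simp; omega
      rw [h3, belowField_last]
      exact dtE.mem_range g
    rw [h1] at h2
    change _ ∈ B ⊔ Subfield.closure {φE (towerAppend t s (Fin.natAdd n l))} at h2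
    rwa [towerAppend_natAdd] at h2
  -- `B(sₗ)` and `B ⊔ A k` meet in `B`, since `sₗ` is transcendental over the latter field.
  exact hnot ((hmemB g).1 (mem_of_mem_adjoin_transcendental le_sup_left ht hgB hgtop))

end

theorem mainTheorem5 {G F E : Type u} [Field G] [CharZero G] [Field F] [Field E]
    [Algebra G F] [Algebra G E] [Algebra F E] [IsScalarTower G F E]
    (σG : G ≃+* G) (σF : F ≃+* F) (σE : E ≃+* E)
    {n : ℕ} (t : Fin n → F) (hF : IsPiSigmaDeltaExt σG σF t)
    {e : ℕ} (s : Fin e → E) (hE : IsSigmaDeltaExt G σF σE t s)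
    (f : F) (g : E) (hg : σE g - g = algebraMap F E f) :
    -- (1) minimal depth of the solution
    (∀ (H : Type u) [Field H] [Algebra G H] [Algebra F H] [IsScalarTower G F H] (σH : H ≃+* H)
      (r : ℕ) (x : Fin r → H), IsPiSigmaStarExt σF σH x →
      ∀ g' : H, σH g' - g' = algebraMap F H f →
        elemDepth G σE (towerAppend t s) g ≤ elemDepth G σH (towerAppend t x) g') ∧
    -- hence `E` with `g` solves DOT, whenever DOT can be solved at all
    ((∃ (H : Type u) (_ : Field H) (_ : Algebra G H) (_ : Algebra F H) (_ : IsScalarTower G F H)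
      (σH : H ≃+* H) (r : ℕ) (x : Fin r → H) (g' : H), SolvesDOT G σF σH t x f g') →
      SolvesDOT G σF σE t s f g) ∧
    -- (2) minimal extension depth, if the top generator has maximal depth and `g` involves it
    -- (no condition if there are no generators)
    ((∀ l : Fin e, (l : ℕ) + 1 = e →
        genDepth G σE (towerAppend t s) (Fin.natAdd n l) = extDepth G σE t s ∧
        g ∉ belowField F s l) →
      (∀ (H : Type u) [Field H] [Algebra G H] [Algebra F H] [IsScalarTower G F H] (σH : H ≃+* H)
        (r : ℕ) (x : Fin r → H), IsPiSigmaStarExt σF σH x →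
        (∃ g' : H, σH g' - g' = algebraMap F H f) →
          extDepth G σE t s ≤ extDepth G σH t x) ∧
      -- hence `E` with `g` solves DOT*
      SolvesDOTStar G σF σE t s f g) := by

  have part1 : ∀ (H : Type u) [Field H] [Algebra G H] [Algebra F H] [IsScalarTower G F H]
      (σH : H ≃+* H) (r : ℕ) (x : Fin r → H), IsPiSigmaStarExt σF σH x →
      ∀ g' : H, σH g' - g' = algebraMap F H f →
        elemDepth G σE (towerAppend t s) g ≤ elemDepth G σH (towerAppend t x) g' :=
    fun H _ _ _ _ σH r x hH g' hg' => hE.elemDepth_le hF hH hg hg'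
  refine ⟨part1, ?_, fun hl => ?_⟩
  · rintro ⟨H, _, _, _, _, σH, r, x, g', hH, hg', hdepth⟩
    refine ⟨hE.1, hg, le_antisymm ?_ ?_⟩
    · rw [← hdepth]
      exact part1 H σH r x hH.isPiSigmaStarExt g' hg'
    -- The reverse inequality `δ(f) ≤ δ(g)` holds for every solution, because `σ` does not raise
    -- depth.
    · have dtF := hF.1.diffTower
      have dtE := dtF.append hE.1.isPiSigmaStarExt.diffTower hE.1.1
      have h := elemDepth_castLE dtF dtE (IsScalarTower.toAlgHom G F E)
        (fun a => (hE.1.1 a).symm) (Nat.le_add_right n e) (fun i => towerAppend_castAdd i) f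
      rw [← h]
      change elemDepth G σE (towerAppend t s) (algebraMap F E f) ≤ _
      rw [← hg]
      exact dtE.elemDepth_sub_le g
  · have part2 : ∀ (H : Type u) [Field H] [Algebra G H] [Algebra F H] [IsScalarTower G F H]
        (σH : H ≃+* H) (r : ℕ) (x : Fin r → H), IsPiSigmaStarExt σF σH x →
        (∃ g' : H, σH g' - g' = algebraMap F H f) → extDepth G σE t s ≤ extDepth G σH t x :=
      fun H _ _ _ _ σH r x hH ⟨g', hg'⟩ => hE.extDepth_le hF hH hg hg' hl
    exact ⟨part2, hE.1, hg, fun H _ _ _ _ σH r x hH => part2 H σH r x hH.isPiSigmaStarExt⟩
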